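/- Let $G$ be a locally compact (Hausdorff) group with left Haar measure $dx$. A weight function on $G$ is a continuous $\omega\colon G\to[1,\infty)$ with $\omega(xy)\le\omega(x)\omega(y)$ and $\omega(e)=1$; put $\omega^*(x)=\omega(x)\omega(x^{-1})$. Let $L^1(G,\omega)$ be the Banach algebra, under convolution, of (classes of) measurable $f$ with $\|f\|_\omega=\int_G|f|\,\omega\,dx<\infty$, and let $L^\infty(G,1/\omega)$ be the set of Borel functions $h\colon G\to\mathbb C$ with $h/\omega$ essentially bounded. A Banach algebra $A$ is weakly amenable if every bounded derivation $D\colon A\to A^*$ (i.e. $D(ab)=D(a)\cdot b+a\cdot D(b)$) is of the form $D(a)=z\cdot a-a\cdot z$ for some $z\in A^*$. A Borel function $p\colon G\times G\to\mathbb C$ is quasi-additive if $p(xy,z)=p(x,yz)+p(y,zx)$ for almost all $x,y,z\in G$; $I(G,\omega)$ denotes the set of quasi-additive $p$ for which there is $h\in L^\infty(G,1/\omega)$ with $p(x,y)=h(xy)-h(yx)$ for almost all $x,y\in G$. (Null sets are understood locally: a set is null if it meets every compact set in a set of Haar measure zero.) **Proposition 3.3 and Corollary 3.4.** Let $\omega_1,\omega_2$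 be weight functions on $G$. Suppose first that $\omega_1\le m\,\omega_2$ for some $m>0$. Then: (i) if $L^1(G,\omega_2)$ is weakly amenable and $I(G,\omega_1)=I(G,\omega_2)$, then $L^1(G,\omega_1)$ is weakly amenable; (ii) if $\omega_2$ or $\omega_2^*$ is bounded, then $L^1(G,\omega_1)$ is weakly amenable. Moreover, if $\omega_1$ and $\omega_2$ are equivalent, that is, $m\,\omega_1\le\omega_2\le n\,\omega_1$ for some $m,n>0$, then $L^1(G,\omega_1)$ is weakly amenable if and only if $L^1(G,\omega_2)$ is weakly amenable. -/

import Mathlib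

open MeasureTheory Set Filter Topology
open scoped ENNReal

set_option linter.unusedSectionVars false

noncomputable section

/-! ### Weak amenability of a Banach algebra -/

section WeakAmenability

variable {A : Type*} [NonUnitalNormedRing A] [NormedSpace ℂ A]

/-- A bounded linear map `D : A → A*` is a derivation if `D (a b) = D a · b + a · D b`, where `A*`
carries its usual `A`-bimodule structure `(a · z) c = z (c a)`, `(z · a) c = z (a c)`. -/
def IsDualDerivation (D : A →L[ℂ] StrongDual ℂ A) : Prop :=
  ∀ a b c : A, D (a * b) c = D a (b * c) + D b (c * a)

/-- `D` is inner if, for some `z ∈ A*`, `D a = z · a - a · z` for all `a`. -/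
def IsInnerDualDerivation (D : A →L[ℂ] StrongDual ℂ A) : Prop :=
  ∃ z : StrongDual ℂ A, ∀ a c : A, D a c = z (a * c) - z (c * a)

variable (A) in
/-- A Banach algebra `A` is weakly amenable if every bounded derivation `A → A*` is inner. -/
def WeaklyAmenable : Prop :=
  ∀ D : A →L[ℂ] StrongDual ℂ A, IsDualDerivation D → IsInnerDualDerivation D

end WeakAmenability

/-! ### Weight functions -/

/-- A weight function on a topological group `G`: a continuous submultiplicative function
`ω : G → [1, ∞)` with `ω e = 1`. -/
structure GroupWeight (G : Type*) [Group G] [TopologicalSpace G] where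
  toFun : G → ℝ
  continuous_toFun : Continuous toFun
  one_le_toFun : ∀ x, 1 ≤ toFun x
  toFun_mul_le : ∀ x y, toFun (x * y) ≤ toFun x * toFun y
  toFun_one : toFun 1 = 1

namespace GroupWeight

section Basic

variable {G : Type*} [Group G] [TopologicalSpace G]

instance : CoeFun (GroupWeight G) (fun _ => G → ℝ) := ⟨GroupWeight.toFun⟩

/-- The weight `ω*(x) = ω(x) ω(x⁻¹)`. -/
def adj [IsTopologicalGroup G] (ω : GroupWeight G) : GroupWeight G where
  toFun x := ω x * ω x⁻¹
  continuous_toFun := ω.continuous_toFun.mul (ω.continuous_toFun.comp continuous_inv)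
  one_le_toFun x := one_le_mul_of_one_le_of_one_le (ω.one_le_toFun x) (ω.one_le_toFun x⁻¹)
  toFun_mul_le x y := by
    have h0 : ∀ z, 0 ≤ ω z := fun z => zero_le_one.trans (ω.one_le_toFun z)
    calc ω (x * y) * ω (x * y)⁻¹ ≤ (ω x * ω y) * (ω y⁻¹ * ω x⁻¹) := by
          refine mul_le_mul (ω.toFun_mul_le x y) ?_ (h0 _) (mul_nonneg (h0 _) (h0 _))
          rw [mul_inv_rev]
          exact ω.toFun_mul_le _ _
      _ = (ω x * ω x⁻¹) * (ω y * ω y⁻¹) := by ring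
  toFun_one := by simp [ω.toFun_one]

/-- Two weights are equivalent if `m ω₁ ≤ ω₂ ≤ n ω₁` for some `m, n > 0`. -/
def Equivalent (ω₁ ω₂ : GroupWeight G) : Prop :=
  ∃ m n : ℝ, 0 < m ∧ 0 < n ∧ ∀ x, m * ω₁ x ≤ ω₂ x ∧ ω₂ x ≤ n * ω₁ x

/-- `ω` is a bounded function. -/
def IsBounded (ω : GroupWeight G) : Prop := ∃ C : ℝ, ∀ x, ω x ≤ C

end Basic

end GroupWeight

/-! ### The Beurling algebra `L¹(G, ω)` -/

section Approximation

/-- Density of `C_c` in `L¹` of a Radon measure. -/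
theorem exists_cc_eLpNorm_one_sub_le {X : Type*} [TopologicalSpace X] [LocallyCompactSpace X]
    [T2Space X] [MeasurableSpace X] [BorelSpace X] (μ : Measure X) [μ.Regular] {f : X → ℂ}
    (hf : MemLp f 1 μ) {ε : ℝ≥0∞} (hε : ε ≠ 0) :
    ∃ g : X → ℂ, eLpNorm (f - g) 1 μ ≤ ε ∧ Continuous g ∧ HasCompactSupport g := by
  refine hf.induction_dense ENNReal.one_ne_top (fun g => Continuous g ∧ HasCompactSupport g)
    ?_ ?_ ?_ hε
  · intro c t ht htμ ε hε
    have hc : (‖c‖ₑ + 1) ≠ 0 := by simp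
    have hc' : (‖c‖ₑ + 1) ≠ ∞ := by simp
    set δ : ℝ≥0∞ := ε / (‖c‖ₑ + 1) / 2 with hδ
    have hδ0 : δ ≠ 0 := by simp [hδ, hε]
    obtain ⟨K, hKt, hK, hKμ⟩ := ht.exists_isCompact_sdiff_lt htμ.ne hδ0
    have hKfin : μ K ≠ ∞ := hK.measure_lt_top.ne
    obtain ⟨U, hKU, hU, hUμ⟩ := hK.exists_isOpen_lt_add (μ := μ) hδ0
    have hUK : μ (U \ K) ≤ δ := by
      rw [measure_sdiff hKU hK.measurableSet.nullMeasurableSet hKfin]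
      exact tsub_le_iff_left.2 hUμ.le
    obtain ⟨φ, hφK, hφU, hφs, hφI⟩ := exists_continuous_one_zero_of_isCompact hK
      hU.isClosed_compl (disjoint_compl_right_iff_subset.2 hKU)
    refine ⟨fun x => (φ x : ℂ) * c, ?_, by fun_prop, ?_⟩
    · have hb : ∀ x, ‖((fun x => (φ x : ℂ) * c) - t.indicator fun _ => c) x‖ₑ ≤
          ((U \ K) ∪ (t \ K)).indicator (fun _ => ‖c‖ₑ) x := by
        intro x
        by_cases hxK : x ∈ K
        · have h1 : φ x = 1 := hφK hxK
          simp [h1, hKt hxK]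
        · by_cases hx : x ∈ (U \ K) ∪ (t \ K)
          · rw [indicator_of_mem hx]
            rw [enorm_le_iff_norm_le]
            have h01 := hφI x
            by_cases hxt : x ∈ t
            · simp only [Pi.sub_apply, indicator_of_mem hxt]
              rw [show (φ x : ℂ) * c - c = ((φ x - 1 : ℝ) : ℂ) * c by push_cast; ring, norm_mul,
                Complex.norm_real]
              refine mul_le_of_le_one_left (norm_nonneg _) ?_
              rw [Real.norm_eq_abs, abs_le]
              constructor <;> linarith [h01.1, h01.2]
            · simp only [Pi.sub_apply, indicator_of_notMem hxt, sub_zero, norm_mul,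
                Complex.norm_real]
              refine mul_le_of_le_one_left (norm_nonneg _) ?_
              rw [Real.norm_eq_abs, abs_le]
              constructor <;> linarith [h01.1, h01.2]
          · have hxU : x ∉ U := fun h => hx (Or.inl ⟨h, hxK⟩)
            have hxt : x ∉ t := fun h => hx (Or.inr ⟨h, hxK⟩)
            have h0 : φ x = 0 := hφU hxU
            simp [h0, hxt]
      rw [eLpNorm_one_eq_lintegral_enorm]
      calc ∫⁻ x, ‖((fun x => (φ x : ℂ) * c) - t.indicator fun _ => c) x‖ₑ ∂μ
          ≤ ∫⁻ x, ((U \ K) ∪ (t \ K)).indicator (fun _ => ‖c‖ₑ) x ∂μ := lintegral_mono hb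
        _ = ‖c‖ₑ * μ ((U \ K) ∪ (t \ K)) := by
            rw [lintegral_indicator_const]
            exact (hU.measurableSet.diff hK.measurableSet).union (ht.diff hK.measurableSet)
        _ ≤ (‖c‖ₑ + 1) * (δ + δ) := by
            gcongr
            · exact le_self_add
            · exact (measure_union_le _ _).trans (add_le_add hUK hKμ.le)
        _ = ε := by
            rw [hδ, ENNReal.add_halves]
            exact ENNReal.mul_div_cancel hc hc'
    · refine HasCompactSupport.intro hφs fun x hx => ?_
      simp [image_eq_zero_of_notMem_tsupport hx]
  · rintro f g ⟨hf, hf'⟩ ⟨hg, hg'⟩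
    exact ⟨hf.add hg, hf'.add hg'⟩
  · rintro f ⟨hf, hf'⟩
    exact (hf.stronglyMeasurable_of_hasCompactSupport hf').aestronglyMeasurable

end Approximation

section Beurling

variable {G : Type*} [Group G] [TopologicalSpace G] [IsTopologicalGroup G] [LocallyCompactSpace G]
  [MeasurableSpace G] [BorelSpace G]

/-- The measure `ω(x) dx`, where `dx` is left Haar measure. -/
def GroupWeight.measure (ω : GroupWeight G) : Measure G :=
  (Measure.haar : Measure G).withDensity (fun x => ENNReal.ofReal (ω x))

/-- `L¹(G, ω)`: the (classes of) functions `f` with `ω f ∈ L¹(G)`, with the norm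
`‖f‖ = ∫ |f(x)| ω(x) dx`. -/
def BeurlingAlgebra (ω : GroupWeight G) : Type _ := Lp ℂ 1 ω.measure

namespace BeurlingAlgebra

variable {ω : GroupWeight G}

instance : NormedAddCommGroup (BeurlingAlgebra ω) :=
  inferInstanceAs (NormedAddCommGroup (Lp ℂ 1 ω.measure))

instance : NormedSpace ℂ (BeurlingAlgebra ω) :=
  inferInstanceAs (NormedSpace ℂ (Lp ℂ 1 ω.measure))

instance : CompleteSpace (BeurlingAlgebra ω) :=
  inferInstanceAs (CompleteSpace (Lp ℂ 1 ω.measure))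

instance : CoeFun (BeurlingAlgebra ω) (fun _ => G → ℂ) :=
  ⟨fun f => ((f.1 : G →ₘ[ω.measure] ℂ) : G → ℂ)⟩

/-- The class of a function `f` with `ω f` integrable. -/
def mk (f : G → ℂ) (hf : MemLp f 1 ω.measure) : BeurlingAlgebra ω := hf.toLp f

theorem memLp (f : BeurlingAlgebra ω) : MemLp f 1 ω.measure := Lp.memLp (E := ℂ) f

theorem weight_pos (ω : GroupWeight G) (x : G) : 0 < ω x := zero_lt_one.trans_le (ω.one_le_toFun x)

theorem ae_eq (ω : GroupWeight G) : ae ω.measure = ae (Measure.haar : Measure G) := by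
  have hm : Measurable fun x => ENNReal.ofReal (ω x) :=
    ω.continuous_toFun.measurable.ennreal_ofReal
  refine le_antisymm (withDensity_absolutelyContinuous _ _).ae_le
    (withDensity_absolutelyContinuous' hm.aemeasurable ?_).ae_le
  exact Eventually.of_forall fun x => by simpa using weight_pos ω x

theorem lintegral_measure (ω : GroupWeight G) (f : G → ℝ≥0∞) :
    ∫⁻ x, f x ∂ω.measure = ∫⁻ x, ENNReal.ofReal (ω x) * f x ∂Measure.haar :=
  lintegral_withDensity_eq_lintegral_mul_non_measurable _
    ω.continuous_toFun.measurable.ennreal_ofReal (by simp) f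

theorem coeFn_mk (f : G → ℂ) (hf : MemLp f 1 ω.measure) :
    mk f hf =ᵐ[(Measure.haar : Measure G)] f := by
  have h : mk f hf =ᵐ[ω.measure] f := MemLp.coeFn_toLp hf
  rwa [EventuallyEq, ae_eq] at h

theorem ext_ae {f g : BeurlingAlgebra ω} (h : f =ᵐ[(Measure.haar : Measure G)] g) : f = g := by
  rw [EventuallyEq, ← ae_eq ω] at h
  exact Lp.ext (E := ℂ) h

theorem enorm_eq (f : BeurlingAlgebra ω) :
    ENNReal.ofReal ‖f‖ = ∫⁻ x, ENNReal.ofReal (ω x) * ‖f x‖ₑ ∂Measure.haar := by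
  rw [← lintegral_measure, ← eLpNorm_one_eq_lintegral_enorm]
  exact ENNReal.ofReal_toReal (memLp f).eLpNorm_ne_top

theorem aestronglyMeasurable (f : BeurlingAlgebra ω) :
    AEStronglyMeasurable f (Measure.haar : Measure G) :=
  (memLp f).aestronglyMeasurable.mono_ac (Measure.ae_le_iff_absolutelyContinuous.1 (ae_eq ω).ge)

theorem integrable_weight_mul_norm (f : BeurlingAlgebra ω) :
    Integrable (fun x => ω x * ‖f x‖) (Measure.haar : Measure G) := by
  refine ⟨ω.continuous_toFun.measurable.aestronglyMeasurable.mul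
    (aestronglyMeasurable f).norm, ?_⟩
  have := enorm_eq f
  rw [hasFiniteIntegral_iff_enorm]
  refine lt_of_le_of_lt (le_of_eq ?_) (this ▸ ENNReal.ofReal_lt_top)
  refine lintegral_congr fun x => ?_
  rw [enorm_mul, enorm_norm, Real.enorm_of_nonneg (weight_pos ω x).le]

theorem norm_eq (f : BeurlingAlgebra ω) :
    ‖f‖ = ∫ x, ω x * ‖f x‖ ∂(Measure.haar : Measure G) := by
  rw [integral_eq_lintegral_of_nonneg_ae
    (Eventually.of_forall fun x => mul_nonneg (weight_pos ω x).le (norm_nonneg _))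
    (integrable_weight_mul_norm f).aestronglyMeasurable, ← ENNReal.toReal_ofReal (norm_nonneg f),
    enorm_eq]
  congr 1
  refine lintegral_congr fun x => ?_
  rw [ENNReal.ofReal_mul (weight_pos ω x).le, ofReal_norm]

theorem coeFn_add (f g : BeurlingAlgebra ω) :
    (f + g : BeurlingAlgebra ω) =ᵐ[(Measure.haar : Measure G)] fun x => f x + g x := by
  have h := Lp.coeFn_add (E := ℂ) (μ := ω.measure) (p := 1) f g
  rwa [EventuallyEq, ae_eq] at h

theorem coeFn_smul (c : ℂ) (f : BeurlingAlgebra ω) :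
    (c • f : BeurlingAlgebra ω) =ᵐ[(Measure.haar : Measure G)] fun x => c * f x := by
  have h := Lp.coeFn_smul (E := ℂ) (μ := ω.measure) (p := 1) c f
  rwa [EventuallyEq, ae_eq] at h

/-! #### Left translation -/

theorem comp_mul_left_ae {α : Type*} {f g : G → α} (h : f =ᵐ[(Measure.haar : Measure G)] g)
    (y : G) : (fun x => f (y⁻¹ * x)) =ᵐ[(Measure.haar : Measure G)] fun x => g (y⁻¹ * x) :=
  (measurePreserving_mul_left Measure.haar y⁻¹).quasiMeasurePreserving.ae_eq_comp h

theorem lintegral_translate_le (g : G → ℝ≥0∞) (y : G) :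
    ∫⁻ x, ENNReal.ofReal (ω x) * g (y⁻¹ * x) ∂Measure.haar ≤
      ENNReal.ofReal (ω y) * ∫⁻ x, ENNReal.ofReal (ω x) * g x ∂Measure.haar := by
  rw [← lintegral_mul_left_eq_self _ y, ← lintegral_const_mul' _ _ ENNReal.ofReal_ne_top]
  refine lintegral_mono fun x => ?_
  rw [inv_mul_cancel_left, ← mul_assoc, ← ENNReal.ofReal_mul (weight_pos ω y).le]
  gcongr
  exact ω.toFun_mul_le y x

theorem memLp_iff {f : G → ℂ} : MemLp f 1 ω.measure ↔
    AEStronglyMeasurable f (Measure.haar : Measure G) ∧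
      ∫⁻ x, ENNReal.ofReal (ω x) * ‖f x‖ₑ ∂Measure.haar < ∞ := by
  rw [MemLp, eLpNorm_one_eq_lintegral_enorm, lintegral_measure]
  refine and_congr_left fun _ => ⟨fun h => ?_, fun h => ?_⟩
  · exact h.mono_ac (Measure.ae_le_iff_absolutelyContinuous.1 (ae_eq ω).ge)
  · exact h.mono_ac (Measure.ae_le_iff_absolutelyContinuous.1 (ae_eq ω).le)

theorem memLp_translate (y : G) (f : BeurlingAlgebra ω) :
    MemLp (fun x => f (y⁻¹ * x)) 1 ω.measure := by
  rw [memLp_iff]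
  refine ⟨(aestronglyMeasurable f).comp_quasiMeasurePreserving
    (measurePreserving_mul_left Measure.haar y⁻¹).quasiMeasurePreserving, ?_⟩
  refine (lintegral_translate_le (fun x => ‖f x‖ₑ) y).trans_lt ?_
  exact ENNReal.mul_lt_top ENNReal.ofReal_lt_top (memLp_iff.1 (memLp f)).2

/-- Left translation `(L_y f)(x) = f(y⁻¹ x)` on `L¹(G, ω)`. -/
def translate (y : G) : BeurlingAlgebra ω →L[ℂ] BeurlingAlgebra ω :=
  LinearMap.mkContinuous
    { toFun := fun f => mk (fun x => f (y⁻¹ * x)) (memLp_translate y f)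
      map_add' := fun f g => ext_ae <| by
        filter_upwards [coeFn_mk _ (memLp_translate y (f + g)), coeFn_mk _ (memLp_translate y f),
          coeFn_mk _ (memLp_translate y g), comp_mul_left_ae (coeFn_add f g) y,
          coeFn_add (mk _ (memLp_translate y f)) (mk _ (memLp_translate y g))]
          with x h1 h2 h3 h4 h5
        rw [h1, h4, h5, h2, h3]
      map_smul' := fun c f => ext_ae <| by
        filter_upwards [coeFn_mk _ (memLp_translate y (c • f)), coeFn_mk _ (memLp_translate y f),
          comp_mul_left_ae (coeFn_smul c f) y, coeFn_smul c (mk _ (memLp_translate y f))]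
          with x h1 h2 h3 h4
        rw [h1, h3, RingHom.id_apply, h4, h2] }
    (ω y) (fun f => by
      rw [← ENNReal.ofReal_le_ofReal_iff (mul_nonneg (weight_pos ω y).le (norm_nonneg f)),
        ENNReal.ofReal_mul (weight_pos ω y).le, enorm_eq, enorm_eq]
      refine le_trans (le_of_eq (lintegral_congr_ae ?_))
        (lintegral_translate_le (fun x => ‖f x‖ₑ) y)
      filter_upwards [coeFn_mk _ (memLp_translate y f)] with x h1
      simp only [LinearMap.coe_mk, AddHom.coe_mk, h1])

theorem coeFn_translate (y : G) (f : BeurlingAlgebra ω) :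
    translate y f =ᵐ[(Measure.haar : Measure G)] fun x => f (y⁻¹ * x) :=
  coeFn_mk _ (memLp_translate y f)

theorem norm_translate_le (y : G) (f : BeurlingAlgebra ω) : ‖translate y f‖ ≤ ω y * ‖f‖ :=
  ContinuousLinearMap.le_of_opNorm_le _
    (LinearMap.mkContinuous_norm_le _ (weight_pos ω y).le _) f

theorem translate_mul (y z : G) (f : BeurlingAlgebra ω) :
    translate (y * z) f = translate y (translate z f) := ext_ae <| by
  filter_upwards [coeFn_translate (y * z) f, coeFn_translate y (translate z f),
    comp_mul_left_ae (coeFn_translate z f) y] with x h1 h2 h3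
  rw [h1, h2, h3]
  simp [mul_assoc]

variable [T2Space G]

theorem memLp_of_cc {f : G → ℂ} (hf : Continuous f) (hf' : HasCompactSupport f) :
    MemLp f 1 ω.measure := by
  rw [memLp_iff]
  refine ⟨(hf.stronglyMeasurable_of_hasCompactSupport hf').aestronglyMeasurable, ?_⟩
  have h : Integrable (fun x => (ω x : ℂ) * f x) (Measure.haar : Measure G) := by
    refine Continuous.integrable_of_hasCompactSupport ?_ hf'.mul_left
    exact (Complex.continuous_ofReal.comp ω.continuous_toFun).mul hf
  refine lt_of_le_of_lt (le_of_eq ?_) (hasFiniteIntegral_iff_enorm.1 h.2)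
  refine lintegral_congr fun x => ?_
  rw [enorm_mul, ← ofReal_norm (ω x : ℂ), Complex.norm_real, Real.norm_of_nonneg
    (weight_pos ω x).le]

/-- `C_c(G)` is dense in `L¹(G, ω)`. -/
theorem exists_cc_norm_sub_le (f : BeurlingAlgebra ω) {ε : ℝ} (hε : 0 < ε) :
    ∃ (g : G → ℂ) (hg : Continuous g) (hg' : HasCompactSupport g),
      ‖f - mk g (memLp_of_cc hg hg')‖ ≤ ε := by
  have hωc : Continuous fun x => (ω x : ℂ) := Complex.continuous_ofReal.comp ω.continuous_toFun
  have hω0 : ∀ x, (ω x : ℂ) ≠ 0 := fun x => by exact_mod_cast (weight_pos ω x).ne'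
  have hωn : ∀ x, ‖(ω x : ℂ)‖ₑ = ENNReal.ofReal (ω x) := fun x => by
    rw [← ofReal_norm, Complex.norm_real, Real.norm_of_nonneg (weight_pos ω x).le]
  have h1 : MemLp (fun x => (ω x : ℂ) * f x) 1 (Measure.haar : Measure G) := by
    refine ⟨hωc.measurable.aestronglyMeasurable.mul (aestronglyMeasurable f), ?_⟩
    rw [eLpNorm_one_eq_lintegral_enorm]
    simp only [enorm_mul, hωn]
    exact (memLp_iff.1 (memLp f)).2
  obtain ⟨g, hg, hgc, hgs⟩ := exists_cc_eLpNorm_one_sub_le Measure.haar h1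
    (ε := ENNReal.ofReal ε) (by simpa using hε)
  have hc : Continuous fun x => (ω x : ℂ)⁻¹ * g x := (hωc.inv₀ hω0).mul hgc
  have hs : HasCompactSupport fun x => (ω x : ℂ)⁻¹ * g x := hgs.mul_left
  refine ⟨_, hc, hs, ?_⟩
  rw [← ENNReal.ofReal_le_ofReal_iff hε.le, enorm_eq]
  refine le_trans (le_of_eq ?_) hg
  rw [eLpNorm_one_eq_lintegral_enorm]
  refine lintegral_congr_ae ?_
  have h2 := coeFn_add (f - mk _ (memLp_of_cc (ω := ω) hc hs)) (mk _ (memLp_of_cc hc hs))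
  rw [sub_add_cancel] at h2
  filter_upwards [h2, coeFn_mk _ (memLp_of_cc (ω := ω) hc hs)] with x h2 h3
  rw [h3] at h2
  rw [← hωn, ← enorm_mul]
  congr 1
  simp only [Pi.sub_apply]
  rw [h2, mul_add, mul_inv_cancel_left₀ (hω0 x)]
  ring

/-- Translation is continuous in the translating element. -/
theorem continuous_translate (f : BeurlingAlgebra ω) :
    Continuous fun y => translate y f := by
  have key : ∀ (g : G → ℂ) (hg : Continuous g) (hg' : HasCompactSupport g),
      Continuous fun y => translate y (mk (ω := ω) g (memLp_of_cc hg hg')) := by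
    intro g hg hg'
    rw [continuous_iff_continuousAt]
    intro y₀
    obtain ⟨V, hV, hVy⟩ := exists_compact_mem_nhds y₀
    rw [ContinuousAt, tendsto_iff_norm_sub_tendsto_zero]
    have hcont : ContinuousOn (fun y => ∫ x, ω x * ‖g (y⁻¹ * x) - g (y₀⁻¹ * x)‖
        ∂(Measure.haar : Measure G)) V := by
      refine continuousOn_integral_of_compact_support (hV.mul hg') ?_ ?_
      · refine Continuous.continuousOn ?_
        have hω := ω.continuous_toFun
        fun_prop
      · intro y x hy hx
        have : ∀ z ∈ V, g (z⁻¹ * x) = 0 := fun z hz => by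
          refine image_eq_zero_of_notMem_tsupport fun h => hx ?_
          simpa using mul_mem_mul hz h
        rw [this y hy, this y₀ (mem_of_mem_nhds hVy)]
        simp
    have hlim := hcont.continuousAt hVy
    rw [ContinuousAt] at hlim
    simp only [sub_self, norm_zero, mul_zero, integral_zero] at hlim
    refine hlim.congr fun y => ?_
    rw [norm_eq]
    refine integral_congr_ae ?_
    set F : BeurlingAlgebra ω := mk g (memLp_of_cc hg hg') with hF
    have h0 : F =ᵐ[(Measure.haar : Measure G)] g := coeFn_mk _ _
    have h1 := coeFn_add (translate y F - translate y₀ F) (translate y₀ F)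
    rw [sub_add_cancel] at h1
    filter_upwards [h1, coeFn_translate y F, coeFn_translate y₀ F, comp_mul_left_ae h0 y,
      comp_mul_left_ae h0 y₀] with x h1 h2 h3 h4 h5
    have h6 : (translate y F - translate y₀ F) x = g (y⁻¹ * x) - g (y₀⁻¹ * x) := by
      rw [h2, h4, h3, h5] at h1
      rw [h1]
      ring
    rw [h6]
  refine continuous_of_locally_uniform_approx_of_continuousAt fun y₀ u hu => ?_
  obtain ⟨ε, hε, hεu⟩ := Metric.mem_uniformity_dist.1 hu
  have hM : 0 < ω y₀ + 1 := add_pos (weight_pos ω y₀) one_pos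
  obtain ⟨g, hg, hg', hfg⟩ := exists_cc_norm_sub_le f (ε := ε / (2 * (ω y₀ + 1))) (by positivity)
  refine ⟨{y | ω y < ω y₀ + 1}, ?_, _, (key g hg hg').continuousAt, ?_⟩
  · exact (isOpen_lt ω.continuous_toFun continuous_const).mem_nhds (lt_add_one (ω y₀))
  · intro y hy
    apply hεu
    rw [dist_eq_norm, ← map_sub]
    calc ‖translate y (f - mk g (memLp_of_cc hg hg'))‖
        ≤ ω y * ‖f - mk g (memLp_of_cc hg hg')‖ := norm_translate_le _ _
      _ ≤ (ω y₀ + 1) * (ε / (2 * (ω y₀ + 1))) :=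
          mul_le_mul (le_of_lt hy) hfg (norm_nonneg _) hM.le
      _ = ε / 2 := by field_simp
      _ < ε := half_lt_self hε

theorem aestronglyMeasurable_smul_translate (f g : BeurlingAlgebra ω) :
    AEStronglyMeasurable (fun y => f y • translate y g) (Measure.haar : Measure G) := by
  choose u hu hu' hfu using fun n : ℕ =>
    exists_cc_norm_sub_le f (ε := 1 / ((n : ℝ) + 1)) (by positivity)
  have h1 : Tendsto (fun n => eLpNorm (u n - (f : G → ℂ)) 1 ω.measure) atTop (𝓝 0) := by
    have h2 : ∀ n, eLpNorm (u n - (f : G → ℂ)) 1 ω.measure =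
        ENNReal.ofReal ‖f - mk (u n) (memLp_of_cc (hu n) (hu' n))‖ := by
      intro n
      rw [eLpNorm_sub_comm, ← ENNReal.ofReal_toReal
        ((memLp f).sub (memLp_of_cc (hu n) (hu' n))).eLpNorm_ne_top]
      congr 1
      have h3 : ‖f - mk (u n) (memLp_of_cc (hu n) (hu' n))‖ =
          (eLpNorm (f - mk (u n) (memLp_of_cc (hu n) (hu' n)) : BeurlingAlgebra ω) 1
            ω.measure).toReal := rfl
      rw [h3]
      congr 1
      refine eLpNorm_congr_ae ?_
      have h4 := Lp.coeFn_sub (E := ℂ) (μ := ω.measure) (p := 1) f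
        (mk (u n) (memLp_of_cc (hu n) (hu' n)))
      have h5 : mk (u n) (memLp_of_cc (hu n) (hu' n)) =ᵐ[ω.measure] u n := MemLp.coeFn_toLp _
      refine EventuallyEq.symm (h4.trans ?_)
      filter_upwards [h5] with x h5
      exact congrArg (fun t => f x - t) h5
    simp only [h2]
    rw [← ENNReal.ofReal_zero]
    refine ENNReal.tendsto_ofReal ?_
    exact squeeze_zero (fun _ => norm_nonneg _) hfu tendsto_one_div_add_atTop_nhds_zero_nat
  obtain ⟨ns, -, hns⟩ := (tendstoInMeasure_of_tendsto_eLpNorm one_ne_zero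
    (fun n => (memLp_of_cc (hu n) (hu' n)).aestronglyMeasurable)
    (memLp f).aestronglyMeasurable h1).exists_seq_tendsto_ae
  rw [ae_eq] at hns
  refine aestronglyMeasurable_of_tendsto_ae atTop
    (f := fun n y => u (ns n) y • translate y g) (fun n => ?_) ?_
  · refine (Continuous.stronglyMeasurable_of_hasCompactSupport
      ((hu (ns n)).smul (continuous_translate g)) ?_).aestronglyMeasurable
    exact (hu' (ns n)).smul_right
  · filter_upwards [hns] with y hy
    exact hy.smul_const _

theorem norm_smul_translate_le (f g : BeurlingAlgebra ω) (y : G) :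
    ‖f y • translate y g‖ ≤ (ω y * ‖f y‖) * ‖g‖ := by
  rw [norm_smul]
  calc ‖f y‖ * ‖translate y g‖ ≤ ‖f y‖ * (ω y * ‖g‖) := by
        gcongr
        exact norm_translate_le y g
    _ = _ := by ring

theorem integrable_smul_translate (f g : BeurlingAlgebra ω) :
    Integrable (fun y => f y • translate y g) (Measure.haar : Measure G) :=
  ((integrable_weight_mul_norm f).mul_const ‖g‖).mono' (aestronglyMeasurable_smul_translate f g)
    (Eventually.of_forall (norm_smul_translate_le f g))

/-! #### Convolution -/

/-- Convolution `(f ∗ g)(x) = ∫ f(y) g(y⁻¹ x) dy`, written as the `L¹(G, ω)`-valued (Bochner)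
integral `f ∗ g = ∫ f(y) L_y g dy`; the integral converges absolutely for all `f, g ∈ L¹(G, ω)`. -/
instance : Mul (BeurlingAlgebra ω) :=
  ⟨fun f g => ∫ y, f y • translate y g ∂(Measure.haar : Measure G)⟩

theorem mul_def (f g : BeurlingAlgebra ω) :
    f * g = ∫ y, f y • translate y g ∂(Measure.haar : Measure G) := rfl

theorem norm_mul_le' (f g : BeurlingAlgebra ω) : ‖f * g‖ ≤ ‖f‖ * ‖g‖ := by
  rw [mul_def, norm_eq f, ← integral_mul_const]
  exact norm_integral_le_of_norm_le ((integrable_weight_mul_norm f).mul_const ‖g‖)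
    (Eventually.of_forall (norm_smul_translate_le f g))

theorem add_mul' (f g k : BeurlingAlgebra ω) : (f + g) * k = f * k + g * k := by
  rw [mul_def, mul_def, mul_def, ← integral_add (integrable_smul_translate f k)
    (integrable_smul_translate g k)]
  refine integral_congr_ae ?_
  filter_upwards [coeFn_add f g] with y h
  rw [h, add_smul]

theorem mul_add' (f g k : BeurlingAlgebra ω) : f * (g + k) = f * g + f * k := by
  rw [mul_def, mul_def, mul_def, ← integral_add (integrable_smul_translate f g)
    (integrable_smul_translate f k)]
  simp only [map_add, smul_add]

theorem smul_mul' (c : ℂ) (f g : BeurlingAlgebra ω) : (c • f) * g = c • (f * g) := by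
  rw [mul_def, mul_def, ← integral_smul]
  refine integral_congr_ae ?_
  filter_upwards [coeFn_smul c f] with y h
  rw [h, mul_smul]

theorem mul_smul' (c : ℂ) (f g : BeurlingAlgebra ω) : f * (c • g) = c • (f * g) := by
  rw [mul_def, mul_def, ← integral_smul]
  refine integral_congr_ae (Eventually.of_forall fun y => ?_)
  simp only [map_smul]
  rw [smul_comm]

/-- Right convolution by `k` as a bounded operator. -/
def mulRightCLM (k : BeurlingAlgebra ω) : BeurlingAlgebra ω →L[ℂ] BeurlingAlgebra ω :=
  LinearMap.mkContinuous
    { toFun := fun f => f * k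
      map_add' := fun f g => add_mul' f g k
      map_smul' := fun c f => smul_mul' c f k } ‖k‖
    (fun f => (norm_mul_le' f k).trans (mul_comm _ _).le)

theorem translate_mul_eq (y : G) (g k : BeurlingAlgebra ω) :
    translate y g * k = translate y (g * k) := by
  rw [mul_def, mul_def, ← ContinuousLinearMap.integral_comp_comm _ (integrable_smul_translate g k),
    ← integral_mul_left_eq_self (fun z => translate y (g z • translate z k)) y⁻¹]
  refine integral_congr_ae ?_
  filter_upwards [coeFn_translate y g] with z h
  rw [h, map_smul, ← translate_mul, mul_inv_cancel_left]

theorem mul_assoc' (f g k : BeurlingAlgebra ω) : f * g * k = f * (g * k) := by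
  have h : f * g * k = mulRightCLM k (∫ y, f y • translate y g ∂(Measure.haar : Measure G)) := rfl
  rw [h, ← ContinuousLinearMap.integral_comp_comm _ (integrable_smul_translate f g),
    mul_def f (g * k)]
  refine integral_congr_ae (Eventually.of_forall fun y => ?_)
  simp only [map_smul]
  rw [← translate_mul_eq]
  rfl

/-- `L¹(G, ω)` is a Banach algebra under convolution. -/
instance : NonUnitalNormedRing (BeurlingAlgebra ω) where
  __ := (inferInstance : NormedAddCommGroup (BeurlingAlgebra ω))
  __ := (inferInstance : Mul (BeurlingAlgebra ω))
  left_distrib := mul_add'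
  right_distrib := add_mul'
  zero_mul f := by simpa using smul_mul' (0 : ℂ) 0 f
  mul_zero f := by simpa using mul_smul' (0 : ℂ) f 0
  mul_assoc := mul_assoc'
  norm_mul_le := norm_mul_le'

instance : IsScalarTower ℂ (BeurlingAlgebra ω) (BeurlingAlgebra ω) := ⟨smul_mul'⟩

instance : SMulCommClass ℂ (BeurlingAlgebra ω) (BeurlingAlgebra ω) :=
  ⟨fun c f g => (mul_smul' c f g).symm⟩

end BeurlingAlgebra

end Beurling

/-! ### Inner quasi-additive functions -/

section QuasiAdditive

/-- `P` holds (locally) almost everywhere on the locally compact group `X`: the set where it fails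
meets every compact set in a set of Haar measure zero. Haar measure lives on the Borel `σ`-algebra
of `X`; this matters for `X = G × G`, where the product `σ`-algebra can be smaller. -/
def HaarLocallyAE {X : Type*} [Group X] [TopologicalSpace X] [IsTopologicalGroup X]
    [LocallyCompactSpace X] (P : X → Prop) : Prop :=
  letI : MeasurableSpace X := borel X
  haveI : BorelSpace X := ⟨rfl⟩
  ∀ K : Set X, IsCompact K → (Measure.haar : Measure X) {x | x ∈ K ∧ ¬ P x} = 0

variable {G : Type*} [Group G] [TopologicalSpace G] [IsTopologicalGroup G] [LocallyCompactSpace G]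

/-- `p : G × G → ℂ` is quasi-additive: it is Borel measurable, and
`p(xy, z) = p(x, yz) + p(y, zx)` for almost all `x, y, z`. -/
structure IsQuasiAdditive (p : G × G → ℂ) : Prop where
  measurable : Measurable[borel (G × G)] p
  ae_eq : HaarLocallyAE fun t : G × G × G =>
    p (t.1 * t.2.1, t.2.2) = p (t.1, t.2.1 * t.2.2) + p (t.2.1, t.2.2 * t.1)

/-- `h ∈ L^∞(G, 1/ω)`: `h` is Borel measurable and `h / ω` is essentially bounded. -/
def MemLInftyWeight (ω : GroupWeight G) (h : G → ℂ) : Prop :=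
  Measurable[borel G] h ∧ ∃ C : ℝ, HaarLocallyAE fun x => ‖h x / (ω x : ℂ)‖ ≤ C

/-- `I(G, ω)`: the quasi-additive functions `p` for which there is `h ∈ L^∞(G, 1/ω)` with
`p(x, y) = h(xy) - h(yx)` for almost all `x, y`. -/
def innerQuasiAdditive (ω : GroupWeight G) : Set (G × G → ℂ) :=
  {p | IsQuasiAdditive p ∧ ∃ h : G → ℂ, MemLInftyWeight ω h ∧
    HaarLocallyAE fun t : G × G => p t = h (t.1 * t.2) - h (t.2 * t.1)}

end QuasiAdditive

end

noncomputable section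

/-! ### Testing integrable functions against `C_c` -/

/-! Two independent mechanisms carry the theorem.

Transfer. If `ω₁ ≤ m ω₂`, the inclusion of `L¹(G, ω₂)` into `L¹(G, ω₁)` is a bounded homomorphism,
so a derivation `D` on `L¹(G, ω₁)` pulls back to `L¹(G, ω₂)` (`pullback`). There it is inner, given
by some functional `z`, and `z` is integration against a Borel function `h` dominated by a multiple
of `ω₂` (`exists_measurable_rep`). The commutator `p(x, y) = h(xy) - h(yx)` lies in `I(G, ω₂)`. If
it also lies in `I(G, ω₁)`, it is the commutator of some `h₁` in `L^∞(G, 1/ω₁)`. For compactly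
supported `a`, `c` the value `D a c` is the integral of `p(x, y) a(x) c(y)`, so `h₁` implements `D`
on such functions and, by density, everywhere. This is
`weaklyAmenable_of_innerQuasiAdditive_subset`. For equivalent weights the sets `I` coincide
automatically.

Suprema instead of averages. If `ω*` is bounded, `D` extends to point masses, and translating
`D(δ_t)` back by `δ_{t⁻¹}` gives a bounded cocycle `ξ` for conjugation (`exists_cocycle`). The real
functionals on `L¹` form an order complete lattice on which conjugation acts by order automorphisms.
Hence the supremum `S` of the real parts of the `ξ t` satisfies `S ∘ conj_t = S - Re ξ t`, and every
bounded cocycle is a coboundary (`exists_coboundary`), whatever `G` is. Integrating over `t`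
recovers `D` as an inner derivation (`weaklyAmenable_of_isBounded_adj`). Boundedness of `ω₂` or
`ω₂*` passes to `ω₁*`.

Haar measure need not be σ-finite, and the Borel `σ`-algebra of `G × G` may be strictly larger than
the product one. The measure theory therefore uses Fubini only for continuous compactly supported
functions, and reaches Borel functions through regular measures determined by their integrals on
`C_c`. -/

theorem ae_eq_zero_of_forall_integral_mul_cc {X : Type*} [TopologicalSpace X]
    [LocallyCompactSpace X] [T2Space X] [MeasurableSpace X] [BorelSpace X] {μ : Measure X}
    [μ.Regular] {f : X → ℂ} (hf : Integrable f μ)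
    (h : ∀ g : X → ℂ, Continuous g → HasCompactSupport g → ∫ x, g x * f x ∂μ = 0) :
    f =ᵐ[μ] 0 := by
  have key : ∀ ε > 0, ∫ x, ‖f x‖ ∂μ ≤ 2 * ε := by
    intro ε hε
    obtain ⟨v, hv, hvc, hvs⟩ := exists_cc_eLpNorm_one_sub_le μ (memLp_one_iff_integrable.2 hf)
      (ε := ENNReal.ofReal ε) (by simpa using hε)
    have hvi : Integrable v μ := hvc.integrable_of_hasCompactSupport hvs
    have hfv : ∫ x, ‖f x - v x‖ ∂μ ≤ ε := by
      have := integral_norm_eq_lintegral_enorm (hf.sub hvi).aestronglyMeasurable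
      simp only [Pi.sub_apply] at this
      rw [this]
      refine ENNReal.toReal_le_of_le_ofReal hε.le ?_
      rwa [eLpNorm_one_eq_lintegral_enorm] at hv
    have hδ : ∀ δ > 0, ∫ x, ‖v x‖ ∂μ ≤ ε + δ * μ.real (tsupport v) := by
      intro δ hδ
      -- An approximate conjugate phase of `v`; `δ` keeps it continuous at the zeros of `v`. Then `g
      -- v = |v|² / (|v| + δ) ≥ |v| - δ`, while `∫ g v = ∫ g (v - f)` is at most `ε` because `g`
      -- annihilates `f`.
      set g : X → ℂ := fun x => ((‖v x‖ + δ : ℝ) : ℂ)⁻¹ * starRingEnd ℂ (v x) with hg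
      have hpos : ∀ x, 0 < ‖v x‖ + δ := fun x => add_pos_of_nonneg_of_pos (norm_nonneg _) hδ
      have hne : ∀ x, ((‖v x‖ + δ : ℝ) : ℂ) ≠ 0 := fun x => by exact_mod_cast (hpos x).ne'
      have hgc : Continuous g := by
        refine Continuous.mul (Continuous.inv₀ (by fun_prop) hne) ?_
        exact Complex.continuous_conj.comp hvc
      have hgs : HasCompactSupport g :=
        HasCompactSupport.mul_left (hvs.comp_left (g := starRingEnd ℂ) (map_zero _))
      have hg1 : ∀ x, ‖g x‖ ≤ 1 := by
        intro x
        rw [hg]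
        simp only [norm_mul, norm_inv, Complex.norm_real, RCLike.norm_conj,
          Real.norm_of_nonneg (hpos x).le]
        rw [inv_mul_le_one₀ (hpos x)]
        linarith
      have hgf : Integrable (fun x => g x * f x) μ :=
        hf.bdd_mul hgc.aestronglyMeasurable (Eventually.of_forall hg1)
      have hgv : Integrable (fun x => g x * v x) μ :=
        hvi.bdd_mul hgc.aestronglyMeasurable (Eventually.of_forall hg1)
      have e1 : ∀ x, g x * v x = ((‖v x‖ ^ 2 / (‖v x‖ + δ) : ℝ) : ℂ) := by
        intro x
        rw [hg]
        simp only
        rw [mul_assoc, mul_comm (starRingEnd ℂ (v x)), Complex.mul_conj, Complex.normSq_eq_norm_sq]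
        push_cast
        rw [div_eq_inv_mul]
      have e2 : ∫ x, (‖v x‖ ^ 2 / (‖v x‖ + δ) : ℝ) ∂μ ≤ ε := by
        have e3 : ((∫ x, (‖v x‖ ^ 2 / (‖v x‖ + δ) : ℝ) ∂μ : ℝ) : ℂ) =
            ∫ x, g x * (v x - f x) ∂μ := by
          rw [← integral_complex_ofReal]
          simp only [mul_sub]
          rw [integral_sub hgv hgf, h g hgc hgs, sub_zero]
          exact integral_congr_ae (Eventually.of_forall fun x => (e1 x).symm)
        calc ∫ x, (‖v x‖ ^ 2 / (‖v x‖ + δ) : ℝ) ∂μ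
            ≤ ‖((∫ x, (‖v x‖ ^ 2 / (‖v x‖ + δ) : ℝ) ∂μ : ℝ) : ℂ)‖ := by
              rw [Complex.norm_real]; exact le_abs_self _
          _ = ‖∫ x, g x * (v x - f x) ∂μ‖ := by rw [e3]
          _ ≤ ∫ x, ‖f x - v x‖ ∂μ := by
              refine norm_integral_le_of_norm_le (hf.sub hvi).norm (Eventually.of_forall fun x => ?_)
              rw [norm_mul, norm_sub_rev]
              exact mul_le_of_le_one_left (norm_nonneg _) (hg1 x)
          _ ≤ ε := hfv
      have hK : MeasurableSet (tsupport v) := hvs.isCompact.measurableSet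
      have hKfin : μ (tsupport v) ≠ ∞ := hvs.isCompact.measure_lt_top.ne
      have hi : Integrable ((tsupport v).indicator fun _ => δ) μ :=
        (integrable_indicator_iff hK).2 (integrableOn_const hKfin)
      have hi2 : Integrable (fun x => (‖v x‖ ^ 2 / (‖v x‖ + δ) : ℝ)) μ := by
        refine (hgv.norm).congr (Eventually.of_forall fun x => ?_)
        simp only
        rw [e1, Complex.norm_real, Real.norm_of_nonneg]
        exact div_nonneg (sq_nonneg _) (hpos x).le
      calc ∫ x, ‖v x‖ ∂μ
          ≤ ∫ x, ((‖v x‖ ^ 2 / (‖v x‖ + δ) : ℝ) + (tsupport v).indicator (fun _ => δ) x) ∂μ := by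
            refine integral_mono hvi.norm (hi2.add hi) fun x => ?_
            by_cases hx : x ∈ tsupport v
            · simp only [indicator_of_mem hx]
              rw [div_add' _ _ _ (hpos x).ne', le_div_iff₀ (hpos x)]
              nlinarith [norm_nonneg (v x)]
            · simp [image_eq_zero_of_notMem_tsupport hx, hx]
        _ = ∫ x, (‖v x‖ ^ 2 / (‖v x‖ + δ) : ℝ) ∂μ + δ * μ.real (tsupport v) := by
            rw [integral_add hi2 hi, integral_indicator_const _ hK, smul_eq_mul, mul_comm δ]
        _ ≤ ε + δ * μ.real (tsupport v) := by gcongr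
    have hv1 : ∫ x, ‖v x‖ ∂μ ≤ ε := by
      refine le_of_tendsto_of_tendsto (b := 𝓝[>] (0 : ℝ)) tendsto_const_nhds
        (g := fun δ => ε + δ * μ.real (tsupport v)) ?_
        (eventually_mem_nhdsWithin.mono fun δ hδ' => hδ δ hδ')
      have : Tendsto (fun δ : ℝ => ε + δ * μ.real (tsupport v)) (𝓝 0)
          (𝓝 (ε + 0 * μ.real (tsupport v))) := Continuous.tendsto (by fun_prop) 0
      simpa using this.mono_left nhdsWithin_le_nhds
    calc ∫ x, ‖f x‖ ∂μ ≤ ∫ x, (‖f x - v x‖ + ‖v x‖) ∂μ :=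
          integral_mono hf.norm ((hf.sub hvi).norm.add hvi.norm) fun x => by
            simpa using norm_add_le (f x - v x) (v x)
      _ = ∫ x, ‖f x - v x‖ ∂μ + ∫ x, ‖v x‖ ∂μ := integral_add (hf.sub hvi).norm hvi.norm
      _ ≤ 2 * ε := by linarith
  have h0 : ∫ x, ‖f x‖ ∂μ = 0 := by
    refine le_antisymm (le_of_forall_pos_le_add fun ε hε => ?_)
      (integral_nonneg fun _ => norm_nonneg _)
    have := key (ε / 2) (by positivity)
    linarith
  have h1 := (integral_eq_zero_iff_of_nonneg (fun _ => norm_nonneg _) hf.norm).1 h0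
  filter_upwards [h1] with x hx
  simpa using hx

namespace BeurlingAlgebra

variable {G : Type*} [Group G] [TopologicalSpace G] [IsTopologicalGroup G] [LocallyCompactSpace G]
  [MeasurableSpace G] [BorelSpace G] {ω : GroupWeight G}

/-! ### Functionals given by functions -/

theorem integrable (f : BeurlingAlgebra ω) : Integrable f (Measure.haar : Measure G) := by
  refine (integrable_weight_mul_norm f).mono' (aestronglyMeasurable f)
    (Eventually.of_forall fun x => ?_)
  exact le_mul_of_one_le_left (norm_nonneg _) (ω.one_le_toFun x)

theorem norm_mul_le_of_le {h : G → ℂ} {C : ℝ} (hC : ∀ x, ‖h x‖ ≤ C * ω x)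
    (f : BeurlingAlgebra ω) (x : G) : ‖h x * f x‖ ≤ C * (ω x * ‖f x‖) := by
  rw [norm_mul, ← mul_assoc]
  exact mul_le_mul_of_nonneg_right (hC x) (norm_nonneg _)

theorem integrable_mul {h : G → ℂ} (hm : AEStronglyMeasurable h (Measure.haar : Measure G)) {C : ℝ}
    (hC : ∀ x, ‖h x‖ ≤ C * ω x) (f : BeurlingAlgebra ω) :
    Integrable (fun x => h x * f x) (Measure.haar : Measure G) :=
  ((integrable_weight_mul_norm f).const_mul C).mono' (hm.mul (aestronglyMeasurable f))
    (Eventually.of_forall (norm_mul_le_of_le hC f))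

/-- The functional `f ↦ ∫ h f` on `L¹(G, ω)`, for `h / ω` bounded. -/
def dualOfFun (h : G → ℂ) (hm : AEStronglyMeasurable h (Measure.haar : Measure G)) (C : ℝ)
    (hC : ∀ x, ‖h x‖ ≤ C * ω x) : StrongDual ℂ (BeurlingAlgebra ω) :=
  LinearMap.mkContinuous
    { toFun := fun f => ∫ x, h x * f x ∂(Measure.haar : Measure G)
      map_add' := fun f g => by
        rw [← integral_add (integrable_mul hm hC f) (integrable_mul hm hC g)]
        refine integral_congr_ae ?_
        filter_upwards [coeFn_add f g] with x hx
        rw [hx, mul_add]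
      map_smul' := fun c f => by
        rw [RingHom.id_apply, smul_eq_mul, ← integral_const_mul]
        refine integral_congr_ae ?_
        filter_upwards [coeFn_smul c f] with x hx
        rw [hx]
        ring }
    C (fun f => by
      rw [norm_eq, ← integral_const_mul]
      exact norm_integral_le_of_norm_le ((integrable_weight_mul_norm f).const_mul C)
        (Eventually.of_forall (norm_mul_le_of_le hC f)))

theorem dualOfFun_apply {h : G → ℂ} (hm : AEStronglyMeasurable h (Measure.haar : Measure G))
    {C : ℝ} (hC : ∀ x, ‖h x‖ ≤ C * ω x) (f : BeurlingAlgebra ω) :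
    dualOfFun h hm C hC f = ∫ x, h x * f x ∂(Measure.haar : Measure G) := rfl

theorem dualOfFun_mk {h : G → ℂ} (hm : AEStronglyMeasurable h (Measure.haar : Measure G))
    {C : ℝ} (hC : ∀ x, ‖h x‖ ≤ C * ω x) {f : G → ℂ} (hf : MemLp f 1 ω.measure) :
    dualOfFun h hm C hC (mk f hf) = ∫ x, h x * f x ∂(Measure.haar : Measure G) := by
  rw [dualOfFun_apply]
  refine integral_congr_ae ?_
  filter_upwards [coeFn_mk f hf] with x hx
  rw [hx]

theorem exists_bound_of_cc (ω : GroupWeight G) {g : G → ℂ} (hg : Continuous g)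
    (hg' : HasCompactSupport g) : ∃ C, ∀ x, ‖g x‖ ≤ C * ω x := by
  obtain ⟨C, hC⟩ := hg.bounded_above_of_compact_support hg'
  refine ⟨C, fun x => (hC x).trans (le_mul_of_one_le_right ?_ (ω.one_le_toFun x))⟩
  exact (norm_nonneg _).trans (hC x)

theorem aestronglyMeasurable_of_cc {g : G → ℂ} (hg : Continuous g) (hg' : HasCompactSupport g) :
    AEStronglyMeasurable g (Measure.haar : Measure G) :=
  (hg.stronglyMeasurable_of_hasCompactSupport hg').aestronglyMeasurable

variable [T2Space G]

theorem eq_of_forall_integral_mul_cc {u v : BeurlingAlgebra ω}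
    (h : ∀ g : G → ℂ, Continuous g → HasCompactSupport g →
      ∫ x, g x * u x ∂(Measure.haar : Measure G) = ∫ x, g x * v x ∂(Measure.haar : Measure G)) :
    u = v := by
  refine ext_ae ?_
  have h0 : (fun x => u x - v x) =ᵐ[(Measure.haar : Measure G)] 0 := by
    refine ae_eq_zero_of_forall_integral_mul_cc ((integrable u).sub (integrable v))
      fun g hg hg' => ?_
    obtain ⟨C, hC⟩ := exists_bound_of_cc ω hg hg'
    have hm := aestronglyMeasurable_of_cc hg hg'
    simp only [mul_sub]
    rw [integral_sub (integrable_mul hm hC u) (integrable_mul hm hC v), h g hg hg', sub_self]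
  filter_upwards [h0] with x hx
  exact sub_eq_zero.1 hx

/-! ### Convolution of compactly supported functions -/

/-- Convolution of functions. -/
def cconv (a c : G → ℂ) (z : G) : ℂ := ∫ y, a y * c (y⁻¹ * z) ∂(Measure.haar : Measure G)

theorem continuous_cconv {a c : G → ℂ} (ha : Continuous a) (ha' : HasCompactSupport a)
    (hc : Continuous c) : Continuous (cconv a c) := by
  rw [← continuousOn_univ]
  refine continuousOn_integral_of_compact_support (k := tsupport a) ha' ?_ ?_
  · exact Continuous.continuousOn (by fun_prop)
  · intro p x _ hx
    rw [image_eq_zero_of_notMem_tsupport hx, zero_mul]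

theorem hasCompactSupport_cconv {a c : G → ℂ} (ha' : HasCompactSupport a)
    (hc' : HasCompactSupport c) : HasCompactSupport (cconv a c) := by
  refine HasCompactSupport.intro (ha'.isCompact.mul hc'.isCompact) fun z hz => ?_
  rw [cconv, integral_eq_zero_of_ae]
  refine Eventually.of_forall fun y => ?_
  by_contra hy
  simp only [Pi.zero_apply, mul_eq_zero, not_or] at hy
  refine hz ⟨y, subset_tsupport _ hy.1, y⁻¹ * z, subset_tsupport _ hy.2, by simp⟩

/-- Pairing with `g` is a continuous functional, so it passes under the Bochner integral defining
the product; left invariance then removes the translation. -/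
theorem integral_mul_mul {g : G → ℂ} (hm : AEStronglyMeasurable g (Measure.haar : Measure G))
    {C : ℝ} (hC : ∀ x, ‖g x‖ ≤ C * ω x) (a c : BeurlingAlgebra ω) :
    ∫ x, g x * (a * c) x ∂(Measure.haar : Measure G) =
      ∫ y, a y * ∫ x, g (y * x) * c x ∂(Measure.haar : Measure G) ∂(Measure.haar : Measure G) := by
  rw [← dualOfFun_apply hm hC, mul_def,
    ← ContinuousLinearMap.integral_comp_comm _ (integrable_smul_translate a c)]
  refine integral_congr_ae (Eventually.of_forall fun y => ?_)
  simp only [map_smul, smul_eq_mul]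
  rw [dualOfFun_apply, ← integral_mul_left_eq_self _ y]
  congr 1
  refine integral_congr_ae ?_
  have := (measurePreserving_mul_left (Measure.haar : Measure G) y).quasiMeasurePreserving.ae_eq_comp
    (coeFn_translate y c)
  filter_upwards [this] with x hx
  simp only [Function.comp_apply, inv_mul_cancel_left] at hx
  rw [hx]

/-- The interchange is Fubini for continuous compactly supported integrands, which needs no
σ-finiteness. -/
theorem integral_mul_cconv {a c g : G → ℂ} (ha : Continuous a) (ha' : HasCompactSupport a)
    (hc : Continuous c) (hc' : HasCompactSupport c) (hg : Continuous g) :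
    ∫ z, g z * cconv a c z ∂(Measure.haar : Measure G) =
      ∫ y, a y * ∫ x, g (y * x) * c x ∂(Measure.haar : Measure G) ∂(Measure.haar : Measure G) := by
  have h1 : ∀ z, g z * cconv a c z =
      ∫ y, g z * (a y * c (y⁻¹ * z)) ∂(Measure.haar : Measure G) := fun z => by
    rw [cconv, integral_const_mul]
  simp only [h1]
  rw [integral_integral_swap_of_hasCompactSupport]
  · refine integral_congr_ae (Eventually.of_forall fun y => ?_)
    simp only
    rw [← integral_mul_left_eq_self _ y, ← integral_const_mul]
    refine integral_congr_ae (Eventually.of_forall fun x => ?_)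
    simp only [inv_mul_cancel_left]
    ring
  · exact (by fun_prop : Continuous fun p : G × G => g p.1 * (a p.2 * c (p.2⁻¹ * p.1)))
  · refine HasCompactSupport.intro ((ha'.isCompact.mul hc'.isCompact).prod ha'.isCompact)
      fun p hp => ?_
    by_contra hne
    simp only [Function.uncurry, mul_eq_zero, not_or] at hne
    refine hp ⟨⟨p.2, subset_tsupport _ hne.2.1, p.2⁻¹ * p.1, subset_tsupport _ hne.2.2, by simp⟩,
      subset_tsupport _ hne.2.1⟩

/-- Both sides pair equally with every `g` in `C_c`. This identifies the abstract Bochner product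
with pointwise convolution, so that functionals given by a function can be evaluated on products. -/
theorem mk_mul_mk {a c : G → ℂ} (ha : Continuous a) (ha' : HasCompactSupport a)
    (hc : Continuous c) (hc' : HasCompactSupport c) :
    mk (ω := ω) a (memLp_of_cc ha ha') * mk c (memLp_of_cc hc hc') =
      mk (cconv a c) (memLp_of_cc (continuous_cconv ha ha' hc) (hasCompactSupport_cconv ha' hc')) := by
  refine eq_of_forall_integral_mul_cc fun g hg hg' => ?_
  obtain ⟨C, hC⟩ := exists_bound_of_cc ω hg hg'
  have hm := aestronglyMeasurable_of_cc hg hg'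
  rw [← dualOfFun_apply hm hC (mk (cconv a c) _), dualOfFun_mk, integral_mul_cconv ha ha' hc hc' hg,
    integral_mul_mul hm hC]
  refine integral_congr_ae ?_
  filter_upwards [coeFn_mk (ω := ω) a (memLp_of_cc ha ha')] with y hy
  rw [hy]
  congr 1
  refine integral_congr_ae ?_
  filter_upwards [coeFn_mk (ω := ω) c (memLp_of_cc hc hc')] with x hx
  rw [hx]

/-! ### Density -/

/-- A function in `C_c` is a combination of the positive and negative parts of its real and
imaginary parts. Linear identities then need checking only on the positive cone, where order
arguments and densities of positive measures apply. -/
theorem mem_of_isClosed_of_cc {V : Submodule ℂ (BeurlingAlgebra ω)}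
    (hV : IsClosed (V : Set (BeurlingAlgebra ω)))
    (h : ∀ (a : G → ℝ) (ha : Continuous fun x => (a x : ℂ))
      (ha' : HasCompactSupport fun x => (a x : ℂ)), (∀ x, 0 ≤ a x) →
      mk (fun x => (a x : ℂ)) (memLp_of_cc ha ha') ∈ V) (f : BeurlingAlgebra ω) : f ∈ V := by
  have hreal : ∀ (a : G → ℝ) (ha : Continuous fun x => (a x : ℂ))
      (ha' : HasCompactSupport fun x => (a x : ℂ)),
      mk (fun x => (a x : ℂ)) (memLp_of_cc ha ha') ∈ V := by
    intro a ha ha'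
    have hac : Continuous a := Complex.continuous_re.comp ha
    have hpos : ∀ b : G → ℝ, Continuous b → (HasCompactSupport fun x => (b x : ℂ)) →
        (Continuous fun x => ((b x ⊔ 0 : ℝ) : ℂ)) ∧
          HasCompactSupport fun x => ((b x ⊔ 0 : ℝ) : ℂ) := by
      intro b hb hb'
      refine ⟨Complex.continuous_ofReal.comp (hb.sup continuous_const), hb'.mono fun x hx => ?_⟩
      contrapose! hx
      simp only [Function.mem_support, ne_eq, Complex.ofReal_eq_zero, not_not] at hx
      simp [hx]
    have hneg : HasCompactSupport fun x => ((-a x : ℝ) : ℂ) := by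
      refine ha'.mono fun x hx => ?_
      simpa using hx
    obtain ⟨h1, h1'⟩ := hpos a hac ha'
    obtain ⟨h2, h2'⟩ := hpos (fun x => -a x) hac.neg hneg
    have := V.sub_mem (h _ h1 h1' fun x => le_sup_right) (h _ h2 h2' fun x => le_sup_right)
    convert this using 1
    refine ext_ae ?_
    have h3 := coeFn_add (mk (ω := ω) _ (memLp_of_cc h1 h1') - mk _ (memLp_of_cc h2 h2'))
      (mk _ (memLp_of_cc h2 h2'))
    rw [sub_add_cancel] at h3
    filter_upwards [coeFn_mk (ω := ω) _ (memLp_of_cc ha ha'), coeFn_mk (ω := ω) _ (memLp_of_cc h1 h1'),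
      coeFn_mk (ω := ω) _ (memLp_of_cc h2 h2'), h3] with x e1 e2 e3 e4
    rw [e2, e3] at e4
    rw [e1, ← sub_eq_iff_eq_add.2 e4, ← Complex.ofReal_sub]
    congr 1
    rcases le_total 0 (a x) with h | h <;> simp [h]
  have hcc : ∀ (a : G → ℂ) (ha : Continuous a) (ha' : HasCompactSupport a),
      mk a (memLp_of_cc ha ha') ∈ V := by
    intro a ha ha'
    have h1 : Continuous fun x => ((a x).re : ℂ) := by fun_prop
    have h2 : Continuous fun x => ((a x).im : ℂ) := by fun_prop
    have h1' : HasCompactSupport fun x => ((a x).re : ℂ) :=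
      ha'.comp_left (g := fun z : ℂ => (z.re : ℂ)) (by simp)
    have h2' : HasCompactSupport fun x => ((a x).im : ℂ) :=
      ha'.comp_left (g := fun z : ℂ => (z.im : ℂ)) (by simp)
    have := V.add_mem (hreal _ h1 h1') (V.smul_mem Complex.I (hreal _ h2 h2'))
    convert this using 1
    refine ext_ae ?_
    filter_upwards [coeFn_mk (ω := ω) _ (memLp_of_cc ha ha'), coeFn_mk (ω := ω) _ (memLp_of_cc h1 h1'),
      coeFn_mk (ω := ω) _ (memLp_of_cc h2 h2'), coeFn_smul Complex.I (mk (ω := ω) _ (memLp_of_cc h2 h2')),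
      coeFn_add (mk (ω := ω) _ (memLp_of_cc h1 h1')) (Complex.I • mk (ω := ω) _ (memLp_of_cc h2 h2'))]
      with x e1 e2 e3 e4 e5
    rw [e1, e5, e2, e4, e3, mul_comm, Complex.re_add_im]
  have : f ∈ closure (V : Set (BeurlingAlgebra ω)) := by
    rw [Metric.mem_closure_iff]
    intro ε hε
    obtain ⟨g, hg, hg', h1⟩ := exists_cc_norm_sub_le f (half_pos hε)
    exact ⟨_, hcc g hg hg', by rw [dist_eq_norm]; linarith⟩
  rwa [hV.closure_eq] at this

theorem dual_ext_cc {y z : StrongDual ℂ (BeurlingAlgebra ω)}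
    (h : ∀ (a : G → ℝ) (ha : Continuous fun x => (a x : ℂ))
      (ha' : HasCompactSupport fun x => (a x : ℂ)), (∀ x, 0 ≤ a x) →
      y (mk (fun x => (a x : ℂ)) (memLp_of_cc ha ha')) =
        z (mk (fun x => (a x : ℂ)) (memLp_of_cc ha ha'))) : y = z := by
  ext f
  exact mem_of_isClosed_of_cc (V := LinearMap.eqLocus (y : BeurlingAlgebra ω →ₗ[ℂ] ℂ)
    (z : BeurlingAlgebra ω →ₗ[ℂ] ℂ)) (isClosed_eq y.continuous z.continuous) h f

/-! ### Approximate identities -/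

theorem exists_bump {U : Set G} (hU : U ∈ 𝓝 (1 : G)) : ∃ φ : G → ℝ, Continuous φ ∧
    HasCompactSupport φ ∧ (∀ x, 0 ≤ φ x) ∧ (∀ x, x ∉ U → φ x = 0) ∧
      ∫ x, φ x ∂(Measure.haar : Measure G) = 1 := by
  obtain ⟨V, hVU, hV, h1V⟩ := mem_nhds_iff.1 hU
  obtain ⟨φ, hφ1, hφ0, hφs, hφI⟩ := exists_continuous_one_zero_of_isCompact
    (isCompact_singleton (x := (1 : G))) hV.isClosed_compl (by simpa using h1V)
  have hpos : 0 < ∫ x, φ x ∂(Measure.haar : Measure G) := by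
    refine φ.continuous.integral_pos_of_hasCompactSupport_nonneg_nonzero hφs
      (fun x => (hφI x).1) (x := 1) ?_
    rw [hφ1 rfl]
    simp
  refine ⟨fun x => (∫ x, φ x ∂(Measure.haar : Measure G))⁻¹ * φ x, by fun_prop, hφs.mul_left,
    fun x => mul_nonneg (inv_nonneg.2 hpos.le) (hφI x).1, fun x hx => ?_, ?_⟩
  · simp only
    rw [hφ0 (fun h => hx (hVU h))]
    simp
  · rw [integral_const_mul, inv_mul_cancel₀ hpos.ne']

/-- A bounded left approximate identity. -/
theorem exists_approxIdentity (ω : GroupWeight G) : ∃ 𝓤 : Ultrafilter (BeurlingAlgebra ω),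
    (∀ᶠ e in (𝓤 : Filter (BeurlingAlgebra ω)), ‖e‖ ≤ 2) ∧
      ∀ a : BeurlingAlgebra ω, Tendsto (fun e => e * a) 𝓤 (𝓝 a) := by
  -- Since `ω 1 = 1`, bumps of integral one can be supported where `ω < 2`; this is the source of
  -- the norm bound `2`.
  have hω : {x | ω x < 2} ∈ 𝓝 (1 : G) := by
    refine (isOpen_lt ω.continuous_toFun continuous_const).mem_nhds ?_
    change ω 1 < 2
    rw [ω.toFun_one]
    norm_num
  have : ∀ U ∈ 𝓝 (1 : G), ∃ e : BeurlingAlgebra ω, ‖e‖ ≤ 2 ∧ ∀ a : BeurlingAlgebra ω,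
      ∀ ε : ℝ, (∀ y ∈ U, ‖translate y a - a‖ ≤ ε) → ‖e * a - a‖ ≤ ε := by
    intro U hU
    obtain ⟨φ, hφ, hφ', h0, hφU, hφ1⟩ := exists_bump (inter_mem hU hω)
    have hc : Continuous fun x => (φ x : ℂ) := by fun_prop
    have hc' : HasCompactSupport fun x => (φ x : ℂ) := hφ'.comp_left Complex.ofReal_zero
    have hφi : Integrable φ (Measure.haar : Measure G) := hφ.integrable_of_hasCompactSupport hφ'
    refine ⟨mk _ (memLp_of_cc hc hc'), ?_, fun a ε hε => ?_⟩
    · rw [norm_eq]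
      calc ∫ x, ω x * ‖mk (ω := ω) _ (memLp_of_cc hc hc') x‖ ∂(Measure.haar : Measure G)
          ≤ ∫ x, 2 * φ x ∂(Measure.haar : Measure G) := by
            refine integral_mono_ae (integrable_weight_mul_norm _) (hφi.const_mul 2) ?_
            filter_upwards [coeFn_mk (ω := ω) _ (memLp_of_cc hc hc')] with x hx
            rw [hx, Complex.norm_real, Real.norm_of_nonneg (h0 x)]
            by_cases hxU : x ∈ U ∩ {x | ω x < 2}
            · exact mul_le_mul_of_nonneg_right (le_of_lt hxU.2) (h0 x)
            · simp [hφU x hxU]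
        _ = 2 := by rw [integral_const_mul, hφ1, mul_one]
    · have e1 : a = ∫ y, (φ y : ℂ) • a ∂(Measure.haar : Measure G) := by
        rw [integral_smul_const, integral_complex_ofReal, hφ1, Complex.ofReal_one, one_smul]
      have e2 : mk (ω := ω) _ (memLp_of_cc hc hc') * a =
          ∫ y, (φ y : ℂ) • translate y a ∂(Measure.haar : Measure G) := by
        rw [mul_def]
        refine integral_congr_ae ?_
        filter_upwards [coeFn_mk (ω := ω) _ (memLp_of_cc hc hc')] with x hx
        rw [hx]
      have i1 : Integrable (fun y => (φ y : ℂ) • a) (Measure.haar : Measure G) :=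
        (hφi.ofReal (𝕜 := ℂ)).smul_const a
      have i2 : Integrable (fun y => (φ y : ℂ) • translate y a) (Measure.haar : Measure G) := by
        refine (integrable_smul_translate (mk (ω := ω) _ (memLp_of_cc hc hc')) a).congr ?_
        filter_upwards [coeFn_mk (ω := ω) _ (memLp_of_cc hc hc')] with x hx
        rw [hx]
      have e3 : mk (ω := ω) _ (memLp_of_cc hc hc') * a - a =
          ∫ y, ((φ y : ℂ) • translate y a - (φ y : ℂ) • a) ∂(Measure.haar : Measure G) := by
        rw [integral_sub i2 i1, ← e1, ← e2]
      rw [e3]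
      calc _ ≤ ∫ y, φ y * ε ∂(Measure.haar : Measure G) := by
            refine norm_integral_le_of_norm_le (hφi.mul_const ε) (Eventually.of_forall fun y => ?_)
            rw [← smul_sub, norm_smul, Complex.norm_real, Real.norm_of_nonneg (h0 y)]
            by_cases hy : y ∈ U ∩ {x | ω x < 2}
            · exact mul_le_mul_of_nonneg_left (hε y hy.1) (h0 y)
            · simp [hφU y hy]
        _ = ε := by rw [integral_mul_const, hφ1, one_mul]
  choose! e he hea using this
  -- `smallSets` also contains sets that are not neighbourhoods, such as `∅`; the principal filter
  -- discards them. An ultrafilter finer than this filter is used later so that weak-* limits exist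
  -- along it.
  have hne : ((𝓝 (1 : G)).smallSets ⊓ 𝓟 (𝓝 (1 : G)).sets).NeBot := by
    rw [((𝓝 (1 : G)).basis_sets.smallSets).inf_principal_neBot_iff]
    exact fun {s} hs => ⟨s, Subset.rfl, hs⟩
  have hmem : ∀ᶠ U in (𝓝 (1 : G)).smallSets ⊓ 𝓟 (𝓝 (1 : G)).sets, U ∈ 𝓝 (1 : G) :=
    mem_inf_of_right (mem_principal_self _)
  refine ⟨(Ultrafilter.of ((𝓝 (1 : G)).smallSets ⊓ 𝓟 (𝓝 (1 : G)).sets)).map e, ?_, fun a => ?_⟩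
  · rw [Ultrafilter.coe_map, eventually_map]
    exact Ultrafilter.of_le _ (hmem.mono fun U hU => he U hU)
  rw [Ultrafilter.coe_map, tendsto_map'_iff]
  refine Tendsto.mono_left ?_ (Ultrafilter.of_le _)
  rw [Metric.tendsto_nhds]
  intro ε hε
  have hcont : ContinuousAt (fun y => translate y a) 1 := (continuous_translate a).continuousAt
  have h1a : translate 1 a = a := ext_ae <| by
    filter_upwards [coeFn_translate 1 a] with x hx
    rw [hx, inv_one, one_mul]
  have hW : {y | dist (translate y a) a < ε / 2} ∈ 𝓝 (1 : G) := by
    have := Metric.tendsto_nhds.1 hcont (ε / 2) (by positivity)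
    simp only [h1a] at this
    exact this
  have hsub : ∀ᶠ U in (𝓝 (1 : G)).smallSets ⊓ 𝓟 (𝓝 (1 : G)).sets,
      U ⊆ {y | dist (translate y a) a < ε / 2} :=
    mem_inf_of_left (eventually_smallSets_subset.2 hW)
  filter_upwards [hsub, hmem] with U hU hU1
  rw [Function.comp_apply, dist_eq_norm]
  refine (hea U hU1 a (ε / 2) fun y hy => ?_).trans_lt (by linarith)
  rw [← dist_eq_norm]
  exact le_of_lt (hU hy)

end BeurlingAlgebra

namespace BeurlingAlgebra

variable {G : Type*} [Group G] [TopologicalSpace G] [IsTopologicalGroup G] [LocallyCompactSpace G]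
  [MeasurableSpace G] [BorelSpace G] {ω : GroupWeight G}

/-! ### Right translation -/

/-- The push-forward is again regular and left invariant, hence a multiple of Haar measure; the
modular function is that multiple. -/
theorem map_mul_right_haar (t : G) : Measure.map (· * t) (Measure.haar : Measure G) =
    Measure.modularCharacterFun t • (Measure.haar : Measure G) := by
  have : (Measure.map (· * t) (Measure.haar : Measure G)).Regular :=
    Measure.Regular.map (Homeomorph.mulRight t)
  rw [Measure.modularCharacterFun_eq_haarScalarFactor (Measure.haar : Measure G) t]
  exact Measure.isMulLeftInvariant_eq_smul_of_regular _ _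

theorem modularCharacterFun_mul_inv (t : G) :
    Measure.modularCharacterFun t * Measure.modularCharacterFun t⁻¹ = 1 := by
  rw [← Measure.modularCharacterFun_map_mul, mul_inv_cancel, Measure.modularCharacterFun_map_one]

theorem integral_comp_mul_right {E : Type*} [NormedAddCommGroup E] [NormedSpace ℝ E] (f : G → E)
    (t : G) : ∫ x, f (x * t) ∂(Measure.haar : Measure G) =
      (Measure.modularCharacterFun t : ℝ) • ∫ x, f x ∂(Measure.haar : Measure G) := by
  have := integral_map_equiv (μ := (Measure.haar : Measure G)) (MeasurableEquiv.mulRight t) f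
  rw [MeasurableEquiv.coe_mulRight, map_mul_right_haar, integral_smul_nnreal_measure] at this
  exact this.symm

theorem lintegral_comp_mul_right (f : G → ℝ≥0∞) (t : G) :
    ∫⁻ x, f (x * t) ∂(Measure.haar : Measure G) =
      (Measure.modularCharacterFun t : ℝ≥0∞) * ∫⁻ x, f x ∂(Measure.haar : Measure G) := by
  have := lintegral_map_equiv (μ := (Measure.haar : Measure G)) f (MeasurableEquiv.mulRight t)
  rw [MeasurableEquiv.coe_mulRight, map_mul_right_haar, lintegral_smul_measure] at this
  exact this.symm

theorem quasiMeasurePreserving_mul_right' (t : G) :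
    Measure.QuasiMeasurePreserving (· * t) (Measure.haar : Measure G) Measure.haar := by
  refine ⟨measurable_mul_const t, ?_⟩
  rw [map_mul_right_haar]
  exact Measure.smul_absolutelyContinuous

theorem comp_mul_right_ae {α : Type*} {f g : G → α} (h : f =ᵐ[(Measure.haar : Measure G)] g)
    (t : G) : (fun x => f (x * t)) =ᵐ[(Measure.haar : Measure G)] fun x => g (x * t) :=
  (quasiMeasurePreserving_mul_right' t).ae_eq_comp h

/-- Convolution of a function on the right by the point mass at `t`. -/
def rightFun (t : G) (f : G → ℂ) (x : G) : ℂ :=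
  ((Measure.modularCharacterFun t : ℝ) : ℂ) * f (x * t⁻¹)

theorem enorm_rightFun (t : G) (f : G → ℂ) (x : G) :
    ‖rightFun t f x‖ₑ = (Measure.modularCharacterFun t : ℝ≥0∞) * ‖f (x * t⁻¹)‖ₑ := by
  rw [rightFun, enorm_mul]
  congr 1
  rw [← ofReal_norm, Complex.norm_real, Real.norm_of_nonneg NNReal.zero_le_coe,
    ENNReal.ofReal_coe_nnreal]

theorem lintegral_rightFun_le (t : G) (f : G → ℂ) :
    ∫⁻ x, ENNReal.ofReal (ω x) * ‖rightFun t f x‖ₑ ∂(Measure.haar : Measure G) ≤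
      ENNReal.ofReal (ω t) * ∫⁻ x, ENNReal.ofReal (ω x) * ‖f x‖ₑ ∂(Measure.haar : Measure G) := by
  have h1 := lintegral_comp_mul_right (fun x => (Measure.modularCharacterFun t : ℝ≥0∞) *
    (ENNReal.ofReal (ω (x * t)) * ‖f x‖ₑ)) t⁻¹
  simp only [inv_mul_cancel_right] at h1
  rw [lintegral_const_mul' _ _ ENNReal.coe_ne_top, lintegral_const_mul' _ _ ENNReal.coe_ne_top,
    ← mul_assoc, ← ENNReal.coe_mul, mul_comm (Measure.modularCharacterFun t⁻¹), modularCharacterFun_mul_inv, ENNReal.coe_one,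
    one_mul] at h1
  calc _ = (Measure.modularCharacterFun t : ℝ≥0∞) *
        ∫⁻ x, ENNReal.ofReal (ω x) * ‖f (x * t⁻¹)‖ₑ ∂(Measure.haar : Measure G) := by
        rw [← lintegral_const_mul' _ _ ENNReal.coe_ne_top]
        refine lintegral_congr fun x => ?_
        rw [enorm_rightFun]
        ring
    _ = _ := h1
    _ ≤ _ := by
        rw [← lintegral_const_mul' _ _ ENNReal.ofReal_ne_top]
        refine lintegral_mono fun x => ?_
        rw [← mul_assoc, ← ENNReal.ofReal_mul (weight_pos ω t).le]
        gcongr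
        rw [mul_comm (ω t)]
        exact ω.toFun_mul_le x t

theorem rightFun_ae {f g : G → ℂ} (h : f =ᵐ[(Measure.haar : Measure G)] g) (t : G) :
    rightFun t f =ᵐ[(Measure.haar : Measure G)] rightFun t g := by
  filter_upwards [comp_mul_right_ae h t⁻¹] with x hx
  simp only [rightFun, hx]

theorem memLp_rightFun (t : G) (f : BeurlingAlgebra ω) : MemLp (rightFun t f) 1 ω.measure := by
  rw [memLp_iff]
  refine ⟨((aestronglyMeasurable f).comp_quasiMeasurePreserving
    (quasiMeasurePreserving_mul_right' t⁻¹)).const_mul _, ?_⟩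
  refine (lintegral_rightFun_le t f).trans_lt ?_
  exact ENNReal.mul_lt_top ENNReal.ofReal_lt_top (memLp_iff.1 (memLp f)).2

/-- Right convolution by the point mass at `t`, that is `(f δ_t)(x) = Δ(t) f(x t⁻¹)`. -/
def rightTranslate (t : G) : BeurlingAlgebra ω →L[ℂ] BeurlingAlgebra ω :=
  LinearMap.mkContinuous
    { toFun := fun f => mk (rightFun t f) (memLp_rightFun t f)
      map_add' := fun f g => ext_ae <| by
        filter_upwards [coeFn_mk _ (memLp_rightFun t (f + g)), coeFn_mk _ (memLp_rightFun t f),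
          coeFn_mk _ (memLp_rightFun t g), comp_mul_right_ae (coeFn_add f g) t⁻¹,
          coeFn_add (mk _ (memLp_rightFun t f)) (mk _ (memLp_rightFun t g))]
          with x h1 h2 h3 h4 h5
        rw [h1, h5, h2, h3, rightFun, h4, rightFun, rightFun, mul_add]
      map_smul' := fun c f => ext_ae <| by
        filter_upwards [coeFn_mk _ (memLp_rightFun t (c • f)), coeFn_mk _ (memLp_rightFun t f),
          comp_mul_right_ae (coeFn_smul c f) t⁻¹, coeFn_smul c (mk _ (memLp_rightFun t f))]
          with x h1 h2 h3 h4
        rw [h1, RingHom.id_apply, h4, h2, rightFun, h3, rightFun]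
        ring }
    (ω t) (fun f => by
      rw [← ENNReal.ofReal_le_ofReal_iff (mul_nonneg (weight_pos ω t).le (norm_nonneg f)),
        ENNReal.ofReal_mul (weight_pos ω t).le, enorm_eq, enorm_eq]
      refine le_trans (le_of_eq (lintegral_congr_ae ?_)) (lintegral_rightFun_le t f)
      filter_upwards [coeFn_mk _ (memLp_rightFun t f)] with x h1
      simp only [LinearMap.coe_mk, AddHom.coe_mk, h1])

theorem coeFn_rightTranslate (t : G) (f : BeurlingAlgebra ω) :
    rightTranslate t f =ᵐ[(Measure.haar : Measure G)] rightFun t f :=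
  coeFn_mk _ (memLp_rightFun t f)

theorem norm_rightTranslate_le (t : G) (f : BeurlingAlgebra ω) :
    ‖rightTranslate t f‖ ≤ ω t * ‖f‖ :=
  ContinuousLinearMap.le_of_opNorm_le _
    (LinearMap.mkContinuous_norm_le _ (weight_pos ω t).le _) f

theorem rightTranslate_mul (s t : G) (f : BeurlingAlgebra ω) :
    rightTranslate (s * t) f = rightTranslate t (rightTranslate s f) := ext_ae <| by
  filter_upwards [coeFn_rightTranslate (s * t) f, coeFn_rightTranslate t (rightTranslate s f),
    rightFun_ae (coeFn_rightTranslate s f) t] with x h1 h2 h3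
  rw [h1, h2, h3]
  simp only [rightFun, Measure.modularCharacterFun_map_mul, mul_inv_rev, mul_assoc]
  push_cast
  ring

theorem rightTranslate_one (f : BeurlingAlgebra ω) : rightTranslate 1 f = f := ext_ae <| by
  filter_upwards [coeFn_rightTranslate 1 f] with x h1
  simp [h1, rightFun, Measure.modularCharacterFun_map_one]

theorem translate_one (f : BeurlingAlgebra ω) : translate 1 f = f := ext_ae <| by
  filter_upwards [coeFn_translate 1 f] with x h1
  simp [h1]

theorem translate_rightTranslate (s t : G) (f : BeurlingAlgebra ω) :
    translate s (rightTranslate t f) = rightTranslate t (translate s f) := ext_ae <| by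
  filter_upwards [coeFn_rightTranslate t (translate s f), coeFn_translate s (rightTranslate t f),
    rightFun_ae (coeFn_translate s f) t, comp_mul_left_ae (coeFn_rightTranslate t f) s]
    with x h1 h2 h3 h4
  rw [h1, h2, h3, h4]
  simp only [rightFun, mul_assoc]

variable [T2Space G]

theorem mul_rightTranslate (a c : BeurlingAlgebra ω) (t : G) :
    a * rightTranslate t c = rightTranslate t (a * c) := by
  rw [mul_def, mul_def,
    ← ContinuousLinearMap.integral_comp_comm _ (integrable_smul_translate a c)]
  refine integral_congr_ae (Eventually.of_forall fun y => ?_)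
  simp only [map_smul, translate_rightTranslate]

/-- Associativity with a point mass in the middle. The substitution `y ↦ y t` produces one factor
`Δ(t)`, the definition of `rightTranslate` another, and they cancel. -/
theorem rightTranslate_mul_eq (a c : BeurlingAlgebra ω) (t : G) :
    rightTranslate t a * c = a * translate t c := by
  rw [mul_def, mul_def]
  have h1 := integral_comp_mul_right (fun y => rightTranslate t a y • translate y c) t
  have h2 := comp_mul_right_ae (coeFn_rightTranslate t a) t
  have h3 : ∫ y, rightTranslate t a (y * t) • translate (y * t) c ∂(Measure.haar : Measure G) =
      (Measure.modularCharacterFun t : ℝ) •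
        ∫ y, a y • translate y (translate t c) ∂(Measure.haar : Measure G) := by
    rw [← integral_smul]
    refine integral_congr_ae ?_
    filter_upwards [h2] with y hy
    rw [hy, rightFun, mul_inv_cancel_right, translate_mul, mul_smul]
    exact Complex.coe_smul _ _
  have h4 := h1.symm.trans h3
  have h5 : (Measure.modularCharacterFun t : ℝ) ≠ 0 := by
    exact_mod_cast (Measure.modularCharacterFun_pos t).ne'
  exact smul_right_injective _ h5 h4

/-- For a bump `φ` of integral one, `Δ(t) = ∫ φ(x t) dx`, and for `t` in a compact neighbourhood the
integrand lives on a fixed compact set. -/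
theorem continuous_modularCharacterFun :
    Continuous fun t : G => (Measure.modularCharacterFun t : ℝ) := by
  obtain ⟨φ, hφ, hφ', -, -, hφ1⟩ := exists_bump (univ_mem : univ ∈ 𝓝 (1 : G))
  have h : ∀ t : G, (Measure.modularCharacterFun t : ℝ) =
      ∫ x, φ (x * t) ∂(Measure.haar : Measure G) := fun t => by
    rw [integral_comp_mul_right φ t, hφ1, smul_eq_mul, mul_one]
  simp only [h]
  rw [continuous_iff_continuousAt]
  intro t₀
  obtain ⟨V, hV, hVt⟩ := exists_compact_mem_nhds t₀
  refine ContinuousOn.continuousAt (s := V) ?_ hVt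
  refine continuousOn_integral_of_compact_support (k := {x | ∃ y ∈ tsupport φ, ∃ z ∈ V, y * z⁻¹ = x})
    ?_ (Continuous.continuousOn (by fun_prop)) ?_
  · convert (hφ'.isCompact.prod hV).image (f := fun p : G × G => p.1 * p.2⁻¹) (by fun_prop) using 1
    ext x
    simp [and_assoc]
  · intro t x ht hx
    by_contra hne
    exact hx ⟨x * t, subset_tsupport _ hne, t, ht, by simp⟩

/-- For `t` in a compact neighbourhood of `t₀` the norm of the difference is an integral over a
fixed compact set, hence continuous in `t`. -/
theorem continuous_rightTranslate_mk {g : G → ℂ} (hg : Continuous g) (hg' : HasCompactSupport g) :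
    Continuous fun t => rightTranslate t (mk (ω := ω) g (memLp_of_cc hg hg')) := by
  rw [continuous_iff_continuousAt]
  intro t₀
  obtain ⟨V, hV, hVt⟩ := exists_compact_mem_nhds t₀
  rw [ContinuousAt, tendsto_iff_norm_sub_tendsto_zero]
  have hcont : ContinuousOn (fun t => ∫ x, ω x * ‖rightFun t g x - rightFun t₀ g x‖
      ∂(Measure.haar : Measure G)) V := by
    refine continuousOn_integral_of_compact_support (hg'.isCompact.mul hV) ?_ ?_
    · refine Continuous.continuousOn ?_
      have hω := ω.continuous_toFun
      have hΔ := continuous_modularCharacterFun (G := G)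
      unfold rightFun
      refine (hω.comp continuous_snd).mul (Continuous.norm (Continuous.sub (Continuous.mul ?_ ?_)
        (Continuous.mul ?_ ?_)))
      · exact Complex.continuous_ofReal.comp (hΔ.comp continuous_fst)
      · fun_prop
      · exact continuous_const
      · fun_prop
    · intro t x ht hx
      have : ∀ z ∈ V, g (x * z⁻¹) = 0 := fun z hz => by
        refine image_eq_zero_of_notMem_tsupport fun h => hx ?_
        exact ⟨_, h, z, hz, by simp⟩
      simp only [rightFun]
      rw [this t ht, this t₀ (mem_of_mem_nhds hVt)]
      simp
  have hlim := hcont.continuousAt hVt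
  rw [ContinuousAt] at hlim
  simp only [sub_self, norm_zero, mul_zero, integral_zero] at hlim
  refine hlim.congr fun t => ?_
  rw [norm_eq]
  refine integral_congr_ae ?_
  set F : BeurlingAlgebra ω := mk g (memLp_of_cc hg hg')
  have h0 : F =ᵐ[(Measure.haar : Measure G)] g := coeFn_mk _ _
  have h1 := coeFn_add (rightTranslate t F - rightTranslate t₀ F) (rightTranslate t₀ F)
  rw [sub_add_cancel] at h1
  filter_upwards [h1, coeFn_rightTranslate t F, coeFn_rightTranslate t₀ F, rightFun_ae h0 t,
    rightFun_ae h0 t₀] with x h1 h2 h3 h4 h5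
  have h6 : (rightTranslate t F - rightTranslate t₀ F) x = rightFun t g x - rightFun t₀ g x := by
    rw [h2, h4, h3, h5] at h1
    rw [h1]
    ring
  rw [h6]

theorem integrable_smul_rightTranslate {b c : G → ℂ} (hb : Continuous b)
    (hb' : HasCompactSupport b) (hc : Continuous c) (hc' : HasCompactSupport c) :
    Integrable (fun s => b s • rightTranslate s (mk (ω := ω) c (memLp_of_cc hc hc')))
      (Measure.haar : Measure G) := by
  have h1 : Continuous fun s => b s • rightTranslate s (mk (ω := ω) c (memLp_of_cc hc hc')) :=
    hb.smul (continuous_rightTranslate_mk hc hc')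
  exact h1.integrable_of_hasCompactSupport hb'.smul_right

/-- Convolution as an integral of right translates. -/
theorem integral_smul_rightTranslate {b c : G → ℂ} (hb : Continuous b)
    (hb' : HasCompactSupport b) (hc : Continuous c) (hc' : HasCompactSupport c) :
    ∫ s, b s • rightTranslate s (mk (ω := ω) c (memLp_of_cc hc hc')) ∂(Measure.haar : Measure G) =
      mk c (memLp_of_cc hc hc') * mk b (memLp_of_cc hb hb') := by
  rw [mk_mul_mk hc hc' hb hb']
  refine eq_of_forall_integral_mul_cc fun g hg hg' => ?_
  obtain ⟨C, hC⟩ := exists_bound_of_cc ω hg hg'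
  have hm := aestronglyMeasurable_of_cc hg hg'
  rw [← dualOfFun_apply hm hC (mk (cconv c b) _), dualOfFun_mk, integral_mul_cconv hc hc' hb hb' hg,
    ← dualOfFun_apply hm hC,
    ← ContinuousLinearMap.integral_comp_comm _ (integrable_smul_rightTranslate hb hb' hc hc')]
  have h1 : ∀ s, dualOfFun g hm C hC (b s • rightTranslate s (mk (ω := ω) c (memLp_of_cc hc hc'))) =
      ∫ y, b s * (g (y * s) * c y) ∂(Measure.haar : Measure G) := by
    intro s
    rw [map_smul, smul_eq_mul, integral_const_mul, dualOfFun_apply]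
    congr 1
    have h2 := integral_comp_mul_right (fun x => g x * c (x * s⁻¹)) s
    simp only [mul_inv_cancel_right] at h2
    rw [h2, ← integral_smul]
    refine integral_congr_ae ?_
    filter_upwards [coeFn_rightTranslate s (mk (ω := ω) c (memLp_of_cc hc hc')),
      rightFun_ae (coeFn_mk (ω := ω) c (memLp_of_cc hc hc')) s] with x e1 e2
    rw [e1, e2, rightFun, Complex.real_smul]
    ring
  simp only [h1]
  rw [integral_integral_swap_of_hasCompactSupport]
  · refine integral_congr_ae (Eventually.of_forall fun y => ?_)
    simp only
    rw [← integral_const_mul]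
    refine integral_congr_ae (Eventually.of_forall fun x => ?_)
    simp only
    ring
  · exact (by fun_prop : Continuous fun p : G × G => b p.1 * (g (p.2 * p.1) * c p.2))
  · refine HasCompactSupport.intro (hb'.isCompact.prod hc'.isCompact) fun p hp => ?_
    by_contra hne
    simp only [Function.uncurry, mul_eq_zero, not_or] at hne
    exact hp ⟨subset_tsupport _ hne.1, subset_tsupport _ hne.2.2⟩

end BeurlingAlgebra

/-! ### Suprema of families of functionals on a normed lattice -/

section LatticeDual

variable {E : Type*} [NormedAddCommGroup E] [Lattice E] [IsOrderedAddMonoid E] [HasSolidNorm E]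
  [NormedSpace ℝ E] {ι : Type*}

/-- A function that is additive and bounded on the positive cone of a normed lattice extends to a
continuous linear functional. -/
theorem exists_clm_of_additive_on_nonneg (s : E → ℝ)
    (hs : ∀ f g, 0 ≤ f → 0 ≤ g → s (f + g) = s f + s g) (C : ℝ) (hC : ∀ f, 0 ≤ f → |s f| ≤ C * ‖f‖) :
    ∃ S : E →L[ℝ] ℝ, ∀ f, 0 ≤ f → S f = s f := by
  have hadd : ∀ f g : E, s (f + g)⁺ - s (f + g)⁻ = (s f⁺ - s f⁻) + (s g⁺ - s g⁻) := by
    intro f g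
    have h1 : (f + g)⁺ + (f⁻ + g⁻) = (f + g)⁻ + (f⁺ + g⁺) := by
      have e1 := posPart_sub_negPart (f + g)
      have e2 := posPart_sub_negPart f
      have e3 := posPart_sub_negPart g
      have : (f + g)⁺ - (f + g)⁻ = (f⁺ - f⁻) + (g⁺ - g⁻) := by rw [e1, e2, e3]
      rw [← sub_eq_zero] at this ⊢
      rw [← this]
      abel
    have h2 := congrArg s h1
    rw [hs _ _ (posPart_nonneg _) (add_nonneg (negPart_nonneg _) (negPart_nonneg _)),
      hs _ _ (negPart_nonneg _) (negPart_nonneg _),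
      hs _ _ (negPart_nonneg _) (add_nonneg (posPart_nonneg _) (posPart_nonneg _)),
      hs _ _ (posPart_nonneg _) (posPart_nonneg _)] at h2
    linarith
  have hpos : ∀ f : E, ‖f⁺‖ ≤ ‖f‖ := fun f => norm_le_norm_of_abs_le_abs (by
    rw [abs_of_nonneg (posPart_nonneg f), ← posPart_add_negPart f]
    exact le_add_of_nonneg_right (negPart_nonneg f))
  have hneg : ∀ f : E, ‖f⁻‖ ≤ ‖f‖ := fun f => norm_le_norm_of_abs_le_abs (by
    rw [abs_of_nonneg (negPart_nonneg f), ← posPart_add_negPart f]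
    exact le_add_of_nonneg_left (posPart_nonneg f))
  -- Homogeneity of `s` is not required: a continuous additive map between real normed spaces is
  -- automatically real-linear.
  let φ : E →+ ℝ := AddMonoidHom.mk' (fun f => s f⁺ - s f⁻) hadd
  have hC0 : ∀ f : E, |φ f| ≤ 2 * |C| * ‖f‖ := by
    intro f
    have h1 := hC _ (posPart_nonneg f)
    have h2 := hC _ (negPart_nonneg f)
    have h3 : C * ‖f⁺‖ ≤ |C| * ‖f‖ :=
      mul_le_mul (le_abs_self C) (hpos f) (norm_nonneg _) (abs_nonneg _)
    have h4 : C * ‖f⁻‖ ≤ |C| * ‖f‖ :=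
      mul_le_mul (le_abs_self C) (hneg f) (norm_nonneg _) (abs_nonneg _)
    have h5 : |φ f| ≤ |s f⁺| + |s f⁻| := abs_sub _ _
    linarith
  have hφ : Continuous φ := AddMonoidHomClass.continuous_of_bound φ (2 * |C|) hC0
  have h00 : s 0 = 0 := by
    have := hs 0 0 le_rfl le_rfl
    rw [add_zero] at this
    linarith
  refine ⟨φ.toRealLinearMap hφ, fun f hf => ?_⟩
  change s f⁺ - s f⁻ = s f
  rw [posPart_of_nonneg hf, negPart_of_nonneg hf, h00, sub_zero]

/-- The values `∑ z i (g i)` over finite decompositions of `f` into positive elements. -/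
def decompValues (z : ι → E →L[ℝ] ℝ) (f : E) : Set ℝ :=
  {r | ∃ l : List (ι × E), (∀ p ∈ l, 0 ≤ p.2) ∧ (l.map Prod.snd).sum = f ∧
    (l.map fun p => z p.1 p.2).sum = r}

/-- Riesz decomposition, one term at a time: the part `p.2 ⊓ f` of a term is charged to `f` and the
remainder to `g`. The remainder is at most `g` because `p.2 ≤ f + g`, so the induction continues
with what is left of `f` and `g`. -/
theorem decompValues_split (z : ι → E →L[ℝ] ℝ) (l : List (ι × E)) (hl : ∀ p ∈ l, 0 ≤ p.2) :
    ∀ f g : E, 0 ≤ f → 0 ≤ g → (l.map Prod.snd).sum = f + g →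
      ∃ r₁ ∈ decompValues z f, ∃ r₂ ∈ decompValues z g, (l.map fun p => z p.1 p.2).sum = r₁ + r₂ := by
  induction l with
  | nil =>
    intro f g hf hg h
    simp only [List.map_nil, List.sum_nil] at h
    obtain ⟨rfl, rfl⟩ := (add_eq_zero_iff_of_nonneg hf hg).1 h.symm
    exact ⟨0, ⟨[], by simp, by simp, by simp⟩, 0, ⟨[], by simp, by simp, by simp⟩, by simp⟩
  | cons p l ih =>
    intro f g hf hg h
    simp only [List.map_cons, List.sum_cons] at h ⊢
    have hp : 0 ≤ p.2 := hl p List.mem_cons_self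
    have hrest : 0 ≤ (l.map Prod.snd).sum := by
      refine List.sum_nonneg fun x hx => ?_
      obtain ⟨q, hq, rfl⟩ := List.mem_map.1 hx
      exact hl q (List.mem_cons_of_mem _ hq)
    set u := p.2 ⊓ f with hu
    have hu0 : 0 ≤ u := le_inf hp hf
    have hv0 : 0 ≤ p.2 - u := sub_nonneg.2 inf_le_left
    have hvg : p.2 - u ≤ g := by
      rw [hu, sub_le_iff_le_add, ← sub_le_iff_le_add', le_inf_iff]
      constructor
      · exact sub_le_self _ hg
      · rw [sub_le_iff_le_add, ← h]
        exact le_add_of_nonneg_right hrest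
    obtain ⟨r₁, ⟨l₁, hl₁, hs₁, rfl⟩, r₂, ⟨l₂, hl₂, hs₂, rfl⟩, hr⟩ :=
      ih (fun q hq => hl q (List.mem_cons_of_mem _ hq)) (f - u) (g - (p.2 - u))
        (sub_nonneg.2 inf_le_right) (sub_nonneg.2 hvg) (by
          have : (l.map Prod.snd).sum = f + g - p.2 := by rw [← h]; abel
          rw [this]
          abel)
    refine ⟨_, ⟨(p.1, u) :: l₁, ?_, ?_, rfl⟩, _, ⟨(p.1, p.2 - u) :: l₂, ?_, ?_, rfl⟩, ?_⟩
    · intro q hq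
      rcases List.mem_cons.1 hq with rfl | hq
      · exact hu0
      · exact hl₁ q hq
    · simp [hs₁]
    · intro q hq
      rcases List.mem_cons.1 hq with rfl | hq
      · exact hv0
      · exact hl₂ q hq
    · simp [hs₂]
    · simp only [List.map_cons, List.sum_cons, hr, map_sub]
      ring

theorem sum_le_of_forall_le {z : ι → E →L[ℝ] ℝ} {T : E →L[ℝ] ℝ}
    (hT : ∀ i f, 0 ≤ f → z i f ≤ T f) {f : E} {r : ℝ} (hr : r ∈ decompValues z f) : r ≤ T f := by
  obtain ⟨l, hl, rfl, rfl⟩ := hr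
  rw [map_list_sum, List.map_map]
  refine List.sum_le_sum fun p hp => ?_
  exact hT _ _ (hl p hp)

/-- A family of functionals bounded above in the order dual of a normed lattice has a supremum. -/
theorem exists_isLUB_functional [Nonempty ι] (z : ι → E →L[ℝ] ℝ) (T : E →L[ℝ] ℝ)
    (hT : ∀ i f, 0 ≤ f → z i f ≤ T f) :
    ∃ S : E →L[ℝ] ℝ, (∀ i f, 0 ≤ f → z i f ≤ S f) ∧
      ∀ S' : E →L[ℝ] ℝ, (∀ i f, 0 ≤ f → z i f ≤ S' f) → ∀ f, 0 ≤ f → S f ≤ S' f := by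
  have hmem : ∀ i f, 0 ≤ f → z i f ∈ decompValues z f := fun i f hf =>
    ⟨[(i, f)], by simpa using hf, by simp, by simp⟩
  have hbdd : ∀ f, BddAbove (decompValues z f) := fun f =>
    ⟨T f, fun r hr => sum_le_of_forall_le hT hr⟩
  obtain ⟨i₀⟩ := ‹Nonempty ι›
  have hle : ∀ i f, 0 ≤ f → z i f ≤ sSup (decompValues z f) := fun i f hf =>
    le_csSup (hbdd f) (hmem i f hf)
  have hle' : ∀ S' : E →L[ℝ] ℝ, (∀ i f, 0 ≤ f → z i f ≤ S' f) → ∀ f, 0 ≤ f →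
      sSup (decompValues z f) ≤ S' f := fun S' hS' f hf =>
    csSup_le ⟨_, hmem i₀ f hf⟩ fun r hr => sum_le_of_forall_le hS' hr
  -- The Riesz–Kantorovich formula. Additivity of the supremum: splitting a decomposition of `f + g`
  -- gives `≤`, concatenating decompositions of `f` and `g` gives `≥`.
  obtain ⟨S, hS⟩ := exists_clm_of_additive_on_nonneg (fun f => sSup (decompValues z f)) (by
    intro f g hf hg
    apply le_antisymm
    · refine csSup_le ⟨_, hmem i₀ _ (add_nonneg hf hg)⟩ ?_
      rintro r ⟨l, hl, hs, rfl⟩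
      obtain ⟨r₁, h₁, r₂, h₂, hr⟩ := decompValues_split z l hl f g hf hg hs
      rw [hr]
      exact add_le_add (le_csSup (hbdd f) h₁) (le_csSup (hbdd g) h₂)
    · rw [← le_sub_iff_add_le]
      refine csSup_le ⟨_, hmem i₀ _ hf⟩ ?_
      rintro r₁ ⟨l₁, hl₁, rfl, rfl⟩
      rw [le_sub_comm]
      refine csSup_le ⟨_, hmem i₀ _ hg⟩ ?_
      rintro r₂ ⟨l₂, hl₂, rfl, rfl⟩
      rw [le_sub_iff_add_le']
      refine le_csSup (hbdd _) ⟨l₁ ++ l₂, ?_, by simp, by simp⟩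
      intro p hp
      rcases List.mem_append.1 hp with hp | hp
      · exact hl₁ p hp
      · exact hl₂ p hp) (‖z i₀‖ + ‖T‖) (by
    intro f hf
    have h1 := hle i₀ f hf
    have h2 := hle' T hT f hf
    have h3 := (abs_le.1 ((z i₀).le_opNorm f)).1
    have h4 := (abs_le.1 (T.le_opNorm f)).2
    have h5 : 0 ≤ ‖z i₀‖ * ‖f‖ := by positivity
    have h6 : 0 ≤ ‖T‖ * ‖f‖ := by positivity
    rw [abs_le]
    constructor <;> linarith)
  exact ⟨S, fun i f hf => (hS f hf).symm ▸ hle i f hf,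
    fun S' hS' f hf => (hS f hf).symm ▸ hle' S' hS' f hf⟩

end LatticeDual

/-! ### Suprema of bounded families in the dual of `L¹(G, ω)` -/

/-- Banach–Alaoglu: an ultrafilter on a weak-* compact ball converges. -/
theorem exists_ultrafilter_limit_dual {A : Type*} [NormedAddCommGroup A] [NormedSpace ℂ A]
    {α : Type*} (𝓤 : Ultrafilter α) (φ : α → StrongDual ℂ A) (C : ℝ)
    (h : ∀ᶠ x in (𝓤 : Filter α), ‖φ x‖ ≤ C) :
    ∃ φ₀ : StrongDual ℂ A, ‖φ₀‖ ≤ C ∧ ∀ f, Tendsto (fun x => φ x f) 𝓤 (𝓝 (φ₀ f)) := by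
  have hc := WeakDual.isCompact_closedBall (0 : StrongDual ℂ A) C
  obtain ⟨w, hw, hle⟩ := hc.ultrafilter_le_nhds' (𝓤.map fun x => StrongDual.toWeakDual (φ x)) (by
    rw [Ultrafilter.mem_map]
    filter_upwards [h] with x hx
    simpa using hx)
  refine ⟨WeakDual.toStrongDual w, by simpa using hw, fun f => ?_⟩
  have h2 : Tendsto (fun x => StrongDual.toWeakDual (φ x)) 𝓤 (𝓝 w) := by
    rwa [Tendsto, ← Ultrafilter.coe_map]
  exact ((WeakDual.eval_continuous f).tendsto w).comp h2

namespace BeurlingAlgebra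

variable {G : Type*} [Group G] [TopologicalSpace G] [IsTopologicalGroup G] [LocallyCompactSpace G]
  [MeasurableSpace G] [BorelSpace G] {ω : GroupWeight G}

/-- The cone of nonnegative functions. -/
def IsNonneg (f : BeurlingAlgebra ω) : Prop :=
  ∀ᵐ x ∂(Measure.haar : Measure G), f x = ((‖f x‖ : ℝ) : ℂ)

/-- Real-valued functions in `L¹(G, ω)`. -/
theorem exists_ofReal_re (ω : GroupWeight G) :
    ∃ (j : Lp ℝ 1 ω.measure →+ BeurlingAlgebra ω) (r : BeurlingAlgebra ω →+ Lp ℝ 1 ω.measure),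
      Continuous j ∧ Continuous r ∧ (∀ f, ‖j f‖ ≤ ‖f‖) ∧ (∀ f, 0 ≤ f → IsNonneg (j f)) ∧
      (∀ f, IsNonneg f → 0 ≤ r f) ∧ (∀ f, IsNonneg f → j (r f) = f) ∧
      (∀ f, IsNonneg f → r (Complex.I • f) = 0) := by
  let j₀ := Complex.ofRealCLM.compLpL 1 ω.measure
  let r₀ := Complex.reCLM.compLpL 1 ω.measure
  let j : Lp ℝ 1 ω.measure →+ BeurlingAlgebra ω := AddMonoidHom.mk' (fun f => j₀ f) (map_add j₀)
  let r : BeurlingAlgebra ω →+ Lp ℝ 1 ω.measure :=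
    AddMonoidHom.mk' (fun f => r₀ f) (fun f g => map_add r₀ f g)
  have hj : ∀ f : Lp ℝ 1 ω.measure, j f =ᵐ[(Measure.haar : Measure G)] fun x => (f x : ℂ) := by
    intro f
    have := Complex.ofRealCLM.coeFn_compLpL (p := 1) (μ := ω.measure) f
    rwa [ae_eq] at this
  have hr : ∀ f : BeurlingAlgebra ω, r f =ᵐ[(Measure.haar : Measure G)] fun x => (f x).re := by
    intro f
    have := Complex.reCLM.coeFn_compLpL (p := 1) (μ := ω.measure) f
    rwa [ae_eq] at this
  refine ⟨j, r, j₀.continuous, r₀.continuous, fun f => ?_, fun f hf => ?_, fun f hf => ?_,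
    fun f hf => ?_, fun f hf => ?_⟩
  · have := Complex.ofRealCLM.norm_compLp_le (p := 1) (μ := ω.measure) f
    rw [Complex.ofRealCLM_norm, one_mul] at this
    exact this
  · rw [← Lp.coeFn_nonneg, EventuallyLE, ae_eq] at hf
    filter_upwards [hj f, hf] with x h1 h2
    rw [h1, Complex.norm_real, Real.norm_of_nonneg h2]
  · rw [← Lp.coeFn_nonneg, EventuallyLE, ae_eq]
    filter_upwards [hr f, hf] with x h1 h2
    rw [h1, h2]
    simp
  · refine ext_ae ?_
    filter_upwards [hj (r f), hr f, hf] with x h1 h2 h3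
    rw [h1, h2, h3]
    simp
  · refine Lp.ext ?_
    rw [EventuallyEq, ae_eq]
    have h0 := Lp.coeFn_zero ℝ 1 ω.measure
    rw [EventuallyEq, ae_eq] at h0
    filter_upwards [hr (Complex.I • f), hf, coeFn_smul Complex.I f, h0] with x h1 h2 h3 h4
    rw [h1, h3, h2, h4]
    simp

/-- The `L¹` norm is additive on the positive cone, so `C` times the integral is a linear functional
dominating the whole family there. A norm-bounded family is thus order bounded, and the lattice
result applies to the real parts. -/
theorem exists_lub_dual {ι : Type*} [Nonempty ι] (ξ : ι → StrongDual ℂ (BeurlingAlgebra ω)) (C : ℝ)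
    (hC : ∀ i, ‖ξ i‖ ≤ C) : ∃ S : StrongDual ℂ (BeurlingAlgebra ω),
      (∀ f, IsNonneg f → (S f).im = 0) ∧ (∀ i f, IsNonneg f → (ξ i f).re ≤ (S f).re) ∧
      ∀ T : StrongDual ℂ (BeurlingAlgebra ω), (∀ i f, IsNonneg f → (ξ i f).re ≤ (T f).re) →
        ∀ f, IsNonneg f → (S f).re ≤ (T f).re := by
  obtain ⟨j, r, hj, hr, hjn, hj0, hr0, hjr, hrI⟩ := exists_ofReal_re ω
  let J : Lp ℝ 1 ω.measure →L[ℝ] BeurlingAlgebra ω := j.toRealLinearMap hj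
  let R : BeurlingAlgebra ω →L[ℝ] Lp ℝ 1 ω.measure := r.toRealLinearMap hr
  let ρ : StrongDual ℂ (BeurlingAlgebra ω) → Lp ℝ 1 ω.measure →L[ℝ] ℝ := fun T =>
    Complex.reCLM.comp ((T.restrictScalars ℝ).comp J)
  have hρ : ∀ T f, ρ T f = (T (j f)).re := fun _ _ => rfl
  have hint : ∀ f : Lp ℝ 1 ω.measure, 0 ≤ f → L1.integralCLM f = ‖f‖ := by
    intro f hf
    rw [← L1.integral_eq, L1.integral_eq_integral, L1.norm_eq_integral_norm]
    refine integral_congr_ae ?_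
    rw [← Lp.coeFn_nonneg] at hf
    filter_upwards [hf] with x hx
    rw [Real.norm_of_nonneg hx]
  obtain ⟨S, hS1, hS2⟩ := exists_isLUB_functional (fun i => ρ (ξ i))
    (C • (L1.integralCLM : Lp ℝ 1 ω.measure →L[ℝ] ℝ)) (by
      intro i f hf
      rw [smul_apply, smul_eq_mul, hint f hf, hρ]
      calc _ ≤ ‖ξ i (j f)‖ := Complex.re_le_norm _
        _ ≤ ‖ξ i‖ * ‖j f‖ := (ξ i).le_opNorm _
        _ ≤ C * ‖f‖ := mul_le_mul (hC i) (hjn f) (norm_nonneg _) ((norm_nonneg _).trans (hC i)))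
  -- The complex extension has imaginary part `-S (r (I f))`, which vanishes on the cone since `I f`
  -- has zero real part there.
  let S' : StrongDual ℂ (BeurlingAlgebra ω) := StrongDual.extendRCLike (S.comp R)
  have hre : ∀ f, (S' f).re = S (r f) := fun f =>
    StrongDual.re_extendRCLike_apply (𝕜 := ℂ) (S.comp R) f
  have him : ∀ f, (S' f).im = - S (r (Complex.I • f)) := fun f =>
    StrongDual.im_extendRCLike_apply (𝕜 := ℂ) (S.comp R) f
  refine ⟨S', fun f hf => ?_, fun i f hf => ?_, fun T hT f hf => ?_⟩
  · rw [him, hrI f hf, map_zero, neg_zero]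
  · have := hS1 i (r f) (hr0 f hf)
    rw [hρ, hjr f hf] at this
    rwa [hre]
  · have := hS2 (ρ T) (fun i g hg => hT i (j g) (hj0 g hg)) (r f) (hr0 f hf)
    rw [hρ, hjr f hf] at this
    rwa [hre]

theorem isNonneg_translate (t : G) {f : BeurlingAlgebra ω} (hf : IsNonneg f) :
    IsNonneg (translate t f) := by
  have h2 : (fun x => f (t⁻¹ * x)) =ᵐ[(Measure.haar : Measure G)]
    fun x => ((‖f (t⁻¹ * x)‖ : ℝ) : ℂ) := comp_mul_left_ae hf t
  filter_upwards [coeFn_translate t f, h2] with x h1 h2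
  rw [h1]
  exact h2

theorem isNonneg_rightTranslate (t : G) {f : BeurlingAlgebra ω} (hf : IsNonneg f) :
    IsNonneg (rightTranslate t f) := by
  have h2 : (fun x => f (x * t⁻¹)) =ᵐ[(Measure.haar : Measure G)]
    fun x => ((‖f (x * t⁻¹)‖ : ℝ) : ℂ) := comp_mul_right_ae hf t⁻¹
  filter_upwards [coeFn_rightTranslate t f, h2] with x h1 h2
  rw [h1, rightFun, norm_mul, Complex.norm_real, Real.norm_of_nonneg NNReal.zero_le_coe,
    Complex.ofReal_mul, ← h2]

variable [T2Space G]

theorem isNonneg_mk_cc (a : G → ℝ) (ha : Continuous fun x => (a x : ℂ))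
    (ha' : HasCompactSupport fun x => (a x : ℂ)) (h0 : ∀ x, 0 ≤ a x) :
    IsNonneg (mk (ω := ω) (fun x => (a x : ℂ)) (memLp_of_cc ha ha')) := by
  filter_upwards [coeFn_mk (ω := ω) _ (memLp_of_cc ha ha')] with x hx
  rw [hx, Complex.norm_real, Real.norm_of_nonneg (h0 x)]

/-- Both sides are linear and continuous in each variable separately, so density is applied first in
`f` and then in `g`. -/
theorem eq_commutator_of_cc (D : BeurlingAlgebra ω →L[ℂ] StrongDual ℂ (BeurlingAlgebra ω))
    (z : StrongDual ℂ (BeurlingAlgebra ω))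
    (h : ∀ (a c : G → ℝ) (ha : Continuous fun x => (a x : ℂ))
      (ha' : HasCompactSupport fun x => (a x : ℂ)) (hc : Continuous fun x => (c x : ℂ))
      (hc' : HasCompactSupport fun x => (c x : ℂ)), (∀ x, 0 ≤ a x) → (∀ x, 0 ≤ c x) →
      D (mk _ (memLp_of_cc ha ha')) (mk _ (memLp_of_cc hc hc')) =
        z (mk _ (memLp_of_cc ha ha') * mk _ (memLp_of_cc hc hc')) -
          z (mk _ (memLp_of_cc hc hc') * mk _ (memLp_of_cc ha ha')))
    (f g : BeurlingAlgebra ω) : D f g = z (f * g) - z (g * f) := by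
  let V : BeurlingAlgebra ω → Submodule ℂ (BeurlingAlgebra ω) := fun g =>
    { carrier := {f | D f g = z (f * g) - z (g * f)}
      add_mem' := fun {u v} hu hv => by
        have hu : D u g = z (u * g) - z (g * u) := hu
        have hv : D v g = z (v * g) - z (g * v) := hv
        change D (u + v) g = z ((u + v) * g) - z (g * (u + v))
        rw [map_add, add_apply, hu, hv, add_mul, mul_add, map_add, map_add]
        ring
      zero_mem' := by
        change D 0 g = z (0 * g) - z (g * 0)
        simp
      smul_mem' := fun c u hu => by
        have hu : D u g = z (u * g) - z (g * u) := hu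
        change D (c • u) g = z ((c • u) * g) - z (g * (c • u))
        rw [map_smul, smul_apply, hu, smul_mul_assoc, mul_smul_comm, map_smul, map_smul, smul_sub] }
  let W : BeurlingAlgebra ω → Submodule ℂ (BeurlingAlgebra ω) := fun f =>
    { carrier := {g | D f g = z (f * g) - z (g * f)}
      add_mem' := fun {u v} hu hv => by
        have hu : D f u = z (f * u) - z (u * f) := hu
        have hv : D f v = z (f * v) - z (v * f) := hv
        change D f (u + v) = z (f * (u + v)) - z ((u + v) * f)
        rw [map_add, hu, hv, add_mul, mul_add, map_add, map_add]
        ring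
      zero_mem' := by
        change D f 0 = z (f * 0) - z (0 * f)
        simp
      smul_mem' := fun c u hu => by
        have hu : D f u = z (f * u) - z (u * f) := hu
        change D f (c • u) = z (f * (c • u)) - z ((c • u) * f)
        rw [map_smul, hu, smul_mul_assoc, mul_smul_comm, map_smul, map_smul, smul_sub] }
  have hV : ∀ g, IsClosed (V g : Set (BeurlingAlgebra ω)) := fun g =>
    isClosed_eq (f := fun f => D f g) (g := fun f => z (f * g) - z (g * f)) (by fun_prop)
      (by fun_prop)
  have hW : ∀ f, IsClosed (W f : Set (BeurlingAlgebra ω)) := fun f =>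
    isClosed_eq (f := fun g => D f g) (g := fun g => z (f * g) - z (g * f)) (by fun_prop)
      (by fun_prop)
  have h1 : ∀ (c : G → ℝ) (hc : Continuous fun x => (c x : ℂ))
      (hc' : HasCompactSupport fun x => (c x : ℂ)), (∀ x, 0 ≤ c x) → ∀ f,
      f ∈ V (mk _ (memLp_of_cc hc hc')) := fun c hc hc' h0 =>
    mem_of_isClosed_of_cc (hV _) fun a ha ha' ha0 => h a c ha ha' hc hc' ha0 h0
  exact mem_of_isClosed_of_cc (hW f) (fun c hc hc' h0 => h1 c hc hc' h0 f) g

/-! ### Bounded cocycles are coboundaries -/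

/-- Conjugation `f ↦ δ_t f δ_{t⁻¹}`. -/
def conjTranslate (t : G) : BeurlingAlgebra ω →L[ℂ] BeurlingAlgebra ω :=
  (translate t).comp (rightTranslate t⁻¹)

theorem conjTranslate_apply (t : G) (f : BeurlingAlgebra ω) :
    conjTranslate t f = translate t (rightTranslate t⁻¹ f) := rfl

theorem isNonneg_conjTranslate (t : G) {f : BeurlingAlgebra ω} (hf : IsNonneg f) :
    IsNonneg (conjTranslate t f) := isNonneg_translate _ (isNonneg_rightTranslate _ hf)

theorem conjTranslate_conjTranslate_inv (t : G) (f : BeurlingAlgebra ω) :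
    conjTranslate t (conjTranslate t⁻¹ f) = f := by
  rw [conjTranslate_apply, conjTranslate_apply, ← translate_rightTranslate, ← translate_mul,
    ← rightTranslate_mul, mul_inv_cancel, inv_inv, mul_inv_cancel, translate_one,
    rightTranslate_one]

/-- `S` is the supremum of the `Re ξ s`. Conjugation preserves the order, and `s ↦ s t` permutes the
family, so the cocycle identity turns `S ∘ conj_t` into the supremum of the `Re (ξ (s t) - ξ t)`,
which is `S - Re ξ t`. The two inequalities `h1` and `h2` both come from minimality of `S`. -/
theorem exists_real_coboundary (ξ : G → StrongDual ℂ (BeurlingAlgebra ω)) (C : ℝ)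
    (hC : ∀ t, ‖ξ t‖ ≤ C) (hξ : ∀ s t f, ξ (s * t) f = ξ s (conjTranslate t f) + ξ t f) :
    ∃ S : StrongDual ℂ (BeurlingAlgebra ω), (∀ f, IsNonneg f → (S f).im = 0) ∧
      ∀ t f, IsNonneg f → (ξ t f).re = (S f).re - (S (conjTranslate t f)).re := by
  obtain ⟨S, hS0, hS1, hS2⟩ := exists_lub_dual ξ C hC
  refine ⟨S, hS0, fun t f hf => ?_⟩
  have h1 := hS2 (S.comp (conjTranslate t) + ξ t) (fun s g hg => by
    have := hξ (s * t⁻¹) t g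
    rw [inv_mul_cancel_right] at this
    rw [this]
    simpa using hS1 (s * t⁻¹) _ (isNonneg_conjTranslate t hg)) f hf
  have h2 := hS2 ((S - ξ t).comp (conjTranslate t⁻¹)) (fun s g hg => by
    have h3 := hξ s t (conjTranslate t⁻¹ g)
    rw [conjTranslate_conjTranslate_inv] at h3
    have h4 := hS1 (s * t) _ (isNonneg_conjTranslate t⁻¹ hg)
    rw [h3] at h4
    simp only [Complex.add_re] at h4
    simp only [ContinuousLinearMap.comp_apply, sub_apply, Complex.sub_re]
    linarith) (conjTranslate t f) (isNonneg_conjTranslate t hf)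
  have h5 := conjTranslate_conjTranslate_inv t⁻¹ f
  rw [inv_inv] at h5
  simp only [ContinuousLinearMap.comp_apply, sub_apply, Complex.sub_re,
    add_apply, Complex.add_re, h5] at h1 h2
  linarith

/-- The real case is applied to `ξ` and to `-i ξ`, whose real part is the imaginary part of `ξ`; the
two suprema are real on the cone and combine to `S + i T`. -/
theorem exists_coboundary (ξ : G → StrongDual ℂ (BeurlingAlgebra ω)) (C : ℝ)
    (hC : ∀ t, ‖ξ t‖ ≤ C) (hξ : ∀ s t f, ξ (s * t) f = ξ s (conjTranslate t f) + ξ t f) :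
    ∃ Z : StrongDual ℂ (BeurlingAlgebra ω), ∀ t f, ξ t f = Z f - Z (conjTranslate t f) := by
  obtain ⟨S, hS, hS'⟩ := exists_real_coboundary ξ C hC hξ
  obtain ⟨T, hT, hT'⟩ := exists_real_coboundary (fun t => (-Complex.I) • ξ t) C
    (fun t => by rw [norm_smul]; simpa using hC t) (fun s t f => by
      simp only [smul_apply, hξ s t f, smul_add])
  refine ⟨S + Complex.I • T, fun t f => ?_⟩
  have : ξ t = (S + Complex.I • T) - (S + Complex.I • T).comp (conjTranslate t) := by
    refine dual_ext_cc fun a ha ha' h0 => ?_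
    have hn := isNonneg_mk_cc (ω := ω) a ha ha' h0
    set f := mk (ω := ω) (fun x => (a x : ℂ)) (memLp_of_cc ha ha')
    have hc := isNonneg_conjTranslate t hn
    have e1 := hS' t f hn
    have e2 := hT' t f hn
    have e3 := hS f hn
    have e4 := hT f hn
    have e5 := hS _ hc
    have e6 := hT _ hc
    simp only [smul_apply, smul_eq_mul, neg_mul, Complex.neg_re, Complex.mul_re,
      Complex.I_re, Complex.I_im, zero_mul, one_mul, zero_sub, neg_neg] at e2
    apply Complex.ext
    · simp [e1, e4, e6]
    · simp [e2, e3, e5]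
  rw [this]
  rfl

/-! ### Weak amenability when `ω*` is bounded -/

theorem norm_rightTranslate_clm_le (t : G) :
    ‖(rightTranslate t : BeurlingAlgebra ω →L[ℂ] _)‖ ≤ ω t :=
  ContinuousLinearMap.opNorm_le_bound _ (weight_pos ω t).le (norm_rightTranslate_le t)

theorem rightTranslate_inv_cancel (t : G) (f : BeurlingAlgebra ω) :
    rightTranslate t⁻¹ (rightTranslate t f) = f := by
  rw [← rightTranslate_mul, mul_inv_cancel, rightTranslate_one]

theorem rightTranslate_cancel_inv (t : G) (f : BeurlingAlgebra ω) :
    rightTranslate t (rightTranslate t⁻¹ f) = f := by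
  rw [← rightTranslate_mul, inv_mul_cancel, rightTranslate_one]

/-- A bounded derivation on `L¹(G, ω)` extends to point masses; `ξ t = δ_{t⁻¹} · D(δ_t)`. -/
theorem exists_cocycle (hω : ω.adj.IsBounded)
    (D : BeurlingAlgebra ω →L[ℂ] StrongDual ℂ (BeurlingAlgebra ω)) (hD : IsDualDerivation D) :
    ∃ (ξ : G → StrongDual ℂ (BeurlingAlgebra ω)) (C : ℝ), (∀ t, ‖ξ t‖ ≤ C) ∧
      ∀ t a c, D (translate t a) c = ξ t (rightTranslate t (a * c)) + D a (rightTranslate t c) := by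
  obtain ⟨K, hK⟩ := hω
  obtain ⟨𝓤, h𝓤, he⟩ := exists_approxIdentity ω
  -- With `e` close to an identity, `D(δ_t e)` approximates `D(δ_t)`, up to a term that subtracting
  -- `D e` removes. The translations by `t` and `t⁻¹` cost `ω(t) ω(t⁻¹)`, so a bound on `ω*` makes
  -- the estimate uniform in `t`.
  let φ : G → BeurlingAlgebra ω → StrongDual ℂ (BeurlingAlgebra ω) := fun t e =>
    (D (translate t e)).comp (rightTranslate t⁻¹) - D e
  have hφ : ∀ t, ∀ᶠ e in (𝓤 : Filter (BeurlingAlgebra ω)), ‖φ t e‖ ≤ ‖D‖ * (2 * K) + ‖D‖ * 2 := by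
    intro t
    filter_upwards [h𝓤] with e he
    refine (norm_sub_le _ _).trans (add_le_add ?_ ?_)
    · calc ‖(D (translate t e)).comp (rightTranslate t⁻¹)‖
          ≤ ‖D (translate t e)‖ * ‖(rightTranslate t⁻¹ : BeurlingAlgebra ω →L[ℂ] _)‖ :=
            ContinuousLinearMap.opNorm_comp_le _ _
        _ ≤ (‖D‖ * (ω t * 2)) * ω t⁻¹ := by
            refine mul_le_mul ?_ (norm_rightTranslate_clm_le _) (norm_nonneg _) ?_
            · refine (D.le_opNorm _).trans (mul_le_mul_of_nonneg_left ?_ (norm_nonneg _))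
              exact (norm_translate_le t e).trans
                (mul_le_mul_of_nonneg_left he (weight_pos ω t).le)
            · have := weight_pos ω t
              positivity
        _ = ‖D‖ * (2 * (ω t * ω t⁻¹)) := by ring
        _ ≤ ‖D‖ * (2 * K) := by
            have : ω t * ω t⁻¹ ≤ K := hK t
            gcongr
    · exact (D.le_opNorm _).trans (mul_le_mul_of_nonneg_left he (norm_nonneg _))
  choose ξ hξ hlim using fun t => exists_ultrafilter_limit_dual 𝓤 (φ t) _ (hφ t)
  refine ⟨ξ, _, hξ, fun t a c => ?_⟩
  have h1 := hlim t (rightTranslate t (a * c))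
  -- Expanding both terms by the derivation rule, the two occurrences of `D a` cancel. The
  -- right-hand side depends on `e` only through `e * a`, which tends to `a`, so the limit can be
  -- computed.
  have h2 : ∀ e, φ t e (rightTranslate t (a * c)) =
      D (translate t (e * a)) c - D (e * a) (rightTranslate t c) := by
    intro e
    have e1 := hD (translate t e) a c
    have e2 := hD e a (rightTranslate t c)
    rw [translate_mul_eq] at e1
    rw [mul_rightTranslate, rightTranslate_mul_eq] at e2
    have e3 : φ t e (rightTranslate t (a * c)) =
        D (translate t e) (rightTranslate t⁻¹ (rightTranslate t (a * c))) -
          D e (rightTranslate t (a * c)) := rfl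
    rw [e3, rightTranslate_inv_cancel, e1, e2]
    ring
  simp only [h2] at h1
  have h3 : Tendsto (fun e => D (translate t (e * a)) c - D (e * a) (rightTranslate t c)) 𝓤
      (𝓝 (D (translate t a) c - D a (rightTranslate t c))) := by
    have hc : Continuous fun b : BeurlingAlgebra ω =>
        D (translate t b) c - D b (rightTranslate t c) := by fun_prop
    exact (hc.tendsto a).comp (he a)
  rw [tendsto_nhds_unique h1 h3]
  ring

theorem weaklyAmenable_of_isBounded_adj (hω : ω.adj.IsBounded) :
    WeaklyAmenable (BeurlingAlgebra ω) := by
  intro D hD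
  obtain ⟨𝓤, h𝓤, he⟩ := exists_approxIdentity ω
  obtain ⟨ξ, C, hC, hξ⟩ := exists_cocycle hω D hD
  have hcoc : ∀ s t f, ξ (s * t) f = ξ s (conjTranslate t f) + ξ t f := by
    intro s t f
    -- Expanding `D(δ_{st} a)` at once, and as `D(δ_s (δ_t a))` in two stages, gives the cocycle
    -- identity on products.
    have hprod : ∀ a c, ξ (s * t) (rightTranslate (s * t) (a * c)) =
        ξ s (conjTranslate t (rightTranslate (s * t) (a * c))) +
          ξ t (rightTranslate (s * t) (a * c)) := by
      intro a c
      have h1 := hξ (s * t) a c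
      rw [translate_mul, hξ s (translate t a) c, hξ t a (rightTranslate s c),
        rightTranslate_mul s t c, translate_mul_eq, mul_rightTranslate,
        ← rightTranslate_mul s t (a * c)] at h1
      have h2 : conjTranslate t (rightTranslate (s * t) (a * c)) =
          rightTranslate s (translate t (a * c)) := by
        rw [conjTranslate_apply, rightTranslate_mul, rightTranslate_inv_cancel,
          translate_rightTranslate]
      rw [h2]
      linear_combination -h1
    -- Products suffice: any element is the limit of its left multiples by the approximate identity.
    have hc : Continuous fun b : BeurlingAlgebra ω => ξ (s * t) (rightTranslate (s * t) b) -
        (ξ s (conjTranslate t (rightTranslate (s * t) b)) + ξ t (rightTranslate (s * t) b)) := by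
      fun_prop
    have hlim := (hc.tendsto (rightTranslate (s * t)⁻¹ f)).comp (he (rightTranslate (s * t)⁻¹ f))
    simp only [Function.comp_def, hprod, sub_self, rightTranslate_cancel_inv] at hlim
    exact sub_eq_zero.1 (tendsto_nhds_unique hlim tendsto_const_nhds)
  obtain ⟨Z, hZ⟩ := exists_coboundary ξ C hC hcoc
  have hDZ : ∀ t a c, D (translate t a) c =
      Z (rightTranslate t (a * c)) - Z (translate t (a * c)) + D a (rightTranslate t c) := by
    intro t a c
    rw [hξ, hZ, conjTranslate_apply, rightTranslate_inv_cancel]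
  -- Integrating `hDZ` against `b(t) dt` replaces `δ_t` by `B` and yields `e2`. The derivation rule
  -- for `D (B * a) F` contains the same term `D a (F * B)`, and subtracting leaves `D B` on the
  -- product `a * F`.
  have key : ∀ (b c : G → ℂ) (hb : Continuous b) (hb' : HasCompactSupport b) (hc : Continuous c)
      (hc' : HasCompactSupport c) (a : BeurlingAlgebra ω),
      D (mk b (memLp_of_cc hb hb')) (a * mk c (memLp_of_cc hc hc')) =
        Z (a * mk c (memLp_of_cc hc hc') * mk b (memLp_of_cc hb hb')) -
          Z (mk b (memLp_of_cc hb hb') * (a * mk c (memLp_of_cc hc hc'))) := by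
    intro b c hb hb' hc hc' a
    set B : BeurlingAlgebra ω := mk b (memLp_of_cc hb hb') with hB
    set F : BeurlingAlgebra ω := mk c (memLp_of_cc hc hc') with hF
    have hbae : B =ᵐ[(Measure.haar : Measure G)] b := coeFn_mk _ _
    have hleft : ∀ f : BeurlingAlgebra ω,
        Integrable (fun s => b s • translate s f) (Measure.haar : Measure G) ∧
        ∫ s, b s • translate s f ∂(Measure.haar : Measure G) = B * f := by
      intro f
      have e1 : (fun s => B s • translate s f) =ᵐ[(Measure.haar : Measure G)]
          fun s => b s • translate s f := by
        filter_upwards [hbae] with s hs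
        rw [hs]
      exact ⟨(integrable_smul_translate B f).congr e1, (integral_congr_ae e1).symm⟩
    have hright := integrable_smul_rightTranslate (ω := ω) hb hb' hc hc'
    have hright' := integral_smul_rightTranslate (ω := ω) hb hb' hc hc'
    have e1 : ∀ s, D (b s • translate s a) F = Z (a * (b s • rightTranslate s F)) -
        Z (b s • translate s (a * F)) + D a (b s • rightTranslate s F) := by
      intro s
      rw [map_smul, smul_apply, hDZ, mul_smul_comm, mul_rightTranslate]
      simp only [map_smul, smul_eq_mul]
      ring
    let L : BeurlingAlgebra ω →L[ℂ] BeurlingAlgebra ω :=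
      LinearMap.mkContinuous
        { toFun := fun f => a * f
          map_add' := mul_add a
          map_smul' := fun c f => mul_smul_comm c a f } ‖a‖ (norm_mul_le a)
    let D' : BeurlingAlgebra ω →L[ℂ] ℂ := (ContinuousLinearMap.apply ℂ ℂ F).comp D
    have i1 : Integrable (fun s => Z (a * (b s • rightTranslate s F))) (Measure.haar : Measure G) :=
      (Z.comp L).integrable_comp hright
    have i2 : Integrable (fun s => Z (b s • translate s (a * F))) (Measure.haar : Measure G) :=
      Z.integrable_comp (hleft (a * F)).1
    have i3 : Integrable (fun s => D a (b s • rightTranslate s F)) (Measure.haar : Measure G) :=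
      (D a).integrable_comp hright
    have e2 : D (B * a) F = Z (a * (F * B)) - Z (B * (a * F)) + D a (F * B) := by
      have f1 : ∫ s, D (b s • translate s a) F ∂(Measure.haar : Measure G) = D (B * a) F := by
        rw [← (hleft a).2]
        exact D'.integral_comp_comm (hleft a).1
      have f2 : ∫ s, Z (a * (b s • rightTranslate s F)) ∂(Measure.haar : Measure G) =
          Z (a * (F * B)) := by
        rw [hF, hB, ← hright']
        exact (Z.comp L).integral_comp_comm hright
      have f3 : ∫ s, Z (b s • translate s (a * F)) ∂(Measure.haar : Measure G) =
          Z (B * (a * F)) := by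
        rw [← (hleft (a * F)).2]
        exact Z.integral_comp_comm (hleft (a * F)).1
      have f4 : ∫ s, D a (b s • rightTranslate s F) ∂(Measure.haar : Measure G) = D a (F * B) := by
        rw [hF, hB, ← hright']
        exact (D a).integral_comp_comm hright
      rw [← f1, ← f2, ← f3, ← f4, ← integral_sub i1 i2,
        ← integral_add (f := fun s => Z (a * (b s • rightTranslate s F)) - Z (b s • translate s (a * F)))
          (i1.sub i2) i3]
      exact integral_congr_ae (Eventually.of_forall e1)
    have e3 := hD B a F
    rw [mul_assoc]
    linear_combination e2 - e3
  have key2 : ∀ (b c : G → ℂ) (hb : Continuous b) (hb' : HasCompactSupport b) (hc : Continuous c)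
      (hc' : HasCompactSupport c),
      D (mk b (memLp_of_cc hb hb')) (mk c (memLp_of_cc hc hc')) =
        Z (mk c (memLp_of_cc hc hc') * mk b (memLp_of_cc hb hb')) -
          Z (mk b (memLp_of_cc hb hb') * mk c (memLp_of_cc hc hc')) := by
    intro b c hb hb' hc hc'
    -- The factor `a` in `key` now runs through the approximate identity.
    have hcont : Continuous fun f : BeurlingAlgebra ω => D (mk b (memLp_of_cc hb hb')) f -
        (Z (f * mk b (memLp_of_cc hb hb')) - Z (mk b (memLp_of_cc hb hb') * f)) := by fun_prop
    have hlim := (hcont.tendsto _).comp (he (mk c (memLp_of_cc hc hc')))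
    simp only [Function.comp_def, key b c hb hb' hc hc', sub_self] at hlim
    exact sub_eq_zero.1 (tendsto_nhds_unique hlim tendsto_const_nhds)
  -- `key2` has the commutator in the order opposite to `IsInnerDualDerivation`, hence the sign.
  refine ⟨-Z, eq_commutator_of_cc D (-Z) fun a c ha ha' hc hc' _ _ => ?_⟩
  rw [key2 _ _ ha ha' hc hc', neg_apply, neg_apply]
  ring

end BeurlingAlgebra

/-! ### Finite measures with compactly supported densities -/

/-- The new measure is at most `C μ` and lives on the compact set `K`; hence it is finite and
inherits from `μ` the compact approximation of `A ∩ K`. Regularity is what lets integrals over `C_c`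
determine such measures. -/
theorem innerRegular_withDensity {X : Type*} [TopologicalSpace X] [T2Space X] [MeasurableSpace X]
    [BorelSpace X] {μ : Measure X} [μ.Regular] {f : X → ℝ≥0∞} {C : NNReal}
    (hC : ∀ x, f x ≤ C) {K : Set X} (hK : IsCompact K) (hfK : ∀ x, x ∉ K → f x = 0) :
    IsFiniteMeasure (μ.withDensity f) ∧ (μ.withDensity f).InnerRegularCompactLTTop := by
  have hle : ∀ s, MeasurableSet s → μ.withDensity f s ≤ C * μ s := by
    intro s hs
    rw [withDensity_apply _ hs, ← setLIntegral_const]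
    exact lintegral_mono hC
  have hzero : μ.withDensity f Kᶜ = 0 := by
    rw [withDensity_apply _ hK.measurableSet.compl]
    rw [setLIntegral_congr_fun hK.measurableSet.compl (g := fun _ => 0) fun x hx => hfK x hx]
    simp
  have hfin : IsFiniteMeasure (μ.withDensity f) := by
    refine ⟨?_⟩
    rw [← measure_add_measure_compl hK.measurableSet, hzero, add_zero]
    exact (hle K hK.measurableSet).trans_lt
      (ENNReal.mul_lt_top ENNReal.coe_lt_top (hK.measure_lt_top (μ := μ)))
  refine ⟨hfin, ⟨?_⟩⟩
  rintro A ⟨hA, -⟩ r hr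
  by_contra! hcon
  refine hr.not_ge (ENNReal.le_of_forall_pos_le_add fun ε hε _ => ?_)
  have hAK : MeasurableSet (A ∩ K) := hA.inter hK.measurableSet
  -- The error will be at most `C` times this tolerance, hence at most `ε`; the `+ 1` covers `C =
  -- 0`.
  have hδ : ((ε / (C + 1) : NNReal) : ℝ≥0∞) ≠ 0 := by
    have : 0 < ε / (C + 1) := by positivity
    exact_mod_cast this.ne'
  obtain ⟨K', hK'A, hK', hμ⟩ := hAK.exists_isCompact_sdiff_lt
    ((measure_mono (μ := μ) inter_subset_right).trans_lt (hK.measure_lt_top (μ := μ))).ne hδ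
  have h1 : μ.withDensity f A ≤
      μ.withDensity f K' + (μ.withDensity f ((A ∩ K) \ K') + μ.withDensity f Kᶜ) := by
    refine (measure_mono fun x hx => ?_).trans ((measure_union_le _ _).trans
      (add_le_add le_rfl (measure_union_le _ _)))
    by_cases hxK : x ∈ K
    · by_cases hx' : x ∈ K'
      · exact Or.inl hx'
      · exact Or.inr (Or.inl ⟨⟨hx, hxK⟩, hx'⟩)
    · exact Or.inr (Or.inr hxK)
  refine h1.trans (add_le_add (hcon K' (hK'A.trans inter_subset_left) hK') ?_)
  rw [hzero, add_zero]
  refine (hle _ (hAK.diff hK'.measurableSet)).trans ?_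
  calc (C : ℝ≥0∞) * μ ((A ∩ K) \ K') ≤ (C : ℝ≥0∞) * ((ε / (C + 1) : NNReal) : ℝ≥0∞) := by
        gcongr
    _ ≤ ε := by
        rw [← ENNReal.coe_mul, ENNReal.coe_le_coe, mul_div_assoc', div_le_iff₀ (by positivity)]
        rw [mul_comm]
        gcongr
        exact le_self_add

theorem innerRegular_withDensity_ofReal {X : Type*} [TopologicalSpace X] [T2Space X]
    [MeasurableSpace X] [BorelSpace X] {μ : Measure X} [μ.Regular] {w : X → ℝ}
    (hw : Continuous w) (hw' : HasCompactSupport w) :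
    IsFiniteMeasure (μ.withDensity fun x => ENNReal.ofReal (w x)) ∧
      (μ.withDensity fun x => ENNReal.ofReal (w x)).InnerRegularCompactLTTop := by
  obtain ⟨C, hC⟩ := hw.bounded_above_of_compact_support hw'
  refine innerRegular_withDensity (C := C.toNNReal) (fun x => ?_) hw'.isCompact fun x hx => ?_
  · exact ENNReal.ofReal_le_ofReal ((le_abs_self _).trans (hC x))
  · rw [image_eq_zero_of_notMem_tsupport hx, ENNReal.ofReal_zero]

/-! ### Iterated integration on the Borel `σ`-algebra of `G × G` -/

section Pair

variable {G : Type*} [Group G] [TopologicalSpace G] [IsTopologicalGroup G] [LocallyCompactSpace G]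
  [T2Space G] [MeasurableSpace G] [BorelSpace G]

theorem continuous_integral_right {F : G × G → ℝ} (hF : Continuous F) (hF' : HasCompactSupport F) :
    Continuous (fun x => ∫ y, F (x, y) ∂(Measure.haar : Measure G)) := by
  rw [← continuousOn_univ]
  refine continuousOn_integral_of_compact_support (k := Prod.snd '' tsupport F)
    (hF'.isCompact.image continuous_snd) (Continuous.continuousOn (by fun_prop)) ?_
  intro x y _ hy
  by_contra hne
  exact hy ⟨(x, y), subset_tsupport _ hne, rfl⟩

theorem hasCompactSupport_integral_right {F : G × G → ℝ} (hF' : HasCompactSupport F) :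
    HasCompactSupport (fun x => ∫ y, F (x, y) ∂(Measure.haar : Measure G)) := by
  refine HasCompactSupport.intro (hF'.isCompact.image continuous_fst) fun x hx => ?_
  rw [integral_eq_zero_of_ae]
  refine Eventually.of_forall fun y => ?_
  by_contra hne
  exact hx ⟨(x, y), subset_tsupport _ hne, rfl⟩

theorem integrable_right {F : G × G → ℝ} (hF : Continuous F) (hF' : HasCompactSupport F) (x : G) :
    Integrable (fun y => F (x, y)) (Measure.haar : Measure G) := by
  have hc : Continuous fun y => F (x, y) := by fun_prop
  refine hc.integrable_of_hasCompactSupport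
    (HasCompactSupport.intro (hF'.isCompact.image continuous_snd) fun y hy => ?_)
  by_contra hne
  exact hy ⟨(x, y), subset_tsupport _ hne, rfl⟩

variable {X : Type*} [Group X] [TopologicalSpace X] [IsTopologicalGroup X] [LocallyCompactSpace X]
  [T2Space X] [MeasurableSpace X] [BorelSpace X]

open CompactlySupported in
/-- Iterated integration is integration against a regular measure on the Borel `σ`-algebra of
`G × G`, absolutely continuous with respect to Haar measure. -/
theorem exists_pair_measure (e : X ≃ₜ* G × G) : ∃ ν : Measure X, ν.Regular ∧
    ν ≪ (Measure.haar : Measure X) ∧ ∀ F : X → ℝ, Continuous F → HasCompactSupport F →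
      ∫ t, F t ∂ν = ∫ x, ∫ y, F (e.symm (x, y)) ∂(Measure.haar : Measure G)
        ∂(Measure.haar : Measure G) := by
  have hc : ∀ F : X → ℝ, Continuous F → Continuous fun p => F (e.symm p) := fun F hF =>
    hF.comp e.symm.continuous
  have hcs : ∀ F : X → ℝ, HasCompactSupport F → HasCompactSupport fun p => F (e.symm p) :=
    fun F hF => hF.comp_homeomorph e.symm.toHomeomorph
  have hout : ∀ F : X → ℝ, Continuous F → HasCompactSupport F →
      Integrable (fun x => ∫ y, F (e.symm (x, y)) ∂(Measure.haar : Measure G))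
        (Measure.haar : Measure G) := fun F hF hF' =>
    (continuous_integral_right (hc F hF) (hcs F hF')).integrable_of_hasCompactSupport
      (hasCompactSupport_integral_right (hcs F hF'))
  -- Riesz–Markov–Kakutani for the iterated integral produces a measure on the full Borel
  -- `σ`-algebra, where the product measure need not be defined.
  let Λ : C_c(X, ℝ) →ₚ[ℝ] ℝ := PositiveLinearMap.mk₀
    { toFun := fun F => ∫ x, ∫ y, F (e.symm (x, y)) ∂(Measure.haar : Measure G)
        ∂(Measure.haar : Measure G)
      map_add' := fun F H => by
        rw [← integral_add (hout F F.continuous F.hasCompactSupport)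
          (hout H H.continuous H.hasCompactSupport)]
        refine integral_congr_ae (Eventually.of_forall fun x => ?_)
        exact integral_add (integrable_right (hc F F.continuous) (hcs F F.hasCompactSupport) x)
          (integrable_right (hc H H.continuous) (hcs H H.hasCompactSupport) x)
      map_smul' := fun c F => by
        simp only [RingHom.id_apply]
        rw [← integral_smul]
        refine integral_congr_ae (Eventually.of_forall fun x => ?_)
        exact integral_smul c _ }
    fun F hF => integral_nonneg fun x => integral_nonneg fun y => hF _
  set ν := RealRMK.rieszMeasure Λ with hν
  have hint : ∀ F : X → ℝ, Continuous F → HasCompactSupport F →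
      ∫ t, F t ∂ν = ∫ x, ∫ y, F (e.symm (x, y)) ∂(Measure.haar : Measure G)
        ∂(Measure.haar : Measure G) := fun F hF hF' =>
    RealRMK.integral_rieszMeasure Λ ⟨⟨F, hF⟩, hF'⟩
  -- Left invariance makes `ν` a multiple of Haar measure on `X`, so statements that hold almost
  -- everywhere for Haar measure hold for `ν`.
  have hinv : ν.IsMulLeftInvariant := by
    refine ⟨fun g => ?_⟩
    have : (Measure.map (g * ·) ν).Regular := Measure.Regular.map (Homeomorph.mulLeft g)
    refine Measure.ext_of_integral_eq_on_compactlySupported fun F => ?_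
    rw [integral_map (f := (F : X → ℝ)) (measurable_const_mul g).aemeasurable
      F.continuous.aestronglyMeasurable]
    rw [hint (⇑F) F.continuous F.hasCompactSupport, hint (fun t => F (g * t))
      (F.continuous.comp (continuous_const_mul g))
      (F.hasCompactSupport.comp_homeomorph (Homeomorph.mulLeft g))]
    have h1 : ∀ x y, g * e.symm (x, y) = e.symm ((e g).1 * x, (e g).2 * y) := by
      intro x y
      apply e.injective
      rw [map_mul, ContinuousMulEquiv.apply_symm_apply, ContinuousMulEquiv.apply_symm_apply]
      rfl
    simp only [h1]
    rw [integral_mul_left_eq_self (fun x => ∫ y, F (e.symm (x, (e g).2 * y))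
      ∂(Measure.haar : Measure G)) (e g).1]
    refine integral_congr_ae (Eventually.of_forall fun x => ?_)
    exact integral_mul_left_eq_self (fun y => F (e.symm (x, y))) (e g).2
  refine ⟨ν, inferInstance, ?_, hint⟩
  rw [Measure.isMulLeftInvariant_eq_smul_of_regular ν Measure.haar]
  exact Measure.smul_absolutelyContinuous

/-- Hypothesis `hkw` says that `φ` pushes the measure `k dν` to `w dz`, as far as `C_c` can see.
Both are finite and regular, so they are equal, and the formula extends to Borel `h`. The copy `X`
of `G × G` carries its own Borel `σ`-algebra, apart from the product instance. -/
theorem integral_comp_pair_eq {e : X ≃ₜ* G × G} {ν : Measure X} [ν.Regular]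
    (hν : ∀ F : X → ℝ, Continuous F → HasCompactSupport F →
      ∫ t, F t ∂ν = ∫ x, ∫ y, F (e.symm (x, y)) ∂(Measure.haar : Measure G)
        ∂(Measure.haar : Measure G))
    {φ : G × G → G} (hφ : Continuous φ) {k : G × G → ℝ} (hk : Continuous k)
    (hk' : HasCompactSupport k) (hk0 : ∀ p, 0 ≤ k p) {w : G → ℝ} (hw : Continuous w)
    (hw' : HasCompactSupport w) (hw0 : ∀ x, 0 ≤ w x)
    (hkw : ∀ g : G → ℝ, Continuous g → HasCompactSupport g →
      ∫ z, g z * w z ∂(Measure.haar : Measure G) =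
        ∫ x, ∫ y, g (φ (x, y)) * k (x, y) ∂(Measure.haar : Measure G) ∂(Measure.haar : Measure G))
    {h : G → ℂ} (hm : Measurable h) :
    (Integrable (fun z => h z * (w z : ℂ)) (Measure.haar : Measure G) →
      Integrable (fun t => h (φ (e t)) * (k (e t) : ℂ)) ν) ∧
    ∫ t, h (φ (e t)) * (k (e t) : ℂ) ∂ν = ∫ z, h z * (w z : ℂ) ∂(Measure.haar : Measure G) := by
  have hke : Continuous fun t => k (e t) := hk.comp e.continuous
  have hke' : HasCompactSupport fun t => k (e t) := hk'.comp_homeomorph e.toHomeomorph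
  have hφe : Continuous fun t => φ (e t) := hφ.comp e.continuous
  obtain ⟨hM1, hM2⟩ := innerRegular_withDensity_ofReal (μ := ν) hke hke'
  obtain ⟨hN1, hN2⟩ := innerRegular_withDensity_ofReal (μ := (Measure.haar : Measure G)) hw hw'
  set M := ν.withDensity fun t => ENNReal.ofReal (k (e t)) with hM
  set N := (Measure.haar : Measure G).withDensity fun z => ENNReal.ofReal (w z) with hN
  have hmk : Measurable fun t => ENNReal.ofReal (k (e t)) := hke.measurable.ennreal_ofReal
  have hmw : Measurable fun z => ENNReal.ofReal (w z) := hw.measurable.ennreal_ofReal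
  have hMN : Measure.map (fun t => φ (e t)) M = N := by
    have : (Measure.map (fun t => φ (e t)) M).InnerRegular :=
      Measure.InnerRegular.map_of_continuous hφe
    refine Measure.ext_of_integral_eq_on_compactlySupported fun g => ?_
    rw [integral_map (f := (g : G → ℝ)) hφe.measurable.aemeasurable g.continuous.aestronglyMeasurable, hM, hN,
      integral_withDensity_eq_integral_toReal_smul hmk (by simp),
      integral_withDensity_eq_integral_toReal_smul hmw (by simp)]
    simp only [smul_eq_mul, ENNReal.toReal_ofReal (hk0 _), ENNReal.toReal_ofReal (hw0 _)]
    have h1 : ∀ z, w z * g z = g z * w z := fun z => mul_comm _ _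
    simp only [h1]
    rw [hkw (⇑g) g.continuous g.hasCompactSupport, hν (fun t => k (e t) * g (φ (e t)))
      (hke.mul (g.continuous.comp hφe)) hke'.mul_right]
    refine integral_congr_ae (Eventually.of_forall fun x =>
      integral_congr_ae (Eventually.of_forall fun y => ?_))
    simp [mul_comm]
  have hi : Integrable h N ↔ Integrable (fun z => h z * (w z : ℂ)) (Measure.haar : Measure G) := by
    rw [hN, integrable_withDensity_iff_integrable_smul' hmw (by simp)]
    refine integrable_congr (Eventually.of_forall fun z => ?_)
    simp only [ENNReal.toReal_ofReal (hw0 z), Complex.real_smul, mul_comm]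
  have hi' : Integrable (fun t => h (φ (e t))) M ↔
      Integrable (fun t => h (φ (e t)) * (k (e t) : ℂ)) ν := by
    rw [hM, integrable_withDensity_iff_integrable_smul' hmk (by simp)]
    refine integrable_congr (Eventually.of_forall fun z => ?_)
    simp only [ENNReal.toReal_ofReal (hk0 _), Complex.real_smul, mul_comm]
  refine ⟨fun h1 => ?_, ?_⟩
  · rw [← hi, ← hMN, integrable_map_measure hm.aestronglyMeasurable
      hφe.measurable.aemeasurable] at h1
    exact hi'.1 h1
  · have h1 : ∫ z, h z ∂N = ∫ z, h z * (w z : ℂ) ∂(Measure.haar : Measure G) := by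
      rw [hN, integral_withDensity_eq_integral_toReal_smul hmw (by simp)]
      refine integral_congr_ae (Eventually.of_forall fun z => ?_)
      simp only [ENNReal.toReal_ofReal (hw0 z), Complex.real_smul, mul_comm]
    have h2 : ∫ t, h (φ (e t)) ∂M = ∫ t, h (φ (e t)) * (k (e t) : ℂ) ∂ν := by
      rw [hM, integral_withDensity_eq_integral_toReal_smul hmk (by simp)]
      refine integral_congr_ae (Eventually.of_forall fun z => ?_)
      simp only [ENNReal.toReal_ofReal (hk0 _), Complex.real_smul, mul_comm]
    rw [← h1, ← h2, ← hMN, integral_map hφe.measurable.aemeasurable hm.aestronglyMeasurable]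

/-- The values of a functional on products of compactly supported functions, as integrals over
`G × G`. -/
theorem integral_cconv_eq_pair {e : X ≃ₜ* G × G} {ν : Measure X} [ν.Regular]
    (hν : ∀ F : X → ℝ, Continuous F → HasCompactSupport F →
      ∫ t, F t ∂ν = ∫ x, ∫ y, F (e.symm (x, y)) ∂(Measure.haar : Measure G)
        ∂(Measure.haar : Measure G))
    {a c : G → ℝ} (ha : Continuous fun x => (a x : ℂ)) (ha' : HasCompactSupport fun x => (a x : ℂ))
    (hc : Continuous fun x => (c x : ℂ)) (hc' : HasCompactSupport fun x => (c x : ℂ))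
    (ha0 : ∀ x, 0 ≤ a x) (hc0 : ∀ x, 0 ≤ c x) {h : G → ℂ} (hm : Measurable h)
    (hi₁ : Integrable (fun z => h z * BeurlingAlgebra.cconv (fun x => (a x : ℂ))
      (fun x => (c x : ℂ)) z) (Measure.haar : Measure G))
    (hi₂ : Integrable (fun z => h z * BeurlingAlgebra.cconv (fun x => (c x : ℂ))
      (fun x => (a x : ℂ)) z) (Measure.haar : Measure G)) :
    ∫ z, h z * BeurlingAlgebra.cconv (fun x => (a x : ℂ)) (fun x => (c x : ℂ)) z
        ∂(Measure.haar : Measure G) -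
      ∫ z, h z * BeurlingAlgebra.cconv (fun x => (c x : ℂ)) (fun x => (a x : ℂ)) z
        ∂(Measure.haar : Measure G) =
      ∫ t, (h ((e t).1 * (e t).2) - h ((e t).2 * (e t).1)) * ((a (e t).1 * c (e t).2 : ℝ) : ℂ) ∂ν := by
  have har : Continuous a := Complex.continuous_re.comp ha
  have hcr : Continuous c := Complex.continuous_re.comp hc
  have har' : HasCompactSupport a := ha'.comp_left (g := Complex.re) rfl
  have hcr' : HasCompactSupport c := hc'.comp_left (g := Complex.re) rfl
  let w : (G → ℝ) → (G → ℝ) → G → ℝ := fun a c z =>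
    ∫ y, a y * c (y⁻¹ * z) ∂(Measure.haar : Measure G)
  have hw : ∀ (a c : G → ℝ) z, BeurlingAlgebra.cconv (fun x => (a x : ℂ)) (fun x => (c x : ℂ)) z =
      (w a c z : ℂ) := by
    intro a c z
    rw [BeurlingAlgebra.cconv, ← integral_complex_ofReal]
    simp
  have hwre : ∀ a c : G → ℝ, w a c = fun z =>
      (BeurlingAlgebra.cconv (fun x => (a x : ℂ)) (fun x => (c x : ℂ)) z).re := by
    intro a c
    ext z
    rw [hw, Complex.ofReal_re]
  have hwc : ∀ a c : G → ℝ, Continuous (fun x => (a x : ℂ)) →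
      HasCompactSupport (fun x => (a x : ℂ)) → Continuous (fun x => (c x : ℂ)) →
      HasCompactSupport (fun x => (c x : ℂ)) → Continuous (w a c) ∧ HasCompactSupport (w a c) := by
    intro a c ha ha' hc hc'
    rw [hwre]
    exact ⟨Complex.continuous_re.comp (BeurlingAlgebra.continuous_cconv ha ha' hc),
      (BeurlingAlgebra.hasCompactSupport_cconv ha' hc').comp_left (g := Complex.re) rfl⟩
  have hw0 : ∀ a c : G → ℝ, (∀ x, 0 ≤ a x) → (∀ x, 0 ≤ c x) → ∀ z, 0 ≤ w a c z :=
    fun a c ha0 hc0 z => integral_nonneg fun y => mul_nonneg (ha0 _) (hc0 _)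
  have hwint : ∀ a c : G → ℝ, Continuous (fun x => (a x : ℂ)) →
      HasCompactSupport (fun x => (a x : ℂ)) → Continuous (fun x => (c x : ℂ)) →
      HasCompactSupport (fun x => (c x : ℂ)) → ∀ g : G → ℝ, Continuous g →
      ∫ z, g z * w a c z ∂(Measure.haar : Measure G) =
        ∫ y, ∫ x, g (y * x) * (a y * c x) ∂(Measure.haar : Measure G)
          ∂(Measure.haar : Measure G) := by
    intro a c ha ha' hc hc' g hg
    have h1 := BeurlingAlgebra.integral_mul_cconv (g := fun x => (g x : ℂ)) ha ha' hc hc'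
      (by fun_prop)
    simp only [hw, ← integral_const_mul] at h1
    apply Complex.ofReal_injective
    rw [← integral_complex_ofReal, ← integral_complex_ofReal]
    simp only [← integral_complex_ofReal]
    push_cast
    rw [h1]
    refine integral_congr_ae (Eventually.of_forall fun x =>
      integral_congr_ae (Eventually.of_forall fun y => ?_))
    simp only
    ring
  set k : G × G → ℝ := fun p => a p.1 * c p.2 with hk
  have hkc : Continuous k := by fun_prop
  have hk' : HasCompactSupport k := by
    refine HasCompactSupport.intro (har'.isCompact.prod hcr'.isCompact) fun p hp => ?_
    by_contra hne
    simp only [hk, mul_eq_zero, not_or] at hne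
    exact hp ⟨subset_tsupport _ hne.1, subset_tsupport _ hne.2⟩
  have hk0 : ∀ p, 0 ≤ k p := fun p => mul_nonneg (ha0 _) (hc0 _)
  obtain ⟨h1, h1'⟩ := integral_comp_pair_eq hν (φ := fun p => p.1 * p.2) (by fun_prop) hkc hk' hk0
    (hwc a c ha ha' hc hc').1 (hwc a c ha ha' hc hc').2 (hw0 a c ha0 hc0)
    (fun g hg _ => hwint a c ha ha' hc hc' g hg) hm
  -- Opposite multiplication pushes the density `a ⊗ c` to the convolution of `c` with `a`; this
  -- needs one interchange of the order of integration.
  obtain ⟨h2, h2'⟩ := integral_comp_pair_eq hν (φ := fun p => p.2 * p.1) (by fun_prop) hkc hk' hk0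
    (hwc c a hc hc' ha ha').1 (hwc c a hc hc' ha ha').2 (hw0 c a hc0 ha0)
    (fun g hg _ => by
      rw [hwint c a hc hc' ha ha' g hg, integral_integral_swap_of_hasCompactSupport]
      · simp only [hk, mul_comm (c _)]
      · exact (by fun_prop : Continuous fun p : G × G => g (p.1 * p.2) * (c p.1 * a p.2))
      · refine HasCompactSupport.intro (hcr'.isCompact.prod har'.isCompact) fun p hp => ?_
        by_contra hne
        simp only [Function.uncurry, mul_eq_zero, not_or] at hne
        exact hp ⟨subset_tsupport _ hne.2.1, subset_tsupport _ hne.2.2⟩) hm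
  simp only [hw] at hi₁ hi₂ ⊢
  rw [← h1', ← h2', ← integral_sub (h1 hi₁) (h2 hi₂)]
  simp only [sub_mul, hk]

end Pair

/-! ### Borel representatives of functionals -/

/-- Serves the gluing below: continuous functions on disjoint open cosets glue to continuous
functions, whereas Borel functions on uncountably many cosets need not glue to a Borel one. -/
theorem exists_continuous_seq_tendsto_ae {X : Type*} [TopologicalSpace X] [LocallyCompactSpace X]
    [T2Space X] [MeasurableSpace X] [BorelSpace X] {μ : Measure X} [μ.Regular] {f : X → ℂ}
    (hf : Integrable f μ) : ∃ v : ℕ → X → ℂ, (∀ n, Continuous (v n)) ∧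
      ∀ᵐ x ∂μ, Tendsto (fun n => v n x) atTop (𝓝 (f x)) := by
  choose u hu hc hs using fun n : ℕ => exists_cc_eLpNorm_one_sub_le μ (memLp_one_iff_integrable.2 hf)
    (ε := ENNReal.ofReal (1 / ((n : ℝ) + 1))) (by
      rw [ne_eq, ENNReal.ofReal_eq_zero, not_le]
      positivity)
  have h1 : Tendsto (fun n => eLpNorm (u n - f) 1 μ) atTop (𝓝 0) := by
    refine tendsto_of_tendsto_of_tendsto_of_le_of_le tendsto_const_nhds
      (h := fun n : ℕ => ENNReal.ofReal (1 / ((n : ℝ) + 1))) ?_ (fun _ => zero_le) fun n => ?_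
    · rw [← ENNReal.ofReal_zero]
      exact ENNReal.tendsto_ofReal tendsto_one_div_add_atTop_nhds_zero_nat
    · simp only
      rw [eLpNorm_sub_comm]
      exact hu n
  obtain ⟨ns, -, hns⟩ := (tendstoInMeasure_of_tendsto_eLpNorm one_ne_zero
    (fun n => ((hc n).stronglyMeasurable_of_hasCompactSupport (hs n)).aestronglyMeasurable)
    hf.aestronglyMeasurable h1).exists_seq_tendsto_ae
  exact ⟨fun n => u (ns n), fun n => hc _, hns⟩

-- The subgroup is the union of the powers of a compact symmetric neighbourhood `W` of `1`; `W ^ (n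
-- + 1)` is a neighbourhood of each point of `W ^ n`.
open Pointwise in
theorem exists_open_sigmaCompact_subgroup (G : Type*) [Group G] [TopologicalSpace G]
    [IsTopologicalGroup G] [LocallyCompactSpace G] : ∃ (H : Subgroup G) (K : ℕ → Set G),
      IsOpen (H : Set G) ∧ (∀ n, IsCompact (K n)) ∧ Monotone K ∧ (∀ n, K n ⊆ H) ∧
        ∀ x ∈ H, ∃ n, K n ∈ 𝓝 x := by
  obtain ⟨V, hV, hV1⟩ := exists_compact_mem_nhds (1 : G)
  set W : Set G := V ∪ V⁻¹ with hW
  have hWc : IsCompact W := hV.union hV.inv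
  have hW1 : W ∈ 𝓝 (1 : G) := mem_of_superset hV1 subset_union_left
  have h1 : (1 : G) ∈ W := mem_of_mem_nhds hW1
  have hWi : W⁻¹ = W := by rw [hW, union_inv, inv_inv, union_comm]
  have hpc : ∀ n : ℕ, IsCompact (W ^ n) := by
    intro n
    induction n with
    | zero => rw [pow_zero]; exact isCompact_singleton
    | succ n ih => rw [pow_succ]; exact ih.mul hWc
  have hnhds : ∀ n : ℕ, ∀ x ∈ W ^ n, W ^ (n + 1) ∈ 𝓝 x := by
    intro n x hx
    have h2 : x • W ∈ 𝓝 x := by simpa using smul_mem_nhds_smul x hW1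
    refine mem_of_superset h2 ?_
    rintro _ ⟨y, hy, rfl⟩
    rw [pow_succ]
    exact mul_mem_mul hx hy
  let H : Subgroup G :=
    { carrier := ⋃ n : ℕ, W ^ n
      mul_mem' := by
        intro a b ha hb
        obtain ⟨m, hm⟩ := mem_iUnion.1 ha
        obtain ⟨n, hn⟩ := mem_iUnion.1 hb
        exact mem_iUnion.2 ⟨m + n, by rw [pow_add]; exact mul_mem_mul hm hn⟩
      one_mem' := mem_iUnion.2 ⟨0, by simp⟩
      inv_mem' := by
        intro a ha
        obtain ⟨m, hm⟩ := mem_iUnion.1 ha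
        refine mem_iUnion.2 ⟨m, ?_⟩
        rw [← hWi, inv_pow, Set.mem_inv, inv_inv]
        exact hm }
  refine ⟨H, fun n => W ^ n, ?_, hpc, fun m n hmn => Set.pow_subset_pow_right h1 hmn,
    fun n => subset_iUnion (fun n : ℕ => W ^ n) n, fun x hx => ?_⟩
  · refine isOpen_iff_mem_nhds.2 fun x hx => ?_
    obtain ⟨n, hn⟩ := mem_iUnion.1 hx
    exact mem_of_superset (hnhds n x hn) (subset_iUnion (fun n : ℕ => W ^ n) (n + 1))
  · obtain ⟨n, hn⟩ := mem_iUnion.1 hx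
    exact ⟨n + 1, hnhds n x hn⟩

namespace BeurlingAlgebra

variable {G : Type*} [Group G] [TopologicalSpace G] [IsTopologicalGroup G] [LocallyCompactSpace G]
  [MeasurableSpace G] [BorelSpace G] {ω : GroupWeight G}

theorem mk_congr {f g : G → ℂ} (h : f =ᵐ[(Measure.haar : Measure G)] g) (hf : MemLp f 1 ω.measure)
    (hg : MemLp g 1 ω.measure) : mk f hf = mk g hg :=
  ext_ae ((coeFn_mk f hf).trans (h.trans (coeFn_mk g hg).symm))

variable [T2Space G]

theorem exists_weight_le (ω : GroupWeight G) {S : Set G} (hS : IsCompact S) :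
    ∃ C : ℝ, 0 ≤ C ∧ ∀ x ∈ S, ω x ≤ C := by
  obtain ⟨C, hC⟩ := hS.bddAbove_image ω.continuous_toFun.continuousOn
  exact ⟨max C 0, le_max_right _ _, fun x hx => (hC (mem_image_of_mem _ hx)).trans (le_max_left _ _)⟩

theorem lintegral_indicator_le {S : Set G} (hS : IsCompact S) {C : ℝ} (hC : ∀ x ∈ S, ω x ≤ C)
    (f : G → ℂ) : ∫⁻ x, ENNReal.ofReal (ω x) * ‖S.indicator f x‖ₑ ∂(Measure.haar : Measure G) ≤
      ENNReal.ofReal C * eLpNorm f 1 ((Measure.haar : Measure G).restrict S) := by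
  rw [eLpNorm_one_eq_lintegral_enorm, ← lintegral_const_mul' _ _ ENNReal.ofReal_ne_top,
    ← lintegral_indicator hS.measurableSet]
  refine lintegral_mono fun x => ?_
  by_cases hx : x ∈ S
  · simp only [indicator_of_mem hx]
    gcongr
    exact hC x hx
  · simp [indicator_of_notMem hx]

theorem memLp_indicator {S : Set G} (hS : IsCompact S) {f : G → ℂ}
    (hf : MemLp f 1 ((Measure.haar : Measure G).restrict S)) :
    MemLp (S.indicator f) 1 ω.measure := by
  obtain ⟨C, -, hC⟩ := exists_weight_le ω hS
  rw [memLp_iff]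
  exact ⟨(aestronglyMeasurable_indicator_iff hS.measurableSet).2 hf.1,
    (lintegral_indicator_le hS hC f).trans_lt (ENNReal.mul_lt_top ENNReal.ofReal_lt_top hf.2)⟩

/-- On a compact set, a functional on `L¹(G, ω)` is given by a function. -/
theorem exists_local_rep (z : StrongDual ℂ (BeurlingAlgebra ω)) {S : Set G} (hS : IsCompact S) :
    ∃ h : G → ℂ, Measurable h ∧ (∀ x, ‖h x‖ ≤ ‖z‖ * ω x) ∧
      ∀ f : G → ℂ, Measurable f → (∃ C : ℝ, ∀ x, ‖f x‖ ≤ C) →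
        ∀ hf : MemLp (S.indicator f) 1 ω.measure,
          z (mk (S.indicator f) hf) = ∫ x in S, h x * f x ∂(Measure.haar : Measure G) := by
  obtain ⟨C, hC0, hC⟩ := exists_weight_le ω hS
  set ν := (Measure.haar : Measure G).restrict S with hν
  have hfin : IsFiniteMeasure ν := ⟨by rw [hν, Measure.restrict_apply_univ]; exact hS.measure_lt_top⟩
  have h21 : ∀ {f : G → ℂ}, MemLp f 2 ν → MemLp f 1 ν := fun h => h.mono_exponent (by norm_num)
  have hT : ∀ f : Lp ℂ 2 ν, MemLp (S.indicator f) 1 ω.measure := fun f =>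
    memLp_indicator hS (h21 (Lp.memLp f))
  have hind : ∀ {f g : G → ℂ}, f =ᵐ[ν] g →
      S.indicator f =ᵐ[(Measure.haar : Measure G)] S.indicator g := fun h =>
    (ae_eq_restrict_iff_indicator_ae_eq hS.measurableSet).1 h
  set M : ℝ := (ν univ ^ (1 / (1 : ℝ≥0∞).toReal - 1 / (2 : ℝ≥0∞).toReal)).toReal with hM
  -- The measure on `S` is finite, so `L²(S)` maps boundedly into `L¹(G, ω)`, and the Hilbert space
  -- Riesz theorem represents `z ∘ T`.
  let T : Lp ℂ 2 ν →L[ℂ] BeurlingAlgebra ω := LinearMap.mkContinuous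
    { toFun := fun f => mk (S.indicator f) (hT f)
      map_add' := fun f g => ext_ae <| by
        filter_upwards [coeFn_mk _ (hT (f + g)), coeFn_mk _ (hT f), coeFn_mk _ (hT g),
          coeFn_add (mk _ (hT f)) (mk _ (hT g)), hind (Lp.coeFn_add f g)] with x h1 h2 h3 h4 h5
        rw [h1, h4, h2, h3, h5]
        by_cases hx : x ∈ S <;> simp [hx]
      map_smul' := fun c f => ext_ae <| by
        filter_upwards [coeFn_mk _ (hT (c • f)), coeFn_mk _ (hT f),
          coeFn_smul c (mk _ (hT f)), hind (Lp.coeFn_smul c f)] with x h1 h2 h4 h5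
        rw [RingHom.id_apply, h1, h4, h2, h5]
        by_cases hx : x ∈ S <;> simp [hx] }
    (C * M) (fun f => by
      have h1 : eLpNorm f 1 ν ≤ eLpNorm f 2 ν *
          ν univ ^ (1 / (1 : ℝ≥0∞).toReal - 1 / (2 : ℝ≥0∞).toReal) :=
        eLpNorm_le_eLpNorm_mul_rpow_measure_univ (by norm_num) (Lp.aestronglyMeasurable f)
      have h2 : ν univ ^ (1 / (1 : ℝ≥0∞).toReal - 1 / (2 : ℝ≥0∞).toReal) ≠ ∞ :=
        ENNReal.rpow_ne_top_of_nonneg (by norm_num) (measure_ne_top _ _)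
      have hM0 : 0 ≤ M := ENNReal.toReal_nonneg
      rw [← ENNReal.ofReal_le_ofReal_iff (by positivity), enorm_eq]
      calc ∫⁻ x, ENNReal.ofReal (ω x) * ‖mk (S.indicator f) (hT f) x‖ₑ ∂(Measure.haar : Measure G)
          = ∫⁻ x, ENNReal.ofReal (ω x) * ‖S.indicator f x‖ₑ ∂(Measure.haar : Measure G) := by
            refine lintegral_congr_ae ?_
            filter_upwards [coeFn_mk _ (hT f)] with x hx
            rw [hx]
        _ ≤ ENNReal.ofReal C * eLpNorm f 1 ν := lintegral_indicator_le hS hC f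
        _ ≤ ENNReal.ofReal C * (ENNReal.ofReal ‖f‖ * ENNReal.ofReal M) := by
            gcongr
            rw [hM, ENNReal.ofReal_toReal h2, Lp.norm_def,
              ENNReal.ofReal_toReal (Lp.memLp f).eLpNorm_ne_top]
            exact h1
        _ = ENNReal.ofReal (C * M * ‖f‖) := by
            rw [ENNReal.ofReal_mul (by positivity), ENNReal.ofReal_mul hC0]
            ring)
  set u := (InnerProductSpace.toDual ℂ (Lp ℂ 2 ν)).symm (z.comp T) with hu
  -- Conjugated because the inner product is conjugate-linear in its first argument.
  set h₀ : G → ℂ := fun x => starRingEnd ℂ (u x) with hh₀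
  have hm₀ : Measurable h₀ :=
    Complex.continuous_conj.measurable.comp (Lp.stronglyMeasurable u).measurable
  have hrep : ∀ f : G → ℂ, Measurable f → (∃ C : ℝ, ∀ x, ‖f x‖ ≤ C) →
      ∀ hf : MemLp (S.indicator f) 1 ω.measure,
        z (mk (S.indicator f) hf) = ∫ x, h₀ x * f x ∂ν := by
    rintro f hfm ⟨B, hB⟩ hf
    have hf2 : MemLp f 2 ν := MemLp.of_bound hfm.aestronglyMeasurable B (Eventually.of_forall hB)
    have e1 : T (hf2.toLp f) = mk (S.indicator f) hf :=
      mk_congr (hind hf2.coeFn_toLp) (hT _) hf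
    have e2 : inner ℂ u (hf2.toLp f) = z (T (hf2.toLp f)) := by
      rw [hu, InnerProductSpace.toDual_symm_apply]
      rfl
    rw [← e1, ← e2, L2.inner_def]
    refine integral_congr_ae ?_
    filter_upwards [hf2.coeFn_toLp] with x hx
    rw [hx, RCLike.inner_apply, mul_comm]
  have hi₀ : Integrable h₀ ν := by
    have h1 := memLp_one_iff_integrable.1 (h21 (Lp.memLp u))
    exact h1.norm.mono' hm₀.aestronglyMeasurable
      (Eventually.of_forall fun x => by rw [hh₀]; simp)
  have hωi : Integrable (fun x => ‖z‖ * ω x) ν := by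
    refine Integrable.const_mul ?_ _
    exact ω.continuous_toFun.continuousOn.integrableOn_compact hS
  have hbound : ∀ᵐ x ∂ν, ‖h₀ x‖ ≤ ‖z‖ * ω x := by
    refine ae_le_of_forall_setIntegral_le hi₀.norm hωi fun B hB _ => ?_
    -- The conjugate phase of `h₀` on `B`, equal to `0` where `h₀` vanishes since `0⁻¹ = 0`.
    -- Evaluating `z` on it gives `∫_B |h₀| ≤ ‖z‖ ∫_B ω`.
    set f : G → ℂ := B.indicator fun x => starRingEnd ℂ (h₀ x) * ((‖h₀ x‖ : ℝ) : ℂ)⁻¹ with hf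
    have hfm : Measurable f := Measurable.indicator (by fun_prop) hB
    have hf1 : ∀ x, ‖f x‖ ≤ B.indicator (fun _ => (1 : ℝ)) x := by
      intro x
      by_cases hx : x ∈ B
      · simp only [hf, indicator_of_mem hx, norm_mul, RCLike.norm_conj, norm_inv, Complex.norm_real,
          norm_norm]
        exact mul_inv_le_one
      · simp [hf, indicator_of_notMem hx]
    have hf1' : ∀ x, ‖f x‖ ≤ 1 := fun x => (hf1 x).trans (by
      by_cases hx : x ∈ B <;> simp [hx])
    have hfp : MemLp (S.indicator f) 1 ω.measure :=
      memLp_indicator hS (MemLp.of_bound hfm.aestronglyMeasurable 1 (Eventually.of_forall hf1'))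
    have e1 := hrep f hfm ⟨1, hf1'⟩ hfp
    have e2 : ∀ x, h₀ x * f x = ((B.indicator (fun x => ‖h₀ x‖) x : ℝ) : ℂ) := by
      intro x
      by_cases hx : x ∈ B
      · simp only [hf, indicator_of_mem hx]
        rw [← mul_assoc, Complex.mul_conj, Complex.normSq_eq_norm_sq]
        by_cases h0 : h₀ x = 0
        · simp [h0]
        · have : ((‖h₀ x‖ : ℝ) : ℂ) ≠ 0 := by simpa using h0
          push_cast
          field_simp
      · simp [hf, indicator_of_notMem hx]
    simp only [e2] at e1
    rw [integral_complex_ofReal, integral_indicator hB] at e1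
    have e3 : ‖mk (S.indicator f) hfp‖ ≤ ∫ x in B, ω x ∂ν := by
      rw [norm_eq, ← integral_indicator hB, hν, ← integral_indicator hS.measurableSet]
      refine integral_mono_ae (integrable_weight_mul_norm _) ?_ ?_
      · rw [integrable_indicator_iff hS.measurableSet]
        refine Integrable.indicator ?_ hB
        exact ω.continuous_toFun.continuousOn.integrableOn_compact hS
      · filter_upwards [coeFn_mk _ hfp] with x hx
        rw [hx]
        by_cases hxS : x ∈ S
        · simp only [indicator_of_mem hxS]
          by_cases hxB : x ∈ B
          · rw [indicator_of_mem hxB]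
            exact mul_le_of_le_one_right (weight_pos ω x).le (hf1' x)
          · simp [hf, indicator_of_notMem hxB]
        · simp [indicator_of_notMem hxS]
    calc ∫ x in B, ‖h₀ x‖ ∂ν ≤ ‖((∫ x in B, ‖h₀ x‖ ∂ν : ℝ) : ℂ)‖ := by
          rw [Complex.norm_real]; exact le_abs_self _
      _ = ‖z (mk (S.indicator f) hfp)‖ := by rw [e1]
      _ ≤ ‖z‖ * ‖mk (S.indicator f) hfp‖ := z.le_opNorm _
      _ ≤ ‖z‖ * ∫ x in B, ω x ∂ν := mul_le_mul_of_nonneg_left e3 (norm_nonneg _)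
      _ = ∫ x in B, ‖z‖ * ω x ∂ν := (integral_const_mul _ _).symm
  have hset : MeasurableSet {x | ‖h₀ x‖ ≤ ‖z‖ * ω x} :=
    measurableSet_le hm₀.norm (ω.continuous_toFun.measurable.const_mul _)
  refine ⟨{x | ‖h₀ x‖ ≤ ‖z‖ * ω x}.indicator h₀, hm₀.indicator hset, fun x => ?_,
    fun f hfm hfb hf => ?_⟩
  · by_cases hx : x ∈ {x | ‖h₀ x‖ ≤ ‖z‖ * ω x}
    · rw [indicator_of_mem hx]
      exact hx
    · rw [indicator_of_notMem hx, norm_zero]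
      exact mul_nonneg (norm_nonneg _) (weight_pos ω x).le
  · rw [hrep f hfm hfb hf]
    refine integral_congr_ae ?_
    filter_upwards [hbound] with x hx
    rw [indicator_of_mem (show x ∈ {x | ‖h₀ x‖ ≤ ‖z‖ * ω x} from hx)]

/-- Evaluating `z` on indicators of `S ∩ B` shows that the two representatives have equal integrals
over every measurable part of `S`. -/
theorem local_rep_unique {z : StrongDual ℂ (BeurlingAlgebra ω)} {S S' : Set G} (hS : IsCompact S)
    (hS' : IsCompact S') (hSS' : S ⊆ S') {h h' : G → ℂ} (hm : Measurable h) (hm' : Measurable h')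
    (hb : ∀ x, ‖h x‖ ≤ ‖z‖ * ω x) (hb' : ∀ x, ‖h' x‖ ≤ ‖z‖ * ω x)
    (hz : ∀ f : G → ℂ, Measurable f → (∃ C : ℝ, ∀ x, ‖f x‖ ≤ C) →
      ∀ hf : MemLp (S.indicator f) 1 ω.measure,
        z (mk (S.indicator f) hf) = ∫ x in S, h x * f x ∂(Measure.haar : Measure G))
    (hz' : ∀ f : G → ℂ, Measurable f → (∃ C : ℝ, ∀ x, ‖f x‖ ≤ C) →
      ∀ hf : MemLp (S'.indicator f) 1 ω.measure,
        z (mk (S'.indicator f) hf) = ∫ x in S', h' x * f x ∂(Measure.haar : Measure G)) :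
    ∀ᵐ x ∂(Measure.haar : Measure G), x ∈ S → h' x = h x := by
  rw [← ae_restrict_iff' hS.measurableSet]
  have hi : ∀ {k : G → ℂ}, Measurable k → (∀ x, ‖k x‖ ≤ ‖z‖ * ω x) →
      Integrable k ((Measure.haar : Measure G).restrict S) := by
    intro k hk hkb
    have h1 : Integrable (fun x => ‖z‖ * ω x) ((Measure.haar : Measure G).restrict S) :=
      Integrable.const_mul (ω.continuous_toFun.continuousOn.integrableOn_compact hS) _
    exact h1.mono' hk.aestronglyMeasurable (Eventually.of_forall hkb)
  refine (hi hm' hb').ae_eq_of_forall_setIntegral_eq _ _ (hi hm hb) fun B hB _ => ?_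
  set f : G → ℂ := (S ∩ B).indicator fun _ => 1 with hf
  have hSB : MeasurableSet (S ∩ B) := hS.measurableSet.inter hB
  have hfm : Measurable f := measurable_const.indicator hSB
  have hfb : ∃ C : ℝ, ∀ x, ‖f x‖ ≤ C := ⟨1, fun x => by
    by_cases hx : x ∈ S ∩ B <;> simp [hf, hx]⟩
  have e1 : S.indicator f = f := by
    rw [hf, indicator_indicator, ← inter_assoc, inter_self]
  have e2 : S'.indicator f = f := by
    rw [hf, indicator_indicator, ← inter_assoc, inter_eq_self_of_subset_right hSS']
  have hfin : IsFiniteMeasure ((Measure.haar : Measure G).restrict S) :=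
    ⟨by rw [Measure.restrict_apply_univ]; exact hS.measure_lt_top⟩
  have hp : MemLp (S.indicator f) 1 ω.measure := by
    obtain ⟨C, hC⟩ := hfb
    exact memLp_indicator hS (MemLp.of_bound hfm.aestronglyMeasurable C (Eventually.of_forall hC))
  have hp' : MemLp (S'.indicator f) 1 ω.measure := by rwa [e2, ← e1]
  have e3 := hz f hfm hfb hp
  have e4 := hz' f hfm hfb hp'
  have e5 : mk (S'.indicator f) hp' = mk (S.indicator f) hp :=
    mk_congr (by rw [e1, e2]) _ _
  have e6 : ∀ {k : G → ℂ} {Q : Set G}, MeasurableSet Q → S ⊆ Q →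
      ∫ x in Q, k x * f x ∂(Measure.haar : Measure G) =
        ∫ x in B, k x ∂((Measure.haar : Measure G).restrict S) := by
    intro k Q hQ hSQ
    have h1 : ∀ x, k x * f x = (S ∩ B).indicator k x := by
      intro x
      by_cases hx : x ∈ S ∩ B <;> simp [hf, hx]
    simp only [h1]
    rw [integral_indicator hSB, Measure.restrict_restrict hSB, Measure.restrict_restrict hB,
      inter_comm B, inter_eq_self_of_subset_left (inter_subset_left.trans hSQ)]
  rw [← e6 (k := h') hS'.measurableSet hSS', ← e6 (k := h) hS.measurableSet Subset.rfl, ← e3, ← e4,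
    e5]

/-- Every functional on `L¹(G, ω)` is given by a Borel function. -/
theorem exists_measurable_rep (z : StrongDual ℂ (BeurlingAlgebra ω)) :
    ∃ (h : G → ℂ) (hm : Measurable h) (hC : ∀ x, ‖h x‖ ≤ ‖z‖ * ω x),
      z = dualOfFun h hm.aestronglyMeasurable ‖z‖ hC := by
  obtain ⟨H, K, hH, hK, hKm, hKH, hKn⟩ := exists_open_sigmaCompact_subgroup G
  -- One base point for each coset of `H`. As `s` is constant on the open cosets, any family indexed
  -- by base points glues to a function that is locally a single member.
  let s : G → G := fun x => (x : G ⧸ H).out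
  have hs1 : ∀ x, (s x : G ⧸ H) = x := fun x => Quotient.out_eq' _
  have hs2 : ∀ x, (s x)⁻¹ * x ∈ H := fun x => QuotientGroup.eq.1 (hs1 x)
  have hs3 : ∀ x y, x⁻¹ * y ∈ H → s y = s x := fun x y hxy => by
    have : (x : G ⧸ H) = y := QuotientGroup.eq.2 hxy
    simp only [s, this]
  let S : G → ℕ → Set G := fun g n => (fun y => g * y) '' K n
  have hSc : ∀ g n, IsCompact (S g n) := fun g n => (hK n).image (continuous_const_mul g)
  have hSm : ∀ g, Monotone (S g) := fun g m n hmn => image_mono (hKm hmn)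
  have hSs : ∀ x₀ n, ∀ x ∈ S (s x₀) n, s x = s x₀ := by
    rintro x₀ n _ ⟨y, hy, rfl⟩
    refine hs3 x₀ _ ?_
    have h1 := H.mul_mem (H.inv_mem (hs2 x₀)) (hKH n hy)
    simpa [mul_assoc] using h1
  choose η hηm hηb hηz using fun g n => exists_local_rep z (hSc g n)
  have hηi : ∀ g n, Integrable ((S g n).indicator (η g n)) (Measure.haar : Measure G) := by
    intro g n
    rw [integrable_indicator_iff (hSc g n).measurableSet]
    have h1 : Integrable (fun x => ‖z‖ * ω x) ((Measure.haar : Measure G).restrict (S g n)) :=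
      Integrable.const_mul (ω.continuous_toFun.continuousOn.integrableOn_compact (hSc g n)) _
    exact h1.mono' (hηm g n).aestronglyMeasurable (Eventually.of_forall (hηb g n))
  choose v hvc hv using fun g n => exists_continuous_seq_tendsto_ae (hηi g n)
  have hcont : ∀ n k, Continuous fun x => v (s x) n k x := by
    intro n k
    rw [continuous_iff_continuousAt]
    intro x₀
    have h1 : ∀ᶠ x in 𝓝 x₀, x₀⁻¹ * x ∈ H := by
      have : IsOpen {x | x₀⁻¹ * x ∈ H} := hH.preimage (continuous_const_mul x₀⁻¹)
      refine this.mem_nhds ?_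
      change x₀⁻¹ * x₀ ∈ H
      rw [inv_mul_cancel]
      exact H.one_mem
    refine ((hvc (s x₀) n k).continuousAt).congr ?_
    filter_upwards [h1] with x hx
    rw [hs3 x₀ x hx]
  -- Borel measurability over uncountably many cosets comes from writing the representative as an
  -- iterated limit of continuous functions: `k → ∞` recovers the local representatives on the
  -- `n`-th compact set of every coset at once, and `n → ∞` exhausts the cosets.
  let h₁ : ℕ → G → ℂ := fun n x => limUnder atTop fun k => v (s x) n k x
  have hh₁ : ∀ n, StronglyMeasurable (h₁ n) := fun n =>
    StronglyMeasurable.limUnder fun k => (hcont n k).measurable.stronglyMeasurable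
  let h₂ : G → ℂ := fun x => limUnder atTop fun n => h₁ n x
  have hh₂ : StronglyMeasurable h₂ := StronglyMeasurable.limUnder hh₁
  have hset : MeasurableSet {x | ‖h₂ x‖ ≤ ‖z‖ * ω x} :=
    measurableSet_le hh₂.measurable.norm (ω.continuous_toFun.measurable.const_mul _)
  set h : G → ℂ := {x | ‖h₂ x‖ ≤ ‖z‖ * ω x}.indicator h₂ with hh
  have hm : Measurable h := hh₂.measurable.indicator hset
  have hC : ∀ x, ‖h x‖ ≤ ‖z‖ * ω x := by
    intro x
    by_cases hx : x ∈ {x | ‖h₂ x‖ ≤ ‖z‖ * ω x}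
    · rw [hh, indicator_of_mem hx]
      exact hx
    · rw [hh, indicator_of_notMem hx, norm_zero]
      exact mul_nonneg (norm_nonneg _) (weight_pos ω x).le
  -- Within a single coset only countably many null sets are discarded.
  have hae : ∀ x₀ N, ∀ᵐ x ∂(Measure.haar : Measure G), x ∈ S (s x₀) N → h x = η (s x₀) N x := by
    intro x₀ N
    have h1 : ∀ᵐ x ∂(Measure.haar : Measure G), ∀ n,
        Tendsto (fun k => v (s x₀) n k x) atTop (𝓝 ((S (s x₀) n).indicator (η (s x₀) n) x)) :=
      ae_all_iff.2 fun n => hv (s x₀) n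
    have h2 : ∀ᵐ x ∂(Measure.haar : Measure G), ∀ n, N ≤ n → x ∈ S (s x₀) N →
        η (s x₀) n x = η (s x₀) N x := by
      refine ae_all_iff.2 fun n => ?_
      by_cases hn : N ≤ n
      · filter_upwards [local_rep_unique (hSc (s x₀) N) (hSc (s x₀) n) (hSm (s x₀) hn)
          (hηm _ _) (hηm _ _) (hηb _ _) (hηb _ _) (hηz _ _) (hηz _ _)] with x hx _
        exact hx
      · exact Eventually.of_forall fun x hx => absurd hx hn
    filter_upwards [h1, h2] with x h1 h2 hxS
    have hsx : s x = s x₀ := hSs x₀ N x hxS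
    have h3 : ∀ n, N ≤ n → h₁ n x = η (s x₀) N x := by
      intro n hn
      have h4 := (h1 n).limUnder_eq
      rw [indicator_of_mem (hSm _ hn hxS), h2 n hn hxS] at h4
      simp only [h₁, hsx]
      exact h4
    have h5 : h₂ x = η (s x₀) N x := by
      refine Tendsto.limUnder_eq (tendsto_const_nhds.congr' ?_)
      filter_upwards [eventually_ge_atTop N] with n hn
      exact (h3 n hn).symm
    have h6 : x ∈ {x | ‖h₂ x‖ ≤ ‖z‖ * ω x} := by
      change ‖h₂ x‖ ≤ ‖z‖ * ω x
      rw [h5]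
      exact hηb _ _ _
    rw [hh, indicator_of_mem h6, h5]
  refine ⟨h, hm, hC, dual_ext_cc fun a ha ha' _ => ?_⟩
  set ψ := dualOfFun (ω := ω) h hm.aestronglyMeasurable ‖z‖ hC with hψ
  -- The exceptional null sets of different cosets cannot be united, so the equality is proved near
  -- each point and spread over the compact support of `a`.
  have hloc : ∃ Q, tsupport (fun x => (a x : ℂ)) ⊆ Q ∧ MeasurableSet Q ∧ ∀ f : G → ℂ, Measurable f →
      (∃ C : ℝ, ∀ x, ‖f x‖ ≤ C) → (∀ x, x ∉ Q → f x = 0) → ∀ hf : MemLp f 1 ω.measure,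
        z (mk f hf) = ψ (mk f hf) := by
    refine IsCompact.induction_on (p := fun P => ∃ Q, P ⊆ Q ∧ MeasurableSet Q ∧ ∀ f : G → ℂ,
      Measurable f → (∃ C : ℝ, ∀ x, ‖f x‖ ≤ C) → (∀ x, x ∉ Q → f x = 0) →
        ∀ hf : MemLp f 1 ω.measure, z (mk f hf) = ψ (mk f hf)) ha'.isCompact ?_ ?_ ?_ ?_
    · refine ⟨∅, Subset.rfl, MeasurableSet.empty, fun f _ _ hf0 hf => ?_⟩
      have : mk f hf = (0 : ℂ) • mk f hf := ext_ae <| by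
        filter_upwards [coeFn_mk f hf, coeFn_smul 0 (mk f hf)] with x h1 h2
        rw [h1, h2, hf0 x (notMem_empty x), zero_mul]
      rw [this, zero_smul, map_zero, map_zero]
    · rintro P P' hPP' ⟨Q, hQ, hQ'⟩
      exact ⟨Q, hPP'.trans hQ, hQ'⟩
    · rintro P P' ⟨Q, hPQ, hQ, hQz⟩ ⟨Q', hPQ', hQ', hQz'⟩
      refine ⟨Q ∪ Q', union_subset_union hPQ hPQ', hQ.union hQ', fun f hfm hfb hf0 hf => ?_⟩
      obtain ⟨B, hB⟩ := hfb
      have hind : ∀ R : Set G, ∀ x, ‖R.indicator f x‖ ≤ B := fun R x =>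
        (norm_indicator_le_norm_self f x).trans (hB x)
      have e1 := hQz (Q.indicator f) (hfm.indicator hQ) ⟨B, hind Q⟩
        (fun x hx => indicator_of_notMem hx f) (hf.indicator hQ)
      have e2 := hQz' (Qᶜ.indicator f) (hfm.indicator hQ.compl) ⟨B, hind Qᶜ⟩
        (fun x hx => by
          by_cases hxQ : x ∈ Q
          · simp [hxQ]
          · rw [indicator_of_mem (show x ∈ Qᶜ from hxQ)]
            exact hf0 x fun h => h.elim hxQ hx) (hf.indicator hQ.compl)
      have e3 : mk f hf = mk (Q.indicator f) (hf.indicator hQ) +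
          mk (Qᶜ.indicator f) (hf.indicator hQ.compl) := ext_ae <| by
        filter_upwards [coeFn_mk f hf, coeFn_mk _ (hf.indicator hQ),
          coeFn_mk _ (hf.indicator hQ.compl),
          coeFn_add (mk _ (hf.indicator hQ)) (mk _ (hf.indicator hQ.compl))] with x h1 h2 h3 h4
        rw [h1, h4, h2, h3]
        exact (congrFun (indicator_self_add_compl Q f) x).symm
      rw [e3, map_add, map_add, e1, e2]
    · intro x _
      obtain ⟨N, hN⟩ := hKn _ (hs2 x)
      have hnhds : S (s x) N ∈ 𝓝 x := by
        have := (Homeomorph.mulLeft (s x)).isOpenMap.image_mem_nhds hN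
        rw [Homeomorph.coe_mulLeft] at this
        simp only [mul_inv_cancel_left] at this
        exact this
      refine ⟨S (s x) N, mem_nhdsWithin_of_mem_nhds hnhds, S (s x) N, Subset.rfl,
        (hSc _ _).measurableSet, fun f hfm hfb hf0 hf => ?_⟩
      have e0 : (S (s x) N).indicator f = f := by
        rw [indicator_eq_self]
        intro y hy
        by_contra hyS
        exact hy (hf0 y hyS)
      have hf' : MemLp ((S (s x) N).indicator f) 1 ω.measure := by rwa [e0]
      have e1 := hηz (s x) N f hfm hfb hf'
      have e2 : mk f hf = mk _ hf' := mk_congr (by rw [e0]) _ _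
      rw [hψ, dualOfFun_mk, e2, e1, ← integral_indicator (hSc _ _).measurableSet]
      refine integral_congr_ae ?_
      filter_upwards [hae x N] with y hy
      by_cases hyS : y ∈ S (s x) N
      · rw [indicator_of_mem hyS, hy hyS]
      · rw [indicator_of_notMem hyS, hf0 y hyS, mul_zero]
  obtain ⟨Q, hQ, -, hQz⟩ := hloc
  refine hQz _ ha.measurable (ha.bounded_above_of_compact_support ha') (fun x hx => ?_) _
  exact image_eq_zero_of_notMem_tsupport (f := fun x => (a x : ℂ)) fun h => hx (hQ h)

end BeurlingAlgebra

/-! ### Inclusions between Beurling algebras -/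

namespace BeurlingAlgebra

variable {G : Type*} [Group G] [TopologicalSpace G] [IsTopologicalGroup G] [LocallyCompactSpace G]
  [MeasurableSpace G] [BorelSpace G] {ω₁ ω₂ : GroupWeight G}

theorem lintegral_weight_le {m : ℝ} (hm : ∀ x, ω₁ x ≤ m * ω₂ x) (f : G → ℂ) :
    ∫⁻ x, ENNReal.ofReal (ω₁ x) * ‖f x‖ₑ ∂(Measure.haar : Measure G) ≤
      ENNReal.ofReal m * ∫⁻ x, ENNReal.ofReal (ω₂ x) * ‖f x‖ₑ ∂(Measure.haar : Measure G) := by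
  rw [← lintegral_const_mul' _ _ ENNReal.ofReal_ne_top]
  refine lintegral_mono fun x => ?_
  rw [← mul_assoc, ← ENNReal.ofReal_mul' (weight_pos ω₂ x).le]
  gcongr
  exact hm x

theorem memLp_of_weight_le {m : ℝ} (hm : ∀ x, ω₁ x ≤ m * ω₂ x) {f : G → ℂ}
    (hf : MemLp f 1 ω₂.measure) : MemLp f 1 ω₁.measure := by
  rw [memLp_iff] at hf ⊢
  exact ⟨hf.1, (lintegral_weight_le hm f).trans_lt (ENNReal.mul_lt_top ENNReal.ofReal_lt_top hf.2)⟩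

/-- The inclusion `L¹(G, ω₂) → L¹(G, ω₁)` when `ω₁ ≤ m ω₂`. -/
def inclusion {m : ℝ} (hm0 : 0 ≤ m) (hm : ∀ x, ω₁ x ≤ m * ω₂ x) :
    BeurlingAlgebra ω₂ →L[ℂ] BeurlingAlgebra ω₁ :=
  LinearMap.mkContinuous
    { toFun := fun f => mk f (memLp_of_weight_le hm (memLp f))
      map_add' := fun f g => ext_ae <| by
        filter_upwards [coeFn_mk _ (memLp_of_weight_le hm (memLp (f + g))),
          coeFn_mk _ (memLp_of_weight_le hm (memLp f)), coeFn_mk _ (memLp_of_weight_le hm (memLp g)),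
          coeFn_add f g, coeFn_add (mk _ (memLp_of_weight_le hm (memLp f)))
            (mk _ (memLp_of_weight_le hm (memLp g)))] with x h1 h2 h3 h4 h5
        rw [h1, h5, h2, h3, h4]
      map_smul' := fun c f => ext_ae <| by
        filter_upwards [coeFn_mk _ (memLp_of_weight_le hm (memLp (c • f))),
          coeFn_mk _ (memLp_of_weight_le hm (memLp f)), coeFn_smul c f,
          coeFn_smul c (mk _ (memLp_of_weight_le hm (memLp f)))] with x h1 h2 h4 h5
        rw [RingHom.id_apply, h1, h5, h2, h4] }
    m (fun f => by
      rw [← ENNReal.ofReal_le_ofReal_iff (mul_nonneg hm0 (norm_nonneg f)), ENNReal.ofReal_mul hm0,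
        enorm_eq, enorm_eq]
      refine le_trans (le_of_eq (lintegral_congr_ae ?_)) (lintegral_weight_le hm f)
      filter_upwards [coeFn_mk _ (memLp_of_weight_le hm (memLp f))] with x h1
      simp only [LinearMap.coe_mk, AddHom.coe_mk, h1])

theorem coeFn_inclusion {m : ℝ} (hm0 : 0 ≤ m) (hm : ∀ x, ω₁ x ≤ m * ω₂ x)
    (f : BeurlingAlgebra ω₂) : inclusion hm0 hm f =ᵐ[(Measure.haar : Measure G)] f :=
  coeFn_mk _ (memLp_of_weight_le hm (memLp f))

theorem inclusion_mk {m : ℝ} (hm0 : 0 ≤ m) (hm : ∀ x, ω₁ x ≤ m * ω₂ x) {f : G → ℂ}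
    (hf : MemLp f 1 ω₂.measure) (hf' : MemLp f 1 ω₁.measure) :
    inclusion hm0 hm (mk f hf) = mk f hf' :=
  ext_ae ((coeFn_inclusion hm0 hm _).trans ((coeFn_mk f hf).trans (coeFn_mk f hf').symm))

theorem inclusion_translate {m : ℝ} (hm0 : 0 ≤ m) (hm : ∀ x, ω₁ x ≤ m * ω₂ x) (y : G)
    (f : BeurlingAlgebra ω₂) :
    inclusion hm0 hm (translate y f) = translate y (inclusion hm0 hm f) := ext_ae <| by
  filter_upwards [coeFn_inclusion hm0 hm (translate y f), coeFn_translate y f,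
    coeFn_translate y (inclusion hm0 hm f), comp_mul_left_ae (coeFn_inclusion hm0 hm f) y]
    with x h1 h2 h3 h4
  rw [h1, h2, h3, h4]

variable [T2Space G]

theorem inclusion_mul {m : ℝ} (hm0 : 0 ≤ m) (hm : ∀ x, ω₁ x ≤ m * ω₂ x)
    (f g : BeurlingAlgebra ω₂) :
    inclusion hm0 hm (f * g) = inclusion hm0 hm f * inclusion hm0 hm g := by
  rw [mul_def, mul_def, ← ContinuousLinearMap.integral_comp_comm _ (integrable_smul_translate f g)]
  refine integral_congr_ae ?_
  filter_upwards [coeFn_inclusion hm0 hm f] with y hy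
  rw [hy, map_smul, inclusion_translate]

/-- The pullback of a map `L¹(G, ω₁) → L¹(G, ω₁)*` along the inclusion. -/
def pullback {m : ℝ} (hm0 : 0 ≤ m) (hm : ∀ x, ω₁ x ≤ m * ω₂ x)
    (D : BeurlingAlgebra ω₁ →L[ℂ] StrongDual ℂ (BeurlingAlgebra ω₁)) :
    BeurlingAlgebra ω₂ →L[ℂ] StrongDual ℂ (BeurlingAlgebra ω₂) :=
  (((ContinuousLinearMap.compL ℂ (BeurlingAlgebra ω₂) (BeurlingAlgebra ω₁) ℂ).flip
    (inclusion hm0 hm)).comp D).comp (inclusion hm0 hm)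

theorem pullback_apply {m : ℝ} (hm0 : 0 ≤ m) (hm : ∀ x, ω₁ x ≤ m * ω₂ x)
    (D : BeurlingAlgebra ω₁ →L[ℂ] StrongDual ℂ (BeurlingAlgebra ω₁)) (f g : BeurlingAlgebra ω₂) :
    pullback hm0 hm D f g = D (inclusion hm0 hm f) (inclusion hm0 hm g) := rfl

theorem isDualDerivation_pullback {m : ℝ} (hm0 : 0 ≤ m) (hm : ∀ x, ω₁ x ≤ m * ω₂ x)
    {D : BeurlingAlgebra ω₁ →L[ℂ] StrongDual ℂ (BeurlingAlgebra ω₁)} (hD : IsDualDerivation D) :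
    IsDualDerivation (pullback hm0 hm D) := fun a b c => by
  simp only [pullback_apply, inclusion_mul, hD _ _ _]

end BeurlingAlgebra

/-! ### Quasi-additive functions and commutators -/

section HaarLocallyAE

variable {X : Type*} [Group X] [TopologicalSpace X] [IsTopologicalGroup X] [LocallyCompactSpace X]

theorem HaarLocallyAE.ae_mem [MeasurableSpace X] [BorelSpace X] {P : X → Prop}
    (h : HaarLocallyAE P) {K : Set X} (hK : IsCompact K) :
    ∀ᵐ x ∂(Measure.haar : Measure X), x ∈ K → P x := by
  obtain rfl := BorelSpace.measurable_eq (α := X)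
  rw [ae_iff]
  simp only [Classical.not_imp]
  exact h K hK

theorem haarLocallyAE_of_forall {P : X → Prop} (h : ∀ x, P x) : HaarLocallyAE P := by
  intro K _
  simp [h]

theorem HaarLocallyAE.mono {P Q : X → Prop} (h : HaarLocallyAE P) (hPQ : ∀ x, P x → Q x) :
    HaarLocallyAE Q := by
  intro K hK
  refine measure_mono_null ?_ (h K hK)
  exact fun x hx => ⟨hx.1, fun hP => hx.2 (hPQ x hP)⟩

end HaarLocallyAE

section QuasiAdditiveCommutator

variable {G : Type*} [Group G] [TopologicalSpace G] [IsTopologicalGroup G] [LocallyCompactSpace G]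

theorem MemLInftyWeight.of_le {ω₁ ω₂ : GroupWeight G} {m : ℝ} (hm : ∀ x, ω₁ x ≤ m * ω₂ x)
    {h : G → ℂ} (hh : MemLInftyWeight ω₁ h) : MemLInftyWeight ω₂ h := by
  obtain ⟨hmeas, C, hC⟩ := hh
  refine ⟨hmeas, C * m, hC.mono fun x hx => ?_⟩
  have h1 : 0 < ω₁ x := zero_lt_one.trans_le (ω₁.one_le_toFun x)
  have h2 : 0 < ω₂ x := zero_lt_one.trans_le (ω₂.one_le_toFun x)
  rw [norm_div, Complex.norm_real, Real.norm_of_nonneg h1.le, div_le_iff₀ h1] at hx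
  rw [norm_div, Complex.norm_real, Real.norm_of_nonneg h2.le, div_le_iff₀ h2, mul_assoc]
  have hC0 : 0 ≤ C := by
    by_contra! hC0
    exact ((mul_neg_of_neg_of_pos hC0 h1).trans_le (norm_nonneg _)).not_ge hx
  exact hx.trans (mul_le_mul_of_nonneg_left (hm x) hC0)

theorem innerQuasiAdditive_subset {ω₁ ω₂ : GroupWeight G} {m : ℝ} (hm : ∀ x, ω₁ x ≤ m * ω₂ x) :
    innerQuasiAdditive ω₁ ⊆ innerQuasiAdditive ω₂ := fun _ ⟨hp, h, hh, hph⟩ =>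
  ⟨hp, h, hh.of_le hm, hph⟩

/-- The identity telescopes through `h(yzx)`, by associativity alone. -/
theorem isQuasiAdditive_commutator {h : G → ℂ} (hh : Measurable[borel G] h) :
    IsQuasiAdditive fun t : G × G => h (t.1 * t.2) - h (t.2 * t.1) := by
  refine ⟨?_, haarLocallyAE_of_forall fun t => ?_⟩
  · have h1 : Measurable[borel (G × G), borel G] fun t : G × G => t.1 * t.2 :=
      (by fun_prop : Continuous fun t : G × G => t.1 * t.2).borel_measurable
    have h2 : Measurable[borel (G × G), borel G] fun t : G × G => t.2 * t.1 :=
      (by fun_prop : Continuous fun t : G × G => t.2 * t.1).borel_measurable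
    exact Measurable.sub (m := borel (G × G)) (hh.comp h1) (hh.comp h2)
  · simp only [mul_assoc]
    ring

variable [MeasurableSpace G] [BorelSpace G]

theorem memLInftyWeight_of_le {ω : GroupWeight G} {h : G → ℂ} (hm : Measurable h) {C : ℝ}
    (hC : ∀ x, ‖h x‖ ≤ C * ω x) : MemLInftyWeight ω h := by
  obtain rfl := BorelSpace.measurable_eq (α := G)
  refine ⟨hm, C, haarLocallyAE_of_forall fun x => ?_⟩
  have h1 : 0 < ω x := zero_lt_one.trans_le (ω.one_le_toFun x)
  rw [norm_div, Complex.norm_real, Real.norm_of_nonneg h1.le, div_le_iff₀ h1]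
  exact hC x

/-- A function in `L^∞(G, 1/ω)` can be changed on a locally null set so as to be dominated by `ω`
everywhere. -/
theorem MemLInftyWeight.exists_bounded {ω : GroupWeight G} {h : G → ℂ} (hh : MemLInftyWeight ω h) :
    Measurable h ∧ ∃ (k : G → ℂ) (C : ℝ), Measurable k ∧ (∀ x, ‖k x‖ ≤ C * ω x) ∧
      ∀ K : Set G, IsCompact K → ∀ᵐ x ∂(Measure.haar : Measure G), x ∈ K → h x = k x := by
  obtain ⟨hm, C, hC⟩ := hh
  have hm' : Measurable h := by
    obtain rfl := BorelSpace.measurable_eq (α := G)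
    exact hm
  have hω : ∀ x, 0 < ω x := fun x => zero_lt_one.trans_le (ω.one_le_toFun x)
  have hset : MeasurableSet {x | ‖h x‖ ≤ max C 0 * ω x} :=
    measurableSet_le hm'.norm (ω.continuous_toFun.measurable.const_mul _)
  refine ⟨hm', {x | ‖h x‖ ≤ max C 0 * ω x}.indicator h, max C 0, hm'.indicator hset, fun x => ?_,
    fun K hK => ?_⟩
  · by_cases hx : x ∈ {x | ‖h x‖ ≤ max C 0 * ω x}
    · rw [indicator_of_mem hx]
      exact hx
    · rw [indicator_of_notMem hx, norm_zero]
      exact mul_nonneg (le_max_right _ _) (hω x).le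
  · filter_upwards [hC.ae_mem hK] with x hx hxK
    have h1 := hx hxK
    rw [norm_div, Complex.norm_real, Real.norm_of_nonneg (hω x).le, div_le_iff₀ (hω x)] at h1
    exact (indicator_of_mem (show x ∈ {x | ‖h x‖ ≤ max C 0 * ω x} from
      h1.trans (mul_le_mul_of_nonneg_right (le_max_left _ _) (hω x).le)) h).symm

/-! ### Commutator integrals and the transfer of weak amenability -/

variable [T2Space G]

open BeurlingAlgebra

/-- Each side is the integral of a commutator against `a ⊗ c` for the pair measure. The density has
compact support, so agreement locally almost everywhere is enough, and the pair measure is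
absolutely continuous with respect to Haar measure. -/
theorem commutator_integral_eq {X : Type*} [Group X] [TopologicalSpace X] [IsTopologicalGroup X]
    [LocallyCompactSpace X] [T2Space X] [MeasurableSpace X] [BorelSpace X] (e : X ≃ₜ* G × G)
    {h k : G → ℂ} (hh : Measurable h) (hk : Measurable k)
    (hhk : HaarLocallyAE fun t : X => h ((e t).1 * (e t).2) - h ((e t).2 * (e t).1) =
      k ((e t).1 * (e t).2) - k ((e t).2 * (e t).1))
    {a c : G → ℝ} (ha : Continuous fun x => (a x : ℂ)) (ha' : HasCompactSupport fun x => (a x : ℂ))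
    (hc : Continuous fun x => (c x : ℂ)) (hc' : HasCompactSupport fun x => (c x : ℂ))
    (ha0 : ∀ x, 0 ≤ a x) (hc0 : ∀ x, 0 ≤ c x)
    (hih : ∀ u : G → ℂ, Continuous u → HasCompactSupport u →
      Integrable (fun z => h z * u z) (Measure.haar : Measure G))
    (hik : ∀ u : G → ℂ, Continuous u → HasCompactSupport u →
      Integrable (fun z => k z * u z) (Measure.haar : Measure G)) :
    ∫ z, h z * cconv (fun x => (a x : ℂ)) (fun x => (c x : ℂ)) z ∂(Measure.haar : Measure G) -
      ∫ z, h z * cconv (fun x => (c x : ℂ)) (fun x => (a x : ℂ)) z ∂(Measure.haar : Measure G) =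
    ∫ z, k z * cconv (fun x => (a x : ℂ)) (fun x => (c x : ℂ)) z ∂(Measure.haar : Measure G) -
      ∫ z, k z * cconv (fun x => (c x : ℂ)) (fun x => (a x : ℂ)) z ∂(Measure.haar : Measure G) := by
  obtain ⟨ν, hνr, hνac, hν⟩ := exists_pair_measure e
  have hac := continuous_cconv ha ha' hc
  have hac' := hasCompactSupport_cconv ha' hc'
  have hca := continuous_cconv hc hc' ha
  have hca' := hasCompactSupport_cconv hc' ha'
  rw [integral_cconv_eq_pair hν ha ha' hc hc' ha0 hc0 hh (hih _ hac hac') (hih _ hca hca'),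
    integral_cconv_eq_pair hν ha ha' hc hc' ha0 hc0 hk (hik _ hac hac') (hik _ hca hca')]
  have hK : IsCompact (e.symm '' (tsupport (fun x => (a x : ℂ)) ×ˢ tsupport fun x => (c x : ℂ))) :=
    (ha'.isCompact.prod hc'.isCompact).image e.symm.continuous
  refine integral_congr_ae ?_
  filter_upwards [hνac.ae_le (hhk.ae_mem hK)] with t ht
  by_cases htK : t ∈ e.symm '' (tsupport (fun x => (a x : ℂ)) ×ˢ tsupport fun x => (c x : ℂ))
  · rw [ht htK]
  · have h0 : ((a (e t).1 * c (e t).2 : ℝ) : ℂ) = 0 := by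
      push_cast
      by_contra hne
      rw [mul_eq_zero, not_or] at hne
      exact htK ⟨e t, ⟨subset_tsupport (fun x => (a x : ℂ)) hne.1,
        subset_tsupport (fun x => (c x : ℂ)) hne.2⟩, e.symm_apply_apply t⟩
    rw [h0, mul_zero, mul_zero]

/-- The functional implementing the pulled-back derivation matters only through the commutator of
its representing function. The inclusion of the sets `I` replaces that function by one dominated by
`ω₁` with the same commutator, which therefore defines a functional on the larger algebra. -/
theorem weaklyAmenable_of_innerQuasiAdditive_subset {ω₁ ω₂ : GroupWeight G} {m : ℝ} (hm0 : 0 ≤ m)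
    (hm : ∀ x, ω₁ x ≤ m * ω₂ x) (hA : WeaklyAmenable (BeurlingAlgebra ω₂))
    (hI : innerQuasiAdditive ω₂ ⊆ innerQuasiAdditive ω₁) :
    WeaklyAmenable (BeurlingAlgebra ω₁) := by
  intro D hD
  obtain ⟨z, hz⟩ := hA _ (isDualDerivation_pullback hm0 hm hD)
  obtain ⟨h, hhm, hhC, hzh⟩ := exists_measurable_rep z
  have hmem := memLInftyWeight_of_le hhm hhC
  obtain ⟨-, h₁, hh₁, hhh₁⟩ := hI ⟨isQuasiAdditive_commutator hmem.1, h, hmem,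
    haarLocallyAE_of_forall fun _ => rfl⟩
  -- The bound on `h₁` holds only locally almost everywhere; `k` satisfies it at every point and has
  -- the same integrals against `C_c`.
  obtain ⟨hm₁, k, C, hkm, hkC, hhk⟩ := hh₁.exists_bounded
  have hae : ∀ u : G → ℂ, HasCompactSupport u →
      (fun x => h₁ x * u x) =ᵐ[(Measure.haar : Measure G)] fun x => k x * u x := by
    intro u hu
    filter_upwards [hhk _ hu.isCompact] with x hx
    by_cases hxu : x ∈ tsupport u
    · rw [hx hxu]
    · rw [image_eq_zero_of_notMem_tsupport hxu, mul_zero, mul_zero]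
  have hint : ∀ {ω : GroupWeight G} {l : G → ℂ} {B : ℝ}, Measurable l → (∀ x, ‖l x‖ ≤ B * ω x) →
      ∀ u : G → ℂ, Continuous u → HasCompactSupport u →
        Integrable (fun x => l x * u x) (Measure.haar : Measure G) := by
    intro ω l B hl hlB u hu hu'
    refine (integrable_mul hl.aestronglyMeasurable hlB
      (mk (ω := ω) u (memLp_of_cc hu hu'))).congr ?_
    filter_upwards [coeFn_mk (ω := ω) u (memLp_of_cc hu hu')] with x hx
    rw [hx]
  refine ⟨dualOfFun k hkm.aestronglyMeasurable C hkC, eq_commutator_of_cc D _ ?_⟩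
  intro a c ha ha' hc hc' ha0 hc0
  have h1 := hz (mk _ (memLp_of_cc ha ha')) (mk _ (memLp_of_cc hc hc'))
  rw [pullback_apply, inclusion_mk hm0 hm _ (memLp_of_cc ha ha'),
    inclusion_mk hm0 hm _ (memLp_of_cc hc hc'), mk_mul_mk ha ha' hc hc', mk_mul_mk hc hc' ha ha',
    hzh, dualOfFun_mk, dualOfFun_mk] at h1
  rw [h1, mk_mul_mk ha ha' hc hc', mk_mul_mk hc hc' ha ha', dualOfFun_mk, dualOfFun_mk,
    ← integral_congr_ae (hae _ (hasCompactSupport_cconv ha' hc')),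
    ← integral_congr_ae (hae _ (hasCompactSupport_cconv hc' ha'))]
  -- The instances are explicit so that `G × G` carries its full Borel `σ`-algebra, as in
  -- `HaarLocallyAE`, and not the product one.
  exact @commutator_integral_eq G _ _ _ _ _ _ _ (G × G) _ _ _ _ _ (borel (G × G))
    (@BorelSpace.mk _ _ (borel (G × G)) rfl)
    (ContinuousMulEquiv.refl (G × G)) h h₁ hhm hm₁ hhh₁ a c ha ha' hc hc' ha0 hc0
    (hint hhm hhC) fun u hu hu' => (hint hkm hkC u hu hu').congr (hae u hu').symm

/-- `ω₁* ≤ m² ω₂*`, and `ω₂*` is bounded by the square of a bound for `ω₂`. -/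
theorem GroupWeight.isBounded_adj_of_le {ω₁ ω₂ : GroupWeight G} {m : ℝ}
    (hm : ∀ x, ω₁ x ≤ m * ω₂ x) (h : ω₂.IsBounded ∨ ω₂.adj.IsBounded) : ω₁.adj.IsBounded := by
  have h0 : ∀ (ω : GroupWeight G) x, 0 ≤ ω x := fun ω x => zero_le_one.trans (ω.one_le_toFun x)
  have hadj : ω₂.adj.IsBounded := by
    refine h.elim (fun ⟨C, hC⟩ => ⟨C * C, fun x => ?_⟩) id
    exact mul_le_mul (hC _) (hC _) (h0 _ _) ((h0 _ x).trans (hC x))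
  obtain ⟨C, hC⟩ := hadj
  refine ⟨m * m * C, fun x => ?_⟩
  calc ω₁ x * ω₁ x⁻¹ ≤ (m * ω₂ x) * (m * ω₂ x⁻¹) :=
        mul_le_mul (hm _) (hm _) (h0 _ _) ((h0 _ x).trans (hm x))
    _ = m * m * (ω₂ x * ω₂ x⁻¹) := by ring
    _ ≤ m * m * C := mul_le_mul_of_nonneg_left (hC x) (mul_self_nonneg m)

end QuasiAdditiveCommutator

end

/-! ### Comparison of weights and invariance under equivalence -/

theorem proposition3p3 {G : Type*} [Group G] [TopologicalSpace G] [IsTopologicalGroup G]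
    [LocallyCompactSpace G] [T2Space G] [MeasurableSpace G] [BorelSpace G]
    (ω₁ ω₂ : GroupWeight G) :
    ((∃ m : ℝ, 0 < m ∧ ∀ x, ω₁ x ≤ m * ω₂ x) →
      (WeaklyAmenable (BeurlingAlgebra ω₂) →
          innerQuasiAdditive ω₁ = innerQuasiAdditive ω₂ →
          WeaklyAmenable (BeurlingAlgebra ω₁)) ∧
      (ω₂.IsBounded ∨ ω₂.adj.IsBounded → WeaklyAmenable (BeurlingAlgebra ω₁))) ∧
    (ω₁.Equivalent ω₂ →
      (WeaklyAmenable (BeurlingAlgebra ω₁) ↔ WeaklyAmenable (BeurlingAlgebra ω₂))) := by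
  refine ⟨fun ⟨m, hm0, hm⟩ => ⟨fun hA hI => ?_, fun h => ?_⟩, fun ⟨m, n, hm, hn, hmn⟩ => ?_⟩
  · exact weaklyAmenable_of_innerQuasiAdditive_subset hm0.le hm hA hI.ge
  · exact BeurlingAlgebra.weaklyAmenable_of_isBounded_adj (GroupWeight.isBounded_adj_of_le hm h)
  · have h1 : ∀ x, ω₁ x ≤ m⁻¹ * ω₂ x := fun x => by
      rw [← div_eq_inv_mul, le_div_iff₀' hm]
      exact (hmn x).1
    have h2 : ∀ x, ω₂ x ≤ n * ω₁ x := fun x => (hmn x).2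
    -- Each direction uses one inequality for the inclusion of algebras and the reverse inequality
    -- for the inclusion of the sets `I`.
    exact ⟨fun h => weaklyAmenable_of_innerQuasiAdditive_subset hn.le h2 h
        (innerQuasiAdditive_subset h1),
      fun h => weaklyAmenable_of_innerQuasiAdditive_subset (inv_nonneg.2 hm.le) h1 h
        (innerQuasiAdditive_subset h2)⟩
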